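/- Let $h=\sin$ with $\theta\in(0,\pi)$ (Kantowski--Sachs) or $h=\sinh$ with $\theta\in(0,\infty)$ (Bianchi type III). Let $I\subseteq\mathbb R$ be a nonempty open interval, $A:I\to\mathbb R$ a smooth nowhere zero function, $\gamma_0\neq 0$ a real constant, $\Psi=\gamma_0\int dt/A$ ($\int dt/A$ being any antiderivative of $1/A$ on $I$) and $B=\gamma_0^{-1}A\cosh\Psi$. On the coordinate domain $U=\{(t,r,\theta,\phi): t\in I,\ r\in\mathbb R,\ 0<\phi<2\pi\}$, with $\theta$ in the range above, consider the Lorentzian metric $$g=-dt^2+A^2(t)\Big[dr^2+\gamma_0^{-2}\cosh^2\!\Big(\gamma_0\!\int\!\tfrac{dt}{A}\Big)\big(d\theta^2+h^2(\theta)\,d\phi^2\big)\Big].$$ A smooth vector field $X$ on $U$ is conformal Killing if $\mathcal L_Xg=2\alpha g$ for a smooth function $\alpha$, and concircular, with conformal factors $\alpha$ and $\beta$, if moreover $\nabla_a\nabla_b\alpha=\beta g_{ab}$ for a function $\beta$. 1. The four linearly independent fields $$\partial_r,\quad \cos\phi\,\partial_\theta-\tfrac{h'(\theta)}{h(\theta)}\sin\phi\,\partial_\phi,\quad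 \sin\phi\,\partial_\theta+\tfrac{h'(\theta)}{h(\theta)}\cos\phi\,\partial_\phi,\quad \partial_\phi$$ are concircular with $\alpha=\beta=0$ (in particular they are Killing fields). 2. If $h=\sin$, the space of conformal Killing vector fields of $g$ on $U$ has dimension $15$. 3. Suppose that $A$ is not exceptional, that is: (i) $B$ is not constant on $I$; (ii) if $h=\sin$, then $A$ is not constant on $I$; (iii) $A'\sinh\Psi+\gamma_0\cosh\Psi$ (that is, $A'+\gamma_0\coth\Psi$ up to the factor $\sinh\Psi$) does not vanish identically on $I$. Then the space of concircular vector fields of $g$ on $U$ is exactly four-dimensional, it is spanned by the four fields of part 1, and both conformal factors $\alpha$ and $\beta$ of every concircular vector field vanish identically on $U$. -/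

import Mathlib

open Set
open scoped ContDiff Matrix

noncomputable section

namespace Concircular

/-! ### Tensor calculus in a coordinate chart -/

/-- The partial derivative of `f` with respect to the `i`-th coordinate. -/
def pd {n : ℕ} (i : Fin n) (f : (Fin n → ℝ) → ℝ) (x : Fin n → ℝ) : ℝ :=
  fderiv ℝ f x (Pi.single i 1)

/-- The components `g_{ab,c} X^c + g_{cb} X^c_{,a} + g_{ac} X^c_{,b}` of the Lie derivative of
the metric `g` along the vector field `X`. -/
def lieDerivMetric {n : ℕ} (g : (Fin n → ℝ) → Matrix (Fin n) (Fin n) ℝ)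
    (X : (Fin n → ℝ) → Fin n → ℝ) (a b : Fin n) (x : Fin n → ℝ) : ℝ :=
  ∑ c, (pd c (fun y => g y a b) x * X x c
    + g x c b * pd a (fun y => X y c) x
    + g x a c * pd b (fun y => X y c) x)

/-- The Christoffel symbols of the second kind `Γ^c_{ab}` of the metric `g`. -/
def christoffel {n : ℕ} (g : (Fin n → ℝ) → Matrix (Fin n) (Fin n) ℝ)
    (c a b : Fin n) (x : Fin n → ℝ) : ℝ :=
  (1 / 2) * ∑ d, (g x)⁻¹ c d *
    (pd a (fun y => g y d b) x + pd b (fun y => g y d a) x - pd d (fun y => g y a b) x)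

/-- The components `f_{,ab} - Γ^c_{ab} f_{,c}` of the Hessian `∇_a ∇_b f`. -/
def hessian {n : ℕ} (g : (Fin n → ℝ) → Matrix (Fin n) (Fin n) ℝ)
    (f : (Fin n → ℝ) → ℝ) (a b : Fin n) (x : Fin n → ℝ) : ℝ :=
  pd a (pd b f) x - ∑ c, christoffel g c a b x * pd c f x

/-- `X` is a smooth conformal Killing vector field on `U` with (smooth) conformal factor `α`:
`L_X g = 2 α g`. -/
def IsConformalKillingWith {n : ℕ} (U : TopologicalSpace.Opens (Fin n → ℝ))
    (g : (Fin n → ℝ) → Matrix (Fin n) (Fin n) ℝ)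
    (X : (Fin n → ℝ) → Fin n → ℝ) (α : (Fin n → ℝ) → ℝ) : Prop :=
  ContDiffOn ℝ ∞ X U ∧ ContDiffOn ℝ ∞ α U ∧
    ∀ x ∈ U, ∀ a b, lieDerivMetric g X a b x = 2 * α x * g x a b

/-- `X` is a concircular vector field on `U` with conformal factors `α` and `β`:
`L_X g = 2 α g` and `∇∇ α = β g`. -/
def IsConcircularWith {n : ℕ} (U : TopologicalSpace.Opens (Fin n → ℝ))
    (g : (Fin n → ℝ) → Matrix (Fin n) (Fin n) ℝ)
    (X : (Fin n → ℝ) → Fin n → ℝ) (α β : (Fin n → ℝ) → ℝ) : Prop :=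
  IsConformalKillingWith U g X α ∧
    ∀ x ∈ U, ∀ a b, hessian g α a b x = β x * g x a b

section Closure

variable {n : ℕ} {U : TopologicalSpace.Opens (Fin n → ℝ)}
  {g : (Fin n → ℝ) → Matrix (Fin n) (Fin n) ℝ}

theorem differentiableAt_of_mem {F : Type*} [NormedAddCommGroup F] [NormedSpace ℝ F]
    {f : (Fin n → ℝ) → F} (hf : ContDiffOn ℝ ∞ f U) {x : Fin n → ℝ} (hx : x ∈ U) :
    DifferentiableAt ℝ f x :=
  (hf.contDiffAt (U.isOpen.mem_nhds hx)).differentiableAt (by simp)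

theorem differentiableAt_pd {f : (Fin n → ℝ) → ℝ} (hf : ContDiffOn ℝ ∞ f U)
    {x : Fin n → ℝ} (hx : x ∈ U) (i : Fin n) : DifferentiableAt ℝ (pd i f) x := by
  have h1 : ContDiffAt ℝ 1 (fderiv ℝ f) x :=
    (hf.contDiffAt (U.isOpen.mem_nhds hx)).fderiv_right (m := 1) (by norm_cast)
  exact (h1.differentiableAt (by simp)).clm_apply (differentiableAt_const _)

theorem pd_add {f f' : (Fin n → ℝ) → ℝ} {x : Fin n → ℝ} (hf : DifferentiableAt ℝ f x)
    (hf' : DifferentiableAt ℝ f' x) (i : Fin n) :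
    pd i (fun y => f y + f' y) x = pd i f x + pd i f' x := by
  simp only [pd, fderiv_fun_add hf hf', add_apply]

theorem pd_const_mul {f : (Fin n → ℝ) → ℝ} {x : Fin n → ℝ} (hf : DifferentiableAt ℝ f x)
    (c : ℝ) (i : Fin n) : pd i (fun y => c * f y) x = c * pd i f x := by
  simp only [pd, fderiv_const_mul hf, smul_apply, smul_eq_mul]

theorem pd_congr {f f' : (Fin n → ℝ) → ℝ} {x : Fin n → ℝ} (hx : x ∈ U)
    (h : ∀ y ∈ U, f y = f' y) (i : Fin n) : pd i f x = pd i f' x := by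
  have : f =ᶠ[nhds x] f' := Filter.eventually_of_mem (U.isOpen.mem_nhds hx) h
  simp only [pd, this.fderiv_eq]

theorem lieDerivMetric_comb {X Y : (Fin n → ℝ) → Fin n → ℝ} (hX : ContDiffOn ℝ ∞ X U)
    (hY : ContDiffOn ℝ ∞ Y U) (c : ℝ) {x : Fin n → ℝ} (hx : x ∈ U) (a b : Fin n) :
    lieDerivMetric g (X + c • Y) a b x = lieDerivMetric g X a b x + c * lieDerivMetric g Y a b x := by
  have hX' := fun k => differentiableAt_pi.1 (differentiableAt_of_mem hX hx) k
  have hY' := fun k => differentiableAt_pi.1 (differentiableAt_of_mem hY hx) k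
  have key : ∀ i k, pd i (fun y => (X + c • Y) y k) x
      = pd i (fun y => X y k) x + c * pd i (fun y => Y y k) x := by
    intro i k
    simp only [Pi.add_apply, Pi.smul_apply, smul_eq_mul]
    rw [pd_add (hX' k) ((hY' k).const_mul c), pd_const_mul (hY' k)]
  simp only [lieDerivMetric, key, Finset.mul_sum, ← Finset.sum_add_distrib]
  refine Finset.sum_congr rfl fun k _ => ?_
  simp only [Pi.add_apply, Pi.smul_apply, smul_eq_mul]
  ring

theorem hessian_comb {f f' : (Fin n → ℝ) → ℝ} (hf : ContDiffOn ℝ ∞ f U)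
    (hf' : ContDiffOn ℝ ∞ f' U) (c : ℝ) {x : Fin n → ℝ} (hx : x ∈ U) (a b : Fin n) :
    hessian g (f + c • f') a b x = hessian g f a b x + c * hessian g f' a b x := by
  have key : ∀ i, ∀ y ∈ U, pd i (f + c • f') y = pd i f y + c * pd i f' y := by
    intro i y hy
    have h1 := differentiableAt_of_mem hf hy
    have h2 := differentiableAt_of_mem hf' hy
    have := pd_add h1 (h2.const_mul c) i
    rw [pd_const_mul h2] at this
    exact this
  have h2 : pd a (pd b (f + c • f')) x = pd a (pd b f) x + c * pd a (pd b f') x := by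
    rw [pd_congr hx (key b), pd_add (differentiableAt_pd hf hx b)
      ((differentiableAt_pd hf' hx b).const_mul c), pd_const_mul (differentiableAt_pd hf' hx b)]
  simp only [hessian, h2, fun i => key i x hx, mul_add, Finset.sum_add_distrib, mul_sub,
    Finset.mul_sum]
  rw [Finset.sum_congr rfl fun k _ => mul_left_comm (christoffel g k a b x) c (pd k f' x)]
  ring

theorem IsConformalKillingWith.comb {X Y : (Fin n → ℝ) → Fin n → ℝ} {α α' : (Fin n → ℝ) → ℝ}
    (hX : IsConformalKillingWith U g X α) (hY : IsConformalKillingWith U g Y α') (c : ℝ) :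
    IsConformalKillingWith U g (X + c • Y) (α + c • α') := by
  refine ⟨hX.1.add (hY.1.const_smul c), hX.2.1.add (hY.2.1.const_smul c), fun x hx a b => ?_⟩
  rw [lieDerivMetric_comb hX.1 hY.1 c hx, hX.2.2 x hx, hY.2.2 x hx]
  simp only [Pi.add_apply, Pi.smul_apply, smul_eq_mul]
  ring

theorem IsConcircularWith.comb {X Y : (Fin n → ℝ) → Fin n → ℝ}
    {α α' β β' : (Fin n → ℝ) → ℝ}
    (hX : IsConcircularWith U g X α β) (hY : IsConcircularWith U g Y α' β') (c : ℝ) :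
    IsConcircularWith U g (X + c • Y) (α + c • α') (β + c • β') := by
  refine ⟨hX.1.comb hY.1 c, fun x hx a b => ?_⟩
  rw [hessian_comb hX.1.2.1 hY.1.2.1 c hx, hX.2 x hx, hY.2 x hx]
  simp only [Pi.add_apply, Pi.smul_apply, smul_eq_mul]
  ring

theorem isConcircularWith_zero : IsConcircularWith U g 0 0 0 := by
  refine ⟨⟨contDiffOn_const, contDiffOn_const, fun x _ a b => ?_⟩, fun x _ a b => ?_⟩
  · simp [lieDerivMetric, pd]
  · have h0 : ∀ i : Fin n, pd i (0 : (Fin n → ℝ) → ℝ) = 0 := fun i => by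
      funext y; simp [pd]
    simp [hessian, h0]

end Closure

/-- Restriction of a field of components to `U`. Vector fields on `U` are elements of
`U → (Fin n → ℝ)`, so that two of them are equal as soon as they agree on `U`. -/
def restrict {n : ℕ} (U : TopologicalSpace.Opens (Fin n → ℝ)) :
    ((Fin n → ℝ) → Fin n → ℝ) →ₗ[ℝ] (U → Fin n → ℝ) :=
  LinearMap.funLeft ℝ (Fin n → ℝ) (Subtype.val : U → Fin n → ℝ)

/-- The real vector space of all smooth conformal Killing vector fields of `g` on `U`. -/
def conformalKillingFields {n : ℕ} (U : TopologicalSpace.Opens (Fin n → ℝ))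
    (g : (Fin n → ℝ) → Matrix (Fin n) (Fin n) ℝ) : Submodule ℝ (U → Fin n → ℝ) :=
  Submodule.map (restrict U)
    { carrier := {X | ∃ α, IsConformalKillingWith U g X α}
      zero_mem' := ⟨0, isConcircularWith_zero.1⟩
      add_mem' := by
        rintro X Y ⟨α, hX⟩ ⟨α', hY⟩
        exact ⟨_, by simpa using hX.comb hY 1⟩
      smul_mem' := by
        rintro c X ⟨α, hX⟩
        exact ⟨_, by simpa using isConcircularWith_zero.1.comb hX c⟩ }

/-- The real vector space of all smooth concircular vector fields of `g` on `U`. -/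
def concircularFields {n : ℕ} (U : TopologicalSpace.Opens (Fin n → ℝ))
    (g : (Fin n → ℝ) → Matrix (Fin n) (Fin n) ℝ) : Submodule ℝ (U → Fin n → ℝ) :=
  Submodule.map (restrict U)
    { carrier := {X | ∃ α β, IsConcircularWith U g X α β}
      zero_mem' := ⟨0, 0, isConcircularWith_zero⟩
      add_mem' := by
        rintro X Y ⟨α, β, hX⟩ ⟨α', β', hY⟩
        exact ⟨_, _, by simpa using hX.comb hY 1⟩
      smul_mem' := by
        rintro c X ⟨α, β, hX⟩
        exact ⟨_, _, by simpa using isConcircularWith_zero.comb hX c⟩ }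

/-! ### The spacetimes -/

/-- The two classes of spacetimes under consideration. -/
inductive SpacetimeType
  | kantowskiSachs
  | bianchiIII

/-- The function `h`: `sin` for Kantowski-Sachs, `sinh` for Bianchi type III. -/
def SpacetimeType.h : SpacetimeType → ℝ → ℝ
  | .kantowskiSachs => Real.sin
  | .bianchiIII => Real.sinh

/-- The range of the coordinate `θ`: `(0, π)` for Kantowski-Sachs, `(0, ∞)` for Bianchi type
III. -/
def SpacetimeType.thetaRange : SpacetimeType → Set ℝ
  | .kantowskiSachs => Ioo 0 Real.pi
  | .bianchiIII => Ioi 0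

theorem SpacetimeType.isOpen_thetaRange (S : SpacetimeType) : IsOpen S.thetaRange := by
  cases S
  · exact isOpen_Ioo
  · exact isOpen_Ioi

/-- The chart with coordinates `(t, r, θ, φ) = (x 0, x 1, x 2, x 3)`, where `t ∈ I`, `r ∈ ℝ`,
`θ` lies in its range and `0 < φ < 2 π`. -/
def chart (S : SpacetimeType) (I : TopologicalSpace.Opens ℝ) :
    TopologicalSpace.Opens (Fin 4 → ℝ) where
  carrier := {x | x 0 ∈ I ∧ x 2 ∈ S.thetaRange ∧ x 3 ∈ Ioo 0 (2 * Real.pi)}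
  is_open' :=
    (I.isOpen.preimage (continuous_apply 0)).inter
      ((S.isOpen_thetaRange.preimage (continuous_apply 2)).inter
        (isOpen_Ioo.preimage (continuous_apply 3)))

/-- The metric
`ds² = -dt² + A(t)² [dr² + γ⁻² cosh²(γ T(t)) (dθ² + h(θ)² dφ²)]`,
where `T` stands for the antiderivative `∫ dt / A`. -/
def metric (S : SpacetimeType) (A T : ℝ → ℝ) (γ : ℝ) (x : Fin 4 → ℝ) :
    Matrix (Fin 4) (Fin 4) ℝ :=
  Matrix.diagonal ![-1,
    A (x 0) ^ 2,
    A (x 0) ^ 2 * ((γ ^ 2)⁻¹ * Real.cosh (γ * T (x 0)) ^ 2),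
    A (x 0) ^ 2 * ((γ ^ 2)⁻¹ * Real.cosh (γ * T (x 0)) ^ 2 * S.h (x 2) ^ 2)]

/-- The four vector fields `∂_r`, `cos φ ∂_θ - (h'/h) sin φ ∂_φ`,
`sin φ ∂_θ + (h'/h) cos φ ∂_φ` and `∂_φ`. -/
def basicField (S : SpacetimeType) : Fin 4 → (Fin 4 → ℝ) → Fin 4 → ℝ :=
  ![fun _ => ![0, 1, 0, 0],
    fun x => ![0, 0, Real.cos (x 3), -(deriv S.h (x 2) / S.h (x 2) * Real.sin (x 3))],
    fun x => ![0, 0, Real.sin (x 3), deriv S.h (x 2) / S.h (x 2) * Real.cos (x 3)],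
    fun _ => ![0, 0, 0, 1]]

end Concircular

end

/-! Write the metric as -dt² + A² dr² + B² (dθ² + h² dφ²) with γB = A C, C = cosh Ψ, S = sinh Ψ, and
let the field have components (q, f, a, b). Smooth functions on the chart form a commutative ring on
which the partial derivatives are commuting derivations, so the conformal Killing and Hessian
equations (`ConfEqs`, `HessEqs`) can be treated by elimination in an abstract differential ring
(`WarpedFrame`). Two analytic facts are used to get back to functions: on a convex chart a function
without derivatives is constant, and a function of t that is not identically zero can be cancelled
from a product with a t-independent function (`Cancels.of_apply_coord`).

Rigidity of concircular fields. The Hessian equations make α_r/A, α_θ/B and α_φ/B independent of t.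
Substituting this into the other equations and differentiating in t repeatedly gives D m = 0 or D² m
= 0 with m independent of t, where D = A B'' - A'' B. The Wronskian A B' - A' B equals A S, hence D
= A' S + γ C: this is condition (iii). Together with B' ≠ 0 somewhere, that is (i), it follows that
α is constant, β = 0 and q_r = f_θ = f_φ = 0 (`conformalFactor_const`). It remains to show that such
a homothety has q = 0 and α = 0. If A is not constant, the rr and θθ equations determine q in two
incompatible ways (`orbit_component_eq_zero`). If A is constant, (ii) leaves only h = sinh, and
there q_θθ = -q contradicts h'' = h unless q = 0; on the sphere the signs agree and linear functions
would survive. A field with q = α = 0 is a translation in r plus a Killing field of the sphere or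
hyperbolic plane (`sphere_killing`).

Dimension fifteen. With dτ = γ dt/A and ρ = γ r the metric is conformal to -dτ² + dρ² + cosh² τ (dθ²
+ sin² θ dφ²), the product of a line with the unit hyperboloid (de Sitter space) in four-dimensional
Minkowski space. There the equations integrate explicitly: up to a constant, f is cosh ρ P + sinh ρ
Q with P, Q restrictions of linear functions to the hyperboloid (`exists_linearEqs`). These give 4 +
4 parameters; what is left is Killing, namely 3 boosts, 3 rotations and 1 translation.
Multiplication by (A/γ, 1/γ, 1, 1) carries the fields back. -/

noncomputable section

namespace Concircular

/-! ### Smooth functions on an open set as a ring with commuting derivations -/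

section SmoothAlgebra

variable {n : ℕ} (U : TopologicalSpace.Opens (Fin n → ℝ))

/-- The algebra of smooth functions on `U`. -/
def smoothAlg : Subalgebra ℝ (U → ℝ) where
  carrier := {f | ∃ F : (Fin n → ℝ) → ℝ, ContDiffOn ℝ ∞ F U ∧ ∀ x : U, f x = F x}
  mul_mem' := by
    rintro f g ⟨F, hF, hf⟩ ⟨G, hG, hg⟩
    exact ⟨F * G, hF.mul hG, fun x => by simp [hf, hg]⟩
  add_mem' := by
    rintro f g ⟨F, hF, hf⟩ ⟨G, hG, hg⟩
    exact ⟨F + G, hF.add hG, fun x => by simp [hf, hg]⟩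
  algebraMap_mem' := fun c => ⟨fun _ => c, contDiffOn_const, fun x => rfl⟩

variable {U}

/-- The element of `smoothAlg U` given by a function that is smooth on `U`. -/
def ofFun (F : (Fin n → ℝ) → ℝ) (hF : ContDiffOn ℝ ∞ F U) : smoothAlg U :=
  ⟨fun x => F x, F, hF, fun _ => rfl⟩

@[simp] theorem ofFun_apply (F : (Fin n → ℝ) → ℝ) (hF : ContDiffOn ℝ ∞ F U) (x : U) :
    (ofFun F hF : U → ℝ) x = F x := rfl

theorem smoothAlg_ext {f g : smoothAlg U} (h : ∀ x : U, (f : U → ℝ) x = (g : U → ℝ) x) : f = g :=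
  Subtype.ext (funext h)

theorem contDiffOn_pd {F : (Fin n → ℝ) → ℝ} (hF : ContDiffOn ℝ ∞ F U) (i : Fin n) :
    ContDiffOn ℝ ∞ (pd i F) U :=
  (hF.fderiv_of_isOpen U.isOpen (by simp)).clm_apply contDiffOn_const

/-- A function on the whole space that represents an element of `smoothAlg U`. -/
def rep (f : smoothAlg U) : (Fin n → ℝ) → ℝ := f.2.choose

theorem contDiffOn_rep (f : smoothAlg U) : ContDiffOn ℝ ∞ (rep f) U := f.2.choose_spec.1

theorem rep_apply (f : smoothAlg U) (x : U) : rep f x = (f : U → ℝ) x :=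
  (f.2.choose_spec.2 x).symm

theorem ofFun_rep (f : smoothAlg U) : ofFun (rep f) (contDiffOn_rep f) = f :=
  smoothAlg_ext (rep_apply f)

theorem pd_mul {f f' : (Fin n → ℝ) → ℝ} {x : Fin n → ℝ} (hf : DifferentiableAt ℝ f x)
    (hf' : DifferentiableAt ℝ f' x) (i : Fin n) :
    pd i (fun y => f y * f' y) x = f x * pd i f' x + f' x * pd i f x := by
  simp [pd, fderiv_fun_mul hf hf']

theorem pd_rep (f : smoothAlg U) (F : (Fin n → ℝ) → ℝ) (h : ∀ x : U, (f : U → ℝ) x = F x)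
    (i : Fin n) (x : U) : pd i (rep f) x = pd i F x :=
  pd_congr x.2 (fun y hy => (rep_apply f ⟨y, hy⟩).trans (h ⟨y, hy⟩)) i

/-- The partial derivative as a derivation of the algebra of smooth functions. -/
def partialD (i : Fin n) : Derivation ℝ (smoothAlg U) (smoothAlg U) :=
  Derivation.mk'
    { toFun := fun f => ofFun (pd i (rep f)) (contDiffOn_pd (contDiffOn_rep f) i)
      map_add' := fun f g => smoothAlg_ext fun x => by
        have hf := differentiableAt_of_mem (contDiffOn_rep f) x.2
        have hg := differentiableAt_of_mem (contDiffOn_rep g) x.2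
        simp only [ofFun_apply]
        rw [pd_rep (f + g) (fun y => rep f y + rep g y) (fun y => by simp [rep_apply]) i x,
          pd_add hf hg]
        rfl
      map_smul' := fun c f => smoothAlg_ext fun x => by
        have hf := differentiableAt_of_mem (contDiffOn_rep f) x.2
        simp only [ofFun_apply]
        rw [pd_rep (c • f) (fun y => c * rep f y) (fun y => by simp [rep_apply]) i x,
          pd_const_mul hf]
        rfl }
    (fun f g => smoothAlg_ext fun x => by
      have hf := differentiableAt_of_mem (contDiffOn_rep f) x.2
      have hg := differentiableAt_of_mem (contDiffOn_rep g) x.2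
      change pd i (rep (f * g)) x = (f : U → ℝ) x * pd i (rep g) x + (g : U → ℝ) x * pd i (rep f) x
      rw [pd_rep (f * g) (fun y => rep f y * rep g y) (fun y => by simp [rep_apply]) i x,
        pd_mul hf hg, rep_apply, rep_apply])

theorem partialD_apply (f : smoothAlg U) (F : (Fin n → ℝ) → ℝ)
    (h : ∀ x : U, (f : U → ℝ) x = F x) (i : Fin n) (x : U) :
    (partialD i f : U → ℝ) x = pd i F x :=
  pd_rep f F h i x

theorem partialD_ofFun (F : (Fin n → ℝ) → ℝ) (hF : ContDiffOn ℝ ∞ F U) (i : Fin n) :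
    partialD i (ofFun F hF) = ofFun (pd i F) (contDiffOn_pd hF i) :=
  smoothAlg_ext fun x => partialD_apply _ F (fun _ => rfl) i x

theorem partialD_comm (i j : Fin n) (f : smoothAlg U) :
    partialD i (partialD j f) = partialD j (partialD i f) := by
  rw [← ofFun_rep f]
  simp only [partialD_ofFun]
  refine smoothAlg_ext fun x => ?_
  have hs := (contDiffOn_rep f).contDiffAt (U.isOpen.mem_nhds x.2)
  have h1 : DifferentiableAt ℝ (fderiv ℝ (rep f)) x :=
    (hs.fderiv_right (m := 1) (by norm_cast)).differentiableAt (by simp)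
  have key : ∀ k l : Fin n, pd k (pd l (rep f)) x
      = fderiv ℝ (fderiv ℝ (rep f)) x (Pi.single k 1) (Pi.single l 1) := by
    intro k l
    have : pd k (pd l (rep f)) x
      = fderiv ℝ (fun y => fderiv ℝ (rep f) y (Pi.single l 1)) x (Pi.single k 1) := rfl
    rw [this, fderiv_clm_apply h1 (differentiableAt_const _)]
    simp
  simp only [ofFun_apply, key]
  exact hs.isSymmSndFDerivAt (by simp; norm_cast) _ _

theorem hasDerivAt_comp_update {F : (Fin n → ℝ) → ℝ} (x : Fin n → ℝ) (i : Fin n) (s : ℝ)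
    (hF : DifferentiableAt ℝ F (Function.update x i s)) :
    HasDerivAt (fun s => F (Function.update x i s)) (pd i F (Function.update x i s)) s :=
  hF.hasFDerivAt.comp_hasDerivAt s (hasDerivAt_update x i s)

theorem pd_comp_apply {φ : ℝ → ℝ} {φ' : ℝ} {x : Fin n → ℝ} {j : Fin n}
    (h : HasDerivAt φ φ' (x j)) (i : Fin n) :
    pd i (fun y => φ (y j)) x = if i = j then φ' else 0 := by
  have h2 : HasFDerivAt (fun y : Fin n → ℝ => φ (y j))
      (φ' • ContinuousLinearMap.proj (R := ℝ) (φ := fun _ : Fin n => ℝ) j) x :=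
    h.comp_hasFDerivAt x (hasFDerivAt_apply j x)
  rw [pd, h2.fderiv]
  simp [Pi.single_apply, eq_comm]

theorem eq_const_of_partialD_eq_zero (hU : Convex ℝ (U : Set (Fin n → ℝ))) {f : smoothAlg U}
    (h : ∀ i, partialD i f = 0) : ∃ c : ℝ, f = algebraMap ℝ (smoothAlg U) c := by
  have hz : ∀ x ∈ U, fderiv ℝ (rep f) x = 0 := by
    intro x hx
    refine ContinuousLinearMap.coe_injective (LinearMap.pi_ext' fun i => ?_)
    have := congrFun (congrArg Subtype.val (h i)) ⟨x, hx⟩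
    rw [partialD_apply f (rep f) (fun y => (rep_apply f y).symm)] at this
    refine LinearMap.ext_ring ?_
    simpa [pd] using this
  rcases isEmpty_or_nonempty U with hE | ⟨⟨x0⟩⟩
  · exact ⟨0, smoothAlg_ext fun x => (hE.false x).elim⟩
  · refine ⟨(f : U → ℝ) x0, smoothAlg_ext fun x => ?_⟩
    have := U.isOpen.is_const_of_fderiv_eq_zero hU.isPreconnected
      ((contDiffOn_rep f).differentiableOn (by simp)) (fun y hy => hz y hy) x.2 x0.2
    rw [rep_apply f x, rep_apply f x0] at this
    exact this

/-- A line parallel to a coordinate axis meets a convex set in an interval, and on it `m` has zero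
derivative. This is what allows a t-independent function to be evaluated at a more convenient value
of t. -/
theorem apply_update_of_partialD_eq_zero (hU : Convex ℝ (U : Set (Fin n → ℝ))) {m : smoothAlg U}
    {i : Fin n} (h : partialD i m = 0) (x : U) (s : ℝ)
    (hs : Function.update (x : Fin n → ℝ) i s ∈ U) :
    (m : U → ℝ) ⟨_, hs⟩ = (m : U → ℝ) x := by
  have hconv : Convex ℝ {r : ℝ | Function.update (x : Fin n → ℝ) i r ∈ U} := by
    intro r hr r' hr' a b ha hb hab
    have := hU hr hr' ha hb hab
    rw [mem_ofPred_eq, ← SetLike.mem_coe]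
    convert this using 1
    funext j
    by_cases hj : j = i
    · subst hj; simp
    · simp [Function.update_of_ne hj, ← add_mul, hab]
  have hopen : IsOpen {r : ℝ | Function.update (x : Fin n → ℝ) i r ∈ U} :=
    U.isOpen.preimage (continuous_const.update i continuous_id)
  have hd : ∀ r ∈ {r : ℝ | Function.update (x : Fin n → ℝ) i r ∈ U},
      HasDerivAt (fun r => rep m (Function.update (x : Fin n → ℝ) i r)) 0 r := by
    intro r hr
    have h1 := hasDerivAt_comp_update (x : Fin n → ℝ) i r
      (differentiableAt_of_mem (contDiffOn_rep m) hr)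
    have := congrFun (congrArg Subtype.val h) ⟨_, hr⟩
    rw [partialD_apply m (rep m) (fun y => (rep_apply m y).symm)] at this
    simp only at this
    rw [this] at h1
    exact h1
  have := hopen.is_const_of_deriv_eq_zero hconv.isPreconnected
    (fun r hr => (hd r hr).differentiableAt.differentiableWithinAt) (fun r hr => (hd r hr).deriv)
    hs (y := (x : Fin n → ℝ) i) (by simp)
  simp only [Function.update_eq_self] at this
  rw [← rep_apply, ← rep_apply]
  exact this

end SmoothAlgebra

/-! ### Elimination for the warped metric: rigidity of concircular fields -/

section Algebra

variable {R : Type*} [CommRing R] [Algebra ℝ R]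

theorem deriv_mul (D : Derivation ℝ R R) (a b : R) : D (a * b) = a * D b + D a * b := by
  simp [mul_comm]

theorem deriv_sq (D : Derivation ℝ R R) (a : R) : D (a ^ 2) = 2 * a * D a := by
  rw [sq, deriv_mul]; ring

theorem deriv_one (D : Derivation ℝ R R) : D 1 = 0 := D.map_one_eq_zero

theorem deriv_inv {D : Derivation ℝ R R} {a b : R} (h : a * b = 1) : D b = -b ^ 2 * D a := by
  have h1 := congrArg D h
  rw [deriv_mul, deriv_one] at h1
  linear_combination b * h1 - D b * h

theorem eq_zero_of_two_mul {x : R} (h : 2 * x = 0) : x = 0 := by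
  have h2 : (2⁻¹ : ℝ) • ((2 : ℝ) • x) = 0 := by
    rw [ofNat_smul_eq_nsmul ℝ 2 x, two_nsmul, ← two_mul, h, smul_zero]
  rwa [smul_smul, inv_mul_cancel₀ two_ne_zero, one_smul] at h2

/-- The equation a x' = a' x integrates to x = a · const; here b = 1/a. It is the integration step
for the mixed Hessian equations. -/
theorem deriv_ratio {D : Derivation ℝ R R} {a b x : R} (h : a * b = 1)
    (hx : a * D x = D a * x) : D (b * x) = 0 := by
  rw [deriv_mul, deriv_inv h]
  linear_combination b ^ 2 * hx - b * D x * h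

/-- `a ^ 2` can be cancelled from products with functions that `D` annihilates. -/
def Cancels (D : Derivation ℝ R R) (a : R) : Prop := ∀ m, D m = 0 → a ^ 2 * m = 0 → m = 0

/-- `Cancels` is stated with the square because some eliminations end in a² m = 0, where a m need
not be annihilated by D and an abstract ring may have nilpotents. -/
theorem Cancels.eq_zero {D : Derivation ℝ R R} {a m : R} (h : Cancels D a) (hm : D m = 0)
    (ha : a * m = 0) : m = 0 :=
  h m hm (by linear_combination a * ha)

/-- The conformal Killing equations `L_X g = 2 α g` for the metric
`-dt² + A² dr² + B² (dθ² + h² dφ²)` and the field with components `q, f, a, b`. -/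
structure ConfEqs (d : Fin 4 → Derivation ℝ R R) (A B h q f a b α : R) : Prop where
  tt : d 0 q = α
  tr : d 1 q = A ^ 2 * d 0 f
  tθ : d 2 q = B ^ 2 * d 0 a
  tφ : d 3 q = B ^ 2 * h ^ 2 * d 0 b
  rr : d 0 A * q + A * d 1 f = α * A
  rθ : A ^ 2 * d 2 f + B ^ 2 * d 1 a = 0
  rφ : A ^ 2 * d 3 f + B ^ 2 * h ^ 2 * d 1 b = 0
  θθ : d 0 B * q + B * d 2 a = α * B
  θφ : d 3 a + h ^ 2 * d 2 b = 0
  φφ : d 0 B * q * h + B * (d 2 h * a + h * d 3 b) = α * B * h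

/-- The part of the equations `∇∇α = β g`, for the metric `-dt² + A² dr² + B² (dθ² + h² dφ²)`,
that does not involve derivatives of `h`. -/
structure HessEqs (d : Fin 4 → Derivation ℝ R R) (A B α β : R) : Prop where
  tt : d 0 (d 0 α) = -β
  tr : A * d 0 (d 1 α) = d 0 A * d 1 α
  tθ : B * d 0 (d 2 α) = d 0 B * d 2 α
  tφ : B * d 0 (d 3 α) = d 0 B * d 3 α
  rθ : d 1 (d 2 α) = 0
  rφ : d 1 (d 3 α) = 0
  rr : d 1 (d 1 α) - A * d 0 A * d 0 α = β * A ^ 2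
  θθ : d 2 (d 2 α) - B * d 0 B * d 0 α = β * B ^ 2

/-- Four commuting derivations, and functions `A`, `B` of the first coordinate and `h` of the third
one as they occur in the metric `-dt² + A² dr² + B² (dθ² + h² dφ²)`, with inverses. -/
structure WarpedFrame (d : Fin 4 → Derivation ℝ R R) (A Ai B Bi h hi : R) (ε : R) : Prop where
  comm : ∀ i j f, d i (d j f) = d j (d i f)
  A_inv : A * Ai = 1
  B_inv : B * Bi = 1
  h_inv : h * hi = 1
  d1A : d 1 A = 0
  d2A : d 2 A = 0
  d3A : d 3 A = 0
  d1B : d 1 B = 0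
  d2B : d 2 B = 0
  d3B : d 3 B = 0
  d0h : d 0 h = 0
  d1h : d 1 h = 0
  d3h : d 3 h = 0
  d2d2h : d 2 (d 2 h) = ε * h
  pyth : d 2 h ^ 2 - ε * h ^ 2 = 1

theorem eq_zero_of_mul_eq {R : Type*} [CommRing R] {a ai x : R} (ha : a * ai = 1)
    (h : a * x = 0) : x = 0 := by
  linear_combination ai * h - x * ha

namespace WarpedFrame

variable {d : Fin 4 → Derivation ℝ R R} {A Ai B Bi h hi : R} {ε : R}
  (W : WarpedFrame d A Ai B Bi h hi ε)
include W

/-- Functions `Z`, `Y` with `A² Z + B² Y = 0` whose `t`-derivatives are `v / A²` and `v / B²`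
vanish. -/
theorem mixed_eq_zero {Z Y v : R} (hD : Cancels (d 0) (A * d 0 (d 0 B) - d 0 (d 0 A) * B))
    (hv : d 0 v = 0) (hZ : A ^ 2 * d 0 Z = v) (hY : B ^ 2 * d 0 Y = v)
    (hZY : A ^ 2 * Z + B ^ 2 * Y = 0) : Z = 0 := by
  have h1 := congrArg (d 0) hZY
  simp only [map_add, map_zero, deriv_mul, deriv_sq] at h1
  -- Eliminating Y from the t-derivative of `hZY` leaves the Wronskian of A and B as coefficient of
  -- Z.
  have h2 : A * (A * d 0 B - d 0 A * B) * Z = B * v := by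
    refine sub_eq_zero.1 (eq_zero_of_two_mul ?_)
    linear_combination -B * h1 + B * hZ + B * hY + 2 * d 0 B * hZY
  have h3 := congrArg (d 0) h2
  simp only [map_sub, deriv_mul, hv] at h3
  -- The coefficient D is the derivative of the Wronskian; the terms in v cancel against `h2`.
  -- Differentiating D Z = 0 once more and multiplying by A² D gives D² v = 0.
  have h4 : (A * d 0 (d 0 B) - d 0 (d 0 A) * B) * Z = 0 := by
    refine eq_zero_of_mul_eq W.A_inv (eq_zero_of_mul_eq W.A_inv ?_)
    linear_combination A * h3 - (A * d 0 B - d 0 A * B) * hZ - d 0 A * h2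
  have h5 := congrArg (d 0) h4
  simp only [map_sub, map_zero, deriv_mul] at h5
  have h6 : v = 0 := by
    refine hD v hv ?_
    linear_combination (A * d 0 (d 0 B) - d 0 (d 0 A) * B) * (A ^ 2 * h5
      - (A * d 0 (d 0 B) - d 0 (d 0 A) * B) * hZ)
      - A ^ 2 * (A * d 0 (d 0 (d 0 B)) + d 0 A * d 0 (d 0 B)
        - (d 0 (d 0 A) * d 0 B + d 0 (d 0 (d 0 A)) * B)) * h4
  have h7 : d 0 Z = 0 := by
    rw [h6] at hZ
    refine eq_zero_of_mul_eq W.A_inv (eq_zero_of_mul_eq W.A_inv ?_)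
    linear_combination hZ
  exact hD.eq_zero h7 h4

variable {q f a b α β : R}

/-- If `∇∇α = β g` for the conformal factor `α`, then `α` is constant, and the field splits. -/
theorem conformalFactor_const (E : ConfEqs d A B h q f a b α) (H : HessEqs d A B α β)
    (hD : Cancels (d 0) (A * d 0 (d 0 B) - d 0 (d 0 A) * B)) (hB : Cancels (d 0) (d 0 B)) :
    (∀ i, d i α = 0) ∧ β = 0 ∧ d 1 q = 0 ∧ d 2 f = 0 ∧ d 3 f = 0 := by
  have hAu := W.A_inv
  have hBu := W.B_inv
  -- Here Z = f_θ, Y = a_r and v = q_rθ; v does not depend on t because v_t = α_rθ = 0.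
  have f2 : d 2 f = 0 := by
    refine W.mixed_eq_zero (Y := d 1 a) (v := d 1 (d 2 q)) hD ?_ ?_ ?_ E.rθ
    · rw [W.comm 0 1, W.comm 0 2, E.tt, H.rθ]
    · have := congrArg (d 2) E.tr
      simp only [deriv_mul, deriv_sq, W.d2A] at this
      rw [W.comm 0 2, W.comm 1 2]
      linear_combination -this
    · have := congrArg (d 1) E.tθ
      simp only [deriv_mul, deriv_sq, W.d1B] at this
      rw [W.comm 0 1]
      linear_combination -this
  have f3 : d 3 f = 0 := by
    refine W.mixed_eq_zero (Y := h ^ 2 * d 1 b) (v := d 1 (d 3 q)) hD ?_ ?_ ?_ ?_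
    · rw [W.comm 0 1, W.comm 0 3, E.tt, H.rφ]
    · have := congrArg (d 3) E.tr
      simp only [deriv_mul, deriv_sq, W.d3A] at this
      rw [W.comm 0 3, W.comm 1 3]
      linear_combination -this
    · have := congrArg (d 1) E.tφ
      simp only [deriv_mul, deriv_sq, W.d1B, W.d1h] at this
      simp only [deriv_mul, deriv_sq, W.d0h, W.comm 0 1]
      linear_combination -this
    · linear_combination E.rφ
  have a1 : d 1 a = 0 := by
    have := E.rθ
    rw [f2] at this
    refine eq_zero_of_mul_eq hBu (eq_zero_of_mul_eq hBu ?_)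
    linear_combination this
  have e1 : B * d 1 α = d 0 B * d 1 q := by
    have := congrArg (d 1) E.θθ
    simp only [map_add, deriv_mul, W.comm 1 0 B, W.d1B, W.comm 1 2 a, a1, map_zero] at this
    linear_combination -this
  -- Both u = q_r / B and F = α_r / A are independent of t: the former since q_rt = α_r and B α_r =
  -- B' q_r.
  obtain ⟨u, hu⟩ : ∃ u, u = Bi * d 1 q := ⟨_, rfl⟩
  have u0 : d 0 u = 0 := hu ▸ deriv_ratio hBu (by rw [W.comm 0 1, E.tt, e1])
  have hq : d 1 q = B * u := by linear_combination -d 1 q * hBu - B * hu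
  obtain ⟨F, hF⟩ : ∃ F, F = Ai * d 1 α := ⟨_, rfl⟩
  have F0 : d 0 F = 0 := hF ▸ deriv_ratio hAu H.tr
  have hα : d 1 α = A * F := by linear_combination -d 1 α * hAu - A * hF
  have e2 : d 0 (d 1 α) = d 0 A * F := by rw [hα, deriv_mul, F0]; ring
  have e4 : d 2 (d 2 α) - B * d 0 B * d 0 α + B ^ 2 * d 0 (d 0 α) = 0 := by
    linear_combination H.θθ + B ^ 2 * H.tt
  have e5 : (d 0 B * d 0 A - B * d 0 (d 0 A)) * F = 0 := by
    have := congrArg (d 1) e4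
    simp only [map_add, map_sub, deriv_mul, deriv_sq, W.comm 1 0, W.d1B, W.comm 1 2, map_zero,
      e2] at this
    rw [← W.comm 1 2, H.rθ, map_zero] at this
    refine eq_zero_of_mul_eq hBu ?_
    linear_combination -this + B ^ 2 * d 0 A * F0
  have e6 : d 0 B * u = A * F :=
    sub_eq_zero.1 (eq_zero_of_mul_eq hBu (by linear_combination -e1 - d 0 B * hq + B * hα))
  have e7 := congrArg (d 0) e6
  simp only [deriv_mul, u0, F0] at e7
  -- Three relations meet: (A'B' - A''B) F = 0, B' u = A F, and its t-derivative B'' u = A' F.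
  -- Eliminating u gives A B'' F = A' B' F up to units, hence D F = 0.
  have F00 : F = 0 := by
    refine hD.eq_zero F0 (eq_zero_of_mul_eq hAu ?_)
    linear_combination A * e5 - A * d 0 (d 0 B) * e6 + A * d 0 B * e7
  have u00 : u = 0 := hB.eq_zero u0 (by rw [e6, F00, mul_zero])
  rw [F00, mul_zero] at hα
  rw [u00, mul_zero] at hq
  obtain ⟨m, hm⟩ : ∃ m, m = Ai * d 0 α := ⟨_, rfl⟩
  have m0 : d 0 m = 0 := by
    refine hm ▸ deriv_ratio hAu (sub_eq_zero.1 (eq_zero_of_mul_eq hAu ?_))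
    have := H.rr
    rw [hα, map_zero] at this
    linear_combination A ^ 2 * H.tt + this
  have hm' : d 0 α = A * m := by linear_combination -d 0 α * hAu - A * hm
  obtain ⟨k, hk⟩ : ∃ k, k = Bi * d 2 α := ⟨_, rfl⟩
  have k0 : d 0 k = 0 := hk ▸ deriv_ratio hBu H.tθ
  have hk' : d 2 α = B * k := by linear_combination -d 2 α * hBu - B * hk
  obtain ⟨l, hl⟩ : ∃ l, l = Bi * d 3 α := ⟨_, rfl⟩
  have l0 : d 0 l = 0 := hl ▸ deriv_ratio hBu H.tφ
  have hl' : d 3 α = B * l := by linear_combination -d 3 α * hBu - B * hl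
  have e8 : d 2 k = (d 0 B * A - B * d 0 A) * m := by
    rw [hk', hm', deriv_mul, deriv_mul, W.d2B, m0] at e4
    refine sub_eq_zero.1 (eq_zero_of_mul_eq hBu ?_)
    linear_combination e4
  -- The left side of k_θ = (A B' - A' B) m is independent of t, so differentiation in t leaves D m
  -- = 0.
  have m00 : m = 0 := by
    have := congrArg (d 0) e8
    rw [W.comm 0 2, k0, map_zero] at this
    simp only [map_sub, deriv_mul, m0] at this
    exact hD.eq_zero m0 (by linear_combination -this)
  rw [m00, mul_zero] at hm'
  have k00 : k = 0 := by
    have := H.tθ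
    rw [W.comm 0 2, hm', map_zero, hk'] at this
    exact hB.eq_zero k0 (eq_zero_of_mul_eq hBu (by linear_combination -this))
  have l00 : l = 0 := by
    have := H.tφ
    rw [W.comm 0 3, hm', map_zero, hl'] at this
    exact hB.eq_zero l0 (eq_zero_of_mul_eq hBu (by linear_combination -this))
  refine ⟨fun i => ?_, ?_, hq, f2, f3⟩
  · fin_cases i
    · exact hm'
    · exact hα
    · simp [hk', k00]
    · simp [hl', l00]
  · rw [← neg_eq_zero, ← H.tt, hm', map_zero]

/-- The tθ and tφ equations say that B² times the t-derivative of (a, b) is the gradient of q along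
the orbits. So the t-derivative of the orbit part of the conformal Killing equations prescribes the
orbit Hessian of q: it is a multiple of dθ² + h² dφ². -/
theorem angular_hessian (E : ConfEqs d A B h q f a b α) :
    d 2 (d 2 q) = (d 0 B ^ 2 - B * d 0 (d 0 B)) * q - B * d 0 B * α + B ^ 2 * d 0 α ∧
    h * d 2 (d 3 q) = d 2 h * d 3 q ∧
    d 3 (d 3 q) = h ^ 2 * d 2 (d 2 q) - h * d 2 h * d 2 q := by
  have h1 := congrArg (d 2) E.tθ
  have h2 := congrArg (d 3) E.tθ
  have h3 := congrArg (d 2) E.tφ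
  have h4 := congrArg (d 3) E.tφ
  have h5 := congrArg (d 0) E.θθ
  have h6 := congrArg (d 0) E.θφ
  have h7 := congrArg (d 0) E.φφ
  have h8 := W.comm 0 2 h
  rw [W.d0h, map_zero] at h8
  simp only [map_add, map_zero, deriv_mul, deriv_sq, W.d2B, W.d3B, W.d3h, W.d0h, E.tt,
    W.comm 2 0, W.comm 3 0, W.comm 3 2, h8] at h1 h2 h3 h4 h5 h6 h7
  refine ⟨?_, ?_, ?_⟩
  · linear_combination h1 + B * h5 - d 0 B * E.θθ
  · refine sub_eq_zero.1 (eq_zero_of_two_mul ?_)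
    linear_combination h * h2 + h * h3 + h * B ^ 2 * h6 - 2 * d 2 h * E.tφ
  · linear_combination h4 - h ^ 2 * h1 + B * h * (h7 - h * h5) - d 0 B * h * (E.φφ - h * E.θθ)
      + h * d 2 h * E.tθ

/-- The Killing equations of the sphere or the hyperbolic plane. -/
theorem sphere_killing (E : ConfEqs d A B h 0 f a b 0) (h2 : d 2 f = 0) (h3 : d 3 f = 0) :
    (∀ i, d i f = 0) ∧ d 0 a = 0 ∧ d 1 a = 0 ∧ d 2 a = 0 ∧ d 3 (d 3 a) = -a ∧
      ∀ i, d i (b - hi * d 2 h * d 3 a) = 0 := by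
  have hAu := W.A_inv
  have hBu := W.B_inv
  have hhu := W.h_inv
  have E1 := E.tr
  have E2 := E.tθ
  have E3 := E.tφ
  have E4 := E.rr
  have E5 := E.rθ
  have E6 := E.rφ
  have E7 := E.θθ
  have E8 := E.φφ
  simp only [map_zero, mul_zero, zero_mul, zero_add, h2, h3] at E1 E2 E3 E4 E5 E6 E7 E8
  have a0 : d 0 a = 0 := by linear_combination -Bi ^ 2 * E2 - d 0 a * (B * Bi + 1) * hBu
  have a1 : d 1 a = 0 := by linear_combination Bi ^ 2 * E5 - d 1 a * (B * Bi + 1) * hBu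
  have a2 : d 2 a = 0 := eq_zero_of_mul_eq hBu E7
  have h4 : d 2 h * a + h * d 3 b = 0 := eq_zero_of_mul_eq hBu E8
  have hBh : B ^ 2 * h ^ 2 * (Bi ^ 2 * hi ^ 2) = 1 := by
    linear_combination (B * Bi + 1) * hBu * (h ^ 2 * hi ^ 2) + (h * hi + 1) * hhu
  have b0 : d 0 b = 0 := eq_zero_of_mul_eq hBh E3.symm
  have b1 : d 1 b = 0 := eq_zero_of_mul_eq hBh E6
  -- Differentiating the θφ equation in φ and the φφ equation in θ eliminates b, and h'² - ε h² = 1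
  -- turns the result into a_φφ = -a.
  have E9 := congrArg (d 3) E.θφ
  have E10 := congrArg (d 2) h4
  simp only [map_add, map_zero, deriv_mul, deriv_sq, W.d3h, a2, W.d2d2h, W.comm 3 2 b] at E9 E10
  have a33 : d 3 (d 3 a) = -a := by
    linear_combination E9 - h * E10 + d 2 h * h4 - a * W.pyth
  refine ⟨fun i => ?_, a0, a1, a2, a33, fun i => ?_⟩
  · fin_cases i
    · exact eq_zero_of_mul_eq (x := d 0 f) hAu
        (eq_zero_of_mul_eq hAu (by linear_combination -E1))
    · exact eq_zero_of_mul_eq hAu E4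
    · exact h2
    · exact h3
  · have c2 := W.comm 0 2 h
    have c1 := W.comm 1 2 h
    have c3 := W.comm 3 2 h
    rw [W.d0h, map_zero] at c2
    rw [W.d1h, map_zero] at c1
    rw [W.d3h, map_zero] at c3
    have hi' := fun i => deriv_inv (D := d i) hhu
    fin_cases i
    · simp [hi', W.d0h, c2, b0, W.comm 0 3 a, a0]
    · simp [hi', W.d1h, c1, b1, W.comm 1 3 a, a1]
    · simp only [Fin.reduceFinMk, map_sub, deriv_mul, hi', W.d2d2h, W.comm 2 3 a, a2, map_zero]
      refine eq_zero_of_mul_eq hhu (eq_zero_of_mul_eq hhu ?_)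
      linear_combination E.θφ + h ^ 2 * hi ^ 2 * d 3 a * W.pyth
        + (h ^ 3 * hi * ε + h * hi + 1) * d 3 a * hhu
    · simp only [Fin.reduceFinMk, map_sub, deriv_mul, hi', W.d3h, c3, a33]
      refine eq_zero_of_mul_eq hhu ?_
      linear_combination h4 + d 2 h * a * hhu

variable {g gi S C : R}

/-- Homotheties do not move the orbits of the group action, if `A` is not constant. -/
theorem orbit_component_eq_zero (E : ConfEqs d A B h q f a b α) (hα : ∀ i, d i α = 0)
    (hq1 : d 1 q = 0) (hf2 : d 2 f = 0) (hA : Cancels (d 0) (d 0 A)) (hS : Cancels (d 0) S)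
    (hg : g * gi = 1) (hg0 : d 0 g = 0) (hgB : g * B = A * C) (hAS : A * d 0 S = g * C)
    (hAC : A * d 0 C = g * S) (hCS : C ^ 2 - S ^ 2 = 1) {Ci : R} (hC : C * Ci = 1) :
    q = 0 ∧ α = 0 := by
  have hAu := W.A_inv
  have hBu := W.B_inv
  have hB' : g * d 0 B = d 0 A * C + g * S := by
    have := congrArg (d 0) hgB
    simp only [deriv_mul, hg0, hAC] at this
    linear_combination this
  have q2 : d 2 q = 0 := by
    refine hA.eq_zero (by rw [W.comm 0 2, E.tt, hα]) ?_
    have := congrArg (d 2) E.rr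
    simp only [map_add, deriv_mul, W.d2A, W.comm 2 0 A, W.comm 2 1, hf2, hα, map_zero] at this
    linear_combination this
  have a0 : d 0 a = 0 := by
    have := E.tθ
    rw [q2] at this
    exact eq_zero_of_mul_eq hBu (eq_zero_of_mul_eq hBu (by linear_combination -this))
  have f0 : d 0 f = 0 := by
    have := E.tr
    rw [hq1] at this
    exact eq_zero_of_mul_eq hAu (eq_zero_of_mul_eq hAu (by linear_combination -this))
  -- With f and a independent of t, the rr and θθ equations become A' q = e1 A and γ S q = e A C
  -- with e1, e independent of t: two formulas for the time dependence of q.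
  obtain ⟨e1, he1⟩ : ∃ x, x = α - d 1 f := ⟨_, rfl⟩
  have e10 : d 0 e1 = 0 := by rw [he1, map_sub, hα, W.comm, f0, map_zero, sub_zero]
  have e11 : d 0 A * q = e1 * A := by linear_combination E.rr - A * he1
  obtain ⟨e, he⟩ : ∃ x, x = α - d 2 a - e1 := ⟨_, rfl⟩
  have e0 : d 0 e = 0 := by rw [he, map_sub, map_sub, hα, W.comm, a0, map_zero, e10]; simp
  have e3 : g * S * q = e * A * C := by
    linear_combination g * E.θθ - q * hB' - (d 2 a - α) * hgB - C * e11 - A * C * he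
  have e4 := congrArg (d 0) e3
  simp only [deriv_mul, e0, hg0, E.tt] at e4
  -- Eliminating q from `e3`, its t-derivative and `e11` leaves S² as the only t-dependent quantity,
  -- so one more derivative forces α = e1 and e = 0.
  have e5 : S ^ 2 * (α - e1) = -e := by
    refine sub_eq_zero.1 (eq_zero_of_mul_eq hg (eq_zero_of_mul_eq hAu ?_))
    linear_combination A * S * e4 - g * S * q * hAS + e * A * S * hAC + (-g * C - d 0 A * S) * e3
      + g * S ^ 2 * e11 - e * A * g * hCS
  have e6 := congrArg (d 0) e5
  simp only [deriv_mul, deriv_sq, map_neg, map_sub, e0, e10, hα] at e6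
  have e7 : α - e1 = 0 := by
    refine hS.eq_zero (by rw [map_sub, hα, e10, sub_zero]) (eq_zero_of_mul_eq hC
      (eq_zero_of_mul_eq hg (eq_zero_of_two_mul ?_)))
    linear_combination A * e6 - 2 * S * (α - e1) * hAS
  have e00 : e = 0 := by linear_combination e5 - S ^ 2 * e7
  rw [e00] at e3 e4
  have hα0 : α = 0 := by
    refine hS α (hα 0) (eq_zero_of_mul_eq hg (eq_zero_of_mul_eq hAu ?_))
    linear_combination A * S * e4 - S * q * g * hAS - g * C * e3
  refine ⟨eq_zero_of_mul_eq hC (eq_zero_of_mul_eq hg (eq_zero_of_mul_eq hg ?_)), hα0⟩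
  rw [hα0] at e4
  linear_combination A * e4 - q * g * hAS

/-- If `A` is constant and the orbits are hyperbolic planes, then homotheties do not move the
orbits. -/
theorem orbit_component_eq_zero_of_hyperbolic (hε : ε = 1)
    (E : ConfEqs d A B h q f a b α) (hα : ∀ i, d i α = 0)
    (hA : d 0 A = 0)
    (hg : g * gi = 1) (hg0 : d 0 g = 0) (hgB : g * B = A * C) (hAS : A * d 0 S = g * C)
    (hAC : A * d 0 C = g * S) (hCS : C ^ 2 - S ^ 2 = 1) {Ci : R} (hC : C * Ci = 1) :
    q = 0 ∧ α = 0 := by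
  subst hε
  have hAu := W.A_inv
  have hB' : d 0 B = S := by
    have := congrArg (d 0) hgB
    simp only [deriv_mul, hg0, hAC, hA] at this
    linear_combination gi * this + (S - d 0 B) * hg
  have hB'' : B * d 0 S = C ^ 2 := by
    refine sub_eq_zero.1 (eq_zero_of_mul_eq hg ?_)
    linear_combination d 0 S * hgB + C * hAS
  obtain ⟨h1, h2, h3⟩ := W.angular_hessian E
  rw [hB', hB'', hα] at h1
  have h4 : d 2 (d 2 q) = -q - B * S * α := by linear_combination h1 - q * hCS
  have h5 := congrArg (d 0) h4
  simp only [map_neg, map_sub, deriv_mul, hB', hα, E.tt, W.comm 0 2, map_zero] at h5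
  -- The t-derivative of q_θθ = -q - B S α reads α (1 + S² + C²) = 0, that is 2 C² α = 0.
  have hα0 : α = 0 := by
    refine eq_zero_of_mul_eq hC (eq_zero_of_mul_eq hC (eq_zero_of_two_mul ?_))
    linear_combination h5 - α * hB'' + α * hCS
  rw [hα0, mul_zero, sub_zero] at h4
  have h6 := congrArg (d 2) h2
  simp only [deriv_mul, W.d2d2h] at h6
  have h9 : d 2 (d 2 (d 3 q)) = -d 3 q := by rw [W.comm 2 3 q, W.comm 2 3, h4, map_neg]
  -- The θφ equation gives h q_θθφ = h'' q_φ = h q_φ, whereas q_θθ = -q gives h q_θθφ = -h q_φ. The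
  -- same clash of signs kills q_θ below.
  have q3 : d 3 q = 0 := by
    refine eq_zero_of_mul_eq W.h_inv (eq_zero_of_two_mul ?_)
    linear_combination -h6 + h * h9
  rw [q3, map_zero, h4] at h3
  have h7 : d 2 h * d 2 q = -(h * q) := by
    refine sub_eq_zero.1 (eq_zero_of_mul_eq W.h_inv ?_)
    linear_combination h3
  have h8 := congrArg (d 2) h7
  simp only [map_neg, deriv_mul, W.d2d2h, h4] at h8
  have q2 : d 2 q = 0 := by
    refine eq_zero_of_mul_eq W.h_inv (eq_zero_of_two_mul ?_)
    linear_combination h8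
  refine ⟨eq_zero_of_mul_eq W.h_inv ?_, hα0⟩
  rw [q2] at h7
  linear_combination h7

end WarpedFrame
end Algebra

/-! ### Conformal Killing equations on the product of a line with the hyperboloid -/

section ConformallyFlat

variable {R : Type*} [CommRing R] [Algebra ℝ R]

namespace WarpedFrame

variable {d : Fin 4 → Derivation ℝ R R} {A Ai B Bi h hi ε : R}
  (W : WarpedFrame d A Ai B Bi h hi ε)
include W

theorem deriv_deriv_h (i : Fin 4) (hi' : i ≠ 2) : d i (d 2 h) = 0 := by
  rw [W.comm]
  fin_cases i
  · simp [W.d0h]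
  · simp [W.d1h]
  · simp at hi'
  · simp [W.d3h]

theorem deriv_hi (i : Fin 4) : d i hi = -hi ^ 2 * d i h := deriv_inv W.h_inv

/-- The Killing fields of the orbits and the translations in the second coordinate. -/
theorem confEqs_of_rotation {z e k : R} (hz : ∀ i, i ≠ 3 → d i z = 0) (hz3 : d 3 (d 3 z) = -z)
    (he : ∀ i, d i e = 0) (hk : ∀ i, d i k = 0) :
    ConfEqs d A B h 0 k z (hi * d 2 h * d 3 z + e) 0 := by
  have hh := W.h_inv
  have hp := W.pyth
  have z0 := hz 0 (by decide)
  have z1 := hz 1 (by decide)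
  have z2 := hz 2 (by decide)
  constructor <;> simp only [map_add, deriv_mul, W.deriv_hi, z0, z1, z2, hz3, he, hk,
    W.d0h, W.d1h, W.d3h, W.comm 0 3 z, W.comm 1 3 z, W.comm 2 3 z, map_zero,
    W.deriv_deriv_h 0 (by decide), W.deriv_deriv_h 1 (by decide), W.deriv_deriv_h 3 (by decide),
    W.d2d2h]
  · ring
  · ring
  · ring
  · ring
  · ring
  · ring
  · ring
  · clear W; grind
  · clear W; grind

end WarpedFrame

theorem ConfEqs.add {d : Fin 4 → Derivation ℝ R R} {A B h q f a b α q' f' a' b' α' : R}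
    (E : ConfEqs d A B h q f a b α) (E' : ConfEqs d A B h q' f' a' b' α') :
    ConfEqs d A B h (q + q') (f + f') (a + a') (b + b') (α + α') := by
  constructor <;> simp only [map_add]
  · linear_combination E.tt + E'.tt
  · linear_combination E.tr + E'.tr
  · linear_combination E.tθ + E'.tθ
  · linear_combination E.tφ + E'.tφ
  · linear_combination E.rr + E'.rr
  · linear_combination E.rθ + E'.rθ
  · linear_combination E.rφ + E'.rφ
  · linear_combination E.θθ + E'.θθ
  · linear_combination E.θφ + E'.θφ
  · linear_combination E.φφ + E'.φφ

theorem ConfEqs.neg {d : Fin 4 → Derivation ℝ R R} {A B h q f a b α : R}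
    (E : ConfEqs d A B h q f a b α) : ConfEqs d A B h (-q) (-f) (-a) (-b) (-α) := by
  constructor <;> simp only [map_neg]
  · linear_combination -E.tt
  · linear_combination -E.tr
  · linear_combination -E.tθ
  · linear_combination -E.tφ
  · linear_combination -E.rr
  · linear_combination -E.rθ
  · linear_combination -E.rφ
  · linear_combination -E.θθ
  · linear_combination -E.θφ
  · linear_combination -E.φφ

/-- The equations `∇∇G = -G g` of the restrictions of linear functions to the hyperboloid with
metric `-dt² + C² (dθ² + h² dφ²)`, where `C = cosh t`, `S = sinh t`. -/
structure LinearEqs (d : Fin 4 → Derivation ℝ R R) (S C h G : R) : Prop where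
  tt : d 0 (d 0 G) = G
  tθ : C * d 0 (d 2 G) = S * d 2 G
  tφ : C * d 0 (d 3 G) = S * d 3 G
  θθ : d 2 (d 2 G) = -C ^ 2 * G + C * S * d 0 G
  θφ : h * d 2 (d 3 G) = d 2 h * d 3 G
  φφ : d 3 (d 3 G) = h ^ 2 * d 2 (d 2 G) - h * d 2 h * d 2 G

/-- The equations `∇∇N = -N g` of the restrictions of linear functions to the sphere. -/
structure SphereEqs (d : Fin 4 → Derivation ℝ R R) (h N : R) : Prop where
  t : d 0 N = 0
  r : d 1 N = 0
  θθ : d 2 (d 2 N) = -N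
  θφ : h * d 2 (d 3 N) = d 2 h * d 3 N
  φφ : d 3 (d 3 N) = h ^ 2 * d 2 (d 2 N) - h * d 2 h * d 2 N

/-- The functions occurring in the metric `-dt² + dr² + cosh² t (dθ² + sin² θ dφ²)` and in its
conformal Killing fields: `S, C = sinh t, cosh t`, `sh, ch = sinh r, cosh r`, `h = sin θ`,
`s, c = sin φ, cos φ`. -/
structure SphericalFrame (d : Fin 4 → Derivation ℝ R R) (S C Ci ch sh h hi c s : R) : Prop
    extends WarpedFrame d 1 1 C Ci h hi (-1) where
  d0C : d 0 C = S
  d0S : d 0 S = C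
  d1S : d 1 S = 0
  d2S : d 2 S = 0
  d3S : d 3 S = 0
  hCS : C ^ 2 - S ^ 2 = 1
  d0ch : d 0 ch = 0
  d1ch : d 1 ch = sh
  d2ch : d 2 ch = 0
  d3ch : d 3 ch = 0
  d0sh : d 0 sh = 0
  d1sh : d 1 sh = ch
  d2sh : d 2 sh = 0
  d3sh : d 3 sh = 0
  hch : ch ^ 2 - sh ^ 2 = 1
  d0c : d 0 c = 0
  d1c : d 1 c = 0
  d2c : d 2 c = 0
  d3c : d 3 c = -s
  d0s : d 0 s = 0
  d1s : d 1 s = 0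
  d2s : d 2 s = 0
  d3s : d 3 s = c
  hcs : c ^ 2 + s ^ 2 = 1

namespace SphericalFrame

variable {d : Fin 4 → Derivation ℝ R R} {S C Ci ch sh h hi c s : R}
  (W : SphericalFrame d S C Ci ch sh h hi c s)
include W

theorem deriv_Ci (i : Fin 4) : d i Ci = -Ci ^ 2 * d i C := deriv_inv W.B_inv

variable {q f a b α : R}

/-- The mixed equations, differentiated once, show that the Hessian of f along the hyperboloid is
-f_rr times its metric. Differentiating again, the integrability conditions give that f_rr - f has
no t-, θ- or φ-derivative, and `angular_hessian` supplies the r-derivative. So K = f_rr - f is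
constant, and f + K = f_rr is linear on the hyperboloid for each r. -/
theorem exists_linearEqs (E : ConfEqs d 1 C h q f a b α) :
    ∃ K, (∀ i, d i K = 0) ∧ LinearEqs d S C h (f + K) ∧ d 1 (d 1 f) = f + K := by
  have hC := W.B_inv
  have hh := W.h_inv
  have E0 := E.tr
  have E1 := E.rr
  have E2 := E.rθ
  have E3 := E.rφ
  have E4 := E.θθ
  have E5 := E.φφ
  simp only [deriv_one, one_pow, one_mul, zero_mul, mul_one, zero_add, W.d0C] at E0 E1 E2 E3 E4 E5
  have f00 : d 0 (d 0 f) = d 1 (d 1 f) := by rw [← E0, W.comm 0 1, E.tt, E1]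
  have f02 : C * d 0 (d 2 f) = S * d 2 f := by
    have h1 := congrArg (d 0) E2
    have h2 := congrArg (d 1) E.tθ
    simp only [map_add, map_zero, deriv_mul, deriv_sq, W.d0C, W.d1B, W.comm 1 2 q, E0,
      W.comm 2 0 f, W.comm 1 0 a] at h1 h2
    refine sub_eq_zero.1 (eq_zero_of_two_mul ?_)
    linear_combination C * h1 + C * h2 - 2 * S * E2
  have f03 : C * d 0 (d 3 f) = S * d 3 f := by
    have h1 := congrArg (d 0) E3
    have h2 := congrArg (d 1) E.tφ
    simp only [map_add, map_zero, deriv_mul, deriv_sq, W.d0C, W.d1B, W.comm 1 3 q, E0,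
      W.comm 3 0 f, W.comm 1 0 b, W.d0h, W.d1h] at h1 h2
    refine sub_eq_zero.1 (eq_zero_of_two_mul ?_)
    linear_combination C * h1 + C * h2 - 2 * S * E3
  have f23 : h * d 2 (d 3 f) = d 2 h * d 3 f := by
    have h1 := congrArg (d 3) E2
    have h2 := congrArg (d 2) E3
    have h3 := congrArg (d 1) E.θφ
    simp only [map_add, map_zero, deriv_mul, deriv_sq, W.d2B, W.d3B, W.d1h, W.comm 3 2 f,
      W.comm 3 1 a, W.comm 2 1 b] at h1 h2 h3
    refine sub_eq_zero.1 (eq_zero_of_two_mul ?_)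
    linear_combination h * h1 + h * h2 - h * C ^ 2 * h3 - 2 * d 2 h * E3
  have h22 := congrArg (d 1) E4
  have f22 : d 2 (d 2 f) = -C ^ 2 * d 1 (d 1 f) + C * S * d 0 f := by
    have h1 := congrArg (d 2) E2
    simp only [map_add, map_zero, deriv_mul, deriv_sq, W.d1B, W.d1S, W.d2B,
      W.comm 2 1 a, E0, ← E1] at h1 h22
    linear_combination h1 - C * h22
  have f33 : d 3 (d 3 f) = h ^ 2 * d 2 (d 2 f) - h * d 2 h * d 2 f := by
    have h1 := congrArg (d 2) E2
    have h2 := congrArg (d 3) E3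
    have h3 := congrArg (d 1) E5
    simp only [map_add, map_zero, deriv_mul, deriv_sq, W.d1B, W.d1S, W.d2B, W.d3B, W.d1h, W.d3h,
      W.deriv_deriv_h 1 (by decide),
      W.comm 2 1 a, W.comm 3 1 b, E0, ← E1] at h1 h2 h3 h22
    linear_combination h2 - C * h * h3 + h ^ 2 * C * h22 - h ^ 2 * h1 + h * d 2 h * E2
  have k0 : d 0 (d 1 (d 1 f)) = d 0 f := by
    have h1 := congrArg (d 0) f22
    have h2 := congrArg (d 2) f02
    simp only [map_add, map_neg, deriv_mul, deriv_sq, W.d0C, W.d0S, W.d2B, W.d2S, f00] at h1 h2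
    rw [W.comm 2 0 (d 2 f)] at h2
    refine sub_eq_zero.1 (eq_zero_of_mul_eq hC (eq_zero_of_mul_eq hC (eq_zero_of_mul_eq hC ?_)))
    linear_combination C * h1 - h2 - S * f22
  have k2 : d 2 (d 1 (d 1 f)) = d 2 f := by
    have h1 := congrArg (d 0) f02
    simp only [deriv_mul, W.d0C, W.d0S] at h1
    rw [← f00, W.comm 2 0, W.comm 2 0]
    exact sub_eq_zero.1 (eq_zero_of_mul_eq hC (by linear_combination h1))
  have k3 : d 3 (d 1 (d 1 f)) = d 3 f := by
    have h1 := congrArg (d 0) f03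
    simp only [deriv_mul, W.d0C, W.d0S] at h1
    rw [← f00, W.comm 3 0, W.comm 3 0]
    exact sub_eq_zero.1 (eq_zero_of_mul_eq hC (by linear_combination h1))
  have k1 : d 1 (d 1 (d 1 f)) = d 1 f := by
    obtain ⟨h1, -, -⟩ := W.angular_hessian E
    have h2 := congrArg (d 0) h1
    have h3 := congrArg (d 1) f22
    have h4 := congrArg (d 1) f00
    simp only [map_add, map_sub, map_neg, deriv_mul, deriv_sq, W.d0C, W.d0S, W.d1B, W.d1S,
      W.comm 0 2, W.comm 1 2, W.comm 1 0, E.tt, E1] at h2 h3 h4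
    simp only [E1]
    refine sub_eq_zero.1 (eq_zero_of_mul_eq hC (eq_zero_of_mul_eq hC (eq_zero_of_two_mul ?_)))
    linear_combination h3 - h2 - C ^ 2 * h4
  refine ⟨d 1 (d 1 f) - f, fun i => ?_, ?_, by ring⟩
  · rw [map_sub, sub_eq_zero]
    fin_cases i
    exacts [k0, k1, k2, k3]
  · have hG : f + (d 1 (d 1 f) - f) = d 1 (d 1 f) := by ring
    rw [hG]
    constructor
    · rw [k0, f00]
    · rw [k2, f02]
    · rw [k3, f03]
    · rw [k2, k0, f22]
    · rw [k3, f23]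
    · rw [k3, k2, f33]

/-- Since P_tt = P, variation of constants gives P = S x + C N with x = C P_t - S P and N = C P - S
P_t independent of t. The mixed equations make x constant; N inherits the equations on the sphere.
-/
theorem linearEqs_split {P : R} (hP : LinearEqs d S C h P) (hP1 : d 1 P = 0) :
    ∃ x N, (∀ i, d i x = 0) ∧ SphereEqs d h N ∧ P = S * x + C * N := by
  have hC := W.B_inv
  have e2 : d 2 (C * P - S * d 0 P) = C * d 2 P - S * d 0 (d 2 P) := by
    simp only [map_sub, deriv_mul, W.d2B, W.d2S, W.comm 2 0]; ring
  have e2' : C * d 2 (C * P - S * d 0 P) = d 2 P := by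
    rw [e2]; linear_combination -S * hP.tθ + d 2 P * W.hCS
  have e3 : d 3 (C * P - S * d 0 P) = C * d 3 P - S * d 0 (d 3 P) := by
    simp only [map_sub, deriv_mul, W.d3B, W.d3S, W.comm 3 0]; ring
  have e3' : C * d 3 (C * P - S * d 0 P) = d 3 P := by
    rw [e3]; linear_combination -S * hP.tφ + d 3 P * W.hCS
  have e22 := congrArg (d 2) e2'
  have e23 := congrArg (d 2) e3'
  have e33 := congrArg (d 3) e3'
  simp only [deriv_mul _ C, W.d2B, W.d3B] at e22 e23 e33
  refine ⟨C * d 0 P - S * P, C * P - S * d 0 P, fun i => ?_, ⟨?_, ?_, ?_, ?_, ?_⟩, ?_⟩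
  · fin_cases i
    · simp only [Fin.zero_eta, map_sub, deriv_mul, W.d0C, W.d0S, hP.tt]; ring
    · simp [W.d1B, W.d1S, hP1, W.comm 1 0]
    · simp only [Fin.reduceFinMk, map_sub, deriv_mul, W.d2B, W.d2S, W.comm 2 0]
      linear_combination hP.tθ
    · simp only [Fin.reduceFinMk, map_sub, deriv_mul, W.d3B, W.d3S, W.comm 3 0]
      linear_combination hP.tφ
  · simp only [map_sub, deriv_mul, W.d0C, W.d0S, hP.tt]; ring
  · simp [W.d1B, W.d1S, hP1, W.comm 1 0]
  · refine sub_eq_zero.1 (eq_zero_of_mul_eq hC ?_)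
    linear_combination e22 + hP.θθ
  · refine sub_eq_zero.1 (eq_zero_of_mul_eq hC ?_)
    linear_combination h * e23 + hP.θφ - d 2 h * e3'
  · refine sub_eq_zero.1 (eq_zero_of_mul_eq hC ?_)
    linear_combination e33 + hP.φφ - h ^ 2 * e22 + h * d 2 h * e2'
  · linear_combination -P * W.hCS

/-- The linear function with coefficients `x, y, z` on the sphere. -/
theorem sphereEqs_split {N : R} (hN : SphereEqs d h N) :
    ∃ x y z, (∀ i, d i x = 0) ∧ (∀ i, d i y = 0) ∧ (∀ i, d i z = 0) ∧
      N = h * (c * x + s * y) + d 2 h * z := by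
  -- The same device in θ, where N_θθ = -N: N = h M + h' z with z = h' N - h N_θ constant and M = h
  -- N + h' N_θ a function of φ with M'' = -M, which is split into cos φ and sin φ.
  have hz : ∀ i, d i (d 2 h * N - h * d 2 N) = 0 := by
    intro i
    fin_cases i
    · simp [W.deriv_deriv_h 0, W.d0h, hN.t, W.comm 0 2 N]
    · simp [W.deriv_deriv_h 1, W.d1h, hN.r, W.comm 1 2 N]
    · simp only [Fin.reduceFinMk, map_sub, deriv_mul, W.d2d2h, hN.θθ]; ring
    · simp only [Fin.reduceFinMk, map_sub, deriv_mul, W.deriv_deriv_h 3 (by decide), W.d3h,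
        W.comm 3 2 N]
      linear_combination -hN.θφ
  obtain ⟨M, hM⟩ : ∃ M, M = h * N + d 2 h * d 2 N := ⟨_, rfl⟩
  have m0 : d 0 M = 0 := by
    simp [hM, W.deriv_deriv_h 0, W.d0h, hN.t, W.comm 0 2 N]
  have m1 : d 1 M = 0 := by
    simp [hM, W.deriv_deriv_h 1, W.d1h, hN.r, W.comm 1 2 N]
  have m2 : d 2 M = 0 := by
    simp only [hM, map_add, deriv_mul, W.d2d2h, hN.θθ]; ring
  have m33 : d 3 (d 3 M) = -M := by
    have h1 := congrArg (d 2) hN.φφ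
    simp only [map_sub, deriv_mul, deriv_sq, W.d2d2h, hN.θθ, map_neg] at h1
    simp only [hM, map_add, deriv_mul, W.deriv_deriv_h 3 (by decide), W.d3h, W.comm 3 2 N, map_zero,
      W.comm 3 2 (d 3 N)]
    linear_combination h * hN.φφ + h ^ 3 * hN.θθ + d 2 h * h1 - (h * N + d 2 h * d 2 N) * W.pyth
  refine ⟨c * M - s * d 3 M, s * M + c * d 3 M, _, fun i => ?_, fun i => ?_, hz, ?_⟩
  · fin_cases i
    · simp [W.d0c, W.d0s, m0, W.comm 0 3]
    · simp [W.d1c, W.d1s, m1, W.comm 1 3]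
    · simp [W.d2c, W.d2s, m2, W.comm 2 3]
    · simp only [Fin.reduceFinMk, map_sub, deriv_mul, W.d3c, W.d3s, m33]; ring
  · fin_cases i
    · simp [W.d0c, W.d0s, m0, W.comm 0 3]
    · simp [W.d1c, W.d1s, m1, W.comm 1 3]
    · simp [W.d2c, W.d2s, m2, W.comm 2 3]
    · simp only [Fin.reduceFinMk, map_add, deriv_mul, W.d3c, W.d3s, m33]; ring
  · linear_combination (-h * M) * W.hcs - h * hM - N * W.pyth

/-- The conformal Killing fields coming from a linear function `P` on the hyperboloid and a
solution `u` of `u'' = u`. -/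
theorem confEqs_of_linearEqs {P u v : R} (hP : LinearEqs d S C h P) (hP1 : d 1 P = 0)
    (u0 : d 0 u = 0) (u1 : d 1 u = v) (u2 : d 2 u = 0) (u3 : d 3 u = 0)
    (v0 : d 0 v = 0) (v1 : d 1 v = u) (v2 : d 2 v = 0) (v3 : d 3 v = 0) :
    ConfEqs d 1 C h (v * d 0 P) (u * P) (-(Ci ^ 2 * v * d 2 P)) (-(Ci ^ 2 * hi ^ 2 * v * d 3 P))
      (v * P) := by
  -- The field is u P ∂_r - u' grad P. Along the hyperboloid its Lie derivative of the metric is -2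
  -- u' ∇∇P = 2 u' P g, and u'' = u gives the same factor in the r-direction.
  have hC := W.B_inv
  have hh := W.h_inv
  have h1 := hP.tθ
  have h2 := hP.tφ
  have h3 := hP.θφ
  have hCS := W.hCS
  constructor <;> simp only [map_neg, deriv_mul, deriv_sq, deriv_one, W.deriv_Ci, W.deriv_hi,
    u0, u1, u2, u3, v0, v1, v2, v3, W.d0C, W.d1B, W.d2B, W.d3B, W.d0h, W.d1h, W.d3h,
    W.comm 1 0 P, W.comm 1 2 P, W.comm 1 3 P, hP1, hP.tt, W.comm 2 0 P, W.comm 3 0 P, W.comm 3 2 P,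
    hP.θθ, hP.φφ, map_zero]
  · ring
  · ring
  · clear W; grind
  · clear W; grind
  · ring
  · clear W; grind
  · clear W; grind
  · clear W; grind
  · clear W; grind
  · clear W; grind

/-- The Killing fields coming from a linear function on the sphere. -/
theorem confEqs_of_sphereEqs {N : R} (hN : SphereEqs d h N) :
    ConfEqs d 1 C h N 0 (S * Ci * d 2 N) (S * Ci * hi ^ 2 * d 3 N) 0 := by
  have hC := W.B_inv
  have hh := W.h_inv
  have h3 := hN.θφ
  have hCS := W.hCS
  constructor <;> simp only [deriv_mul, deriv_sq, deriv_one, W.deriv_Ci, W.deriv_hi,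
    W.d0C, W.d1B, W.d2B, W.d3B, W.d0h, W.d1h, W.d3h, W.d0S, W.d1S, W.d2S, W.d3S,
    W.comm 0 2 N, W.comm 0 3 N, W.comm 1 2 N, W.comm 1 3 N, hN.t, hN.r, W.comm 3 2 N,
    hN.θθ, hN.φφ, map_zero]
  · ring
  · clear W; grind
  · clear W; grind
  · ring
  · ring
  · ring
  · clear W; grind
  · clear W; grind
  · clear W; grind

end SphericalFrame

end ConformallyFlat

/-! ### The general conformal Killing field with fifteen coefficients -/

section Model

variable {R : Type*} [CommRing R] [Algebra ℝ R]

/-- The linear function with coefficients `x, y, z` on the sphere. -/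
def sphereLinear (d : Fin 4 → Derivation ℝ R R) (h c s x y z : R) : R :=
  h * (c * x + s * y) + d 2 h * z

/-- The linear function with coefficients `w, x, y, z` on the hyperboloid. -/
def hyperboloidLinear (d : Fin 4 → Derivation ℝ R R) (S C h c s w x y z : R) : R :=
  S * w + C * sphereLinear d h c s x y z

/-- The components of the conformal Killing field of `-dt² + dr² + cosh² t (dθ² + sin² θ dφ²)`
with fifteen given coefficients. -/
def modelField (d : Fin 4 → Derivation ℝ R R) (S C Ci ch sh h hi c s : R) (k : Fin 15 → R) :
    Fin 4 → R :=
  ![sh * d 0 (hyperboloidLinear d S C h c s (k 0) (k 1) (k 2) (k 3))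
      + ch * d 0 (hyperboloidLinear d S C h c s (k 4) (k 5) (k 6) (k 7))
      + sphereLinear d h c s (k 8) (k 9) (k 10),
    ch * hyperboloidLinear d S C h c s (k 0) (k 1) (k 2) (k 3)
      + sh * hyperboloidLinear d S C h c s (k 4) (k 5) (k 6) (k 7) + k 11,
    -(Ci ^ 2 * sh * d 2 (hyperboloidLinear d S C h c s (k 0) (k 1) (k 2) (k 3)))
      + -(Ci ^ 2 * ch * d 2 (hyperboloidLinear d S C h c s (k 4) (k 5) (k 6) (k 7)))
      + S * Ci * d 2 (sphereLinear d h c s (k 8) (k 9) (k 10))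
      + (c * k 12 + s * k 13),
    -(Ci ^ 2 * hi ^ 2 * sh * d 3 (hyperboloidLinear d S C h c s (k 0) (k 1) (k 2) (k 3)))
      + -(Ci ^ 2 * hi ^ 2 * ch * d 3 (hyperboloidLinear d S C h c s (k 4) (k 5) (k 6) (k 7)))
      + S * Ci * hi ^ 2 * d 3 (sphereLinear d h c s (k 8) (k 9) (k 10))
      + (hi * d 2 h * d 3 (c * k 12 + s * k 13) + k 14)]

/-- `LinearEqs` involves no r-derivative, so functions of r alone act as constants. -/
theorem LinearEqs.mul_sub_mul {d : Fin 4 → Derivation ℝ R R} {S C h G G' u v : R}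
    (hG : LinearEqs d S C h G) (hG' : LinearEqs d S C h G') (hu : ∀ i, i ≠ 1 → d i u = 0)
    (hv : ∀ i, i ≠ 1 → d i v = 0) : LinearEqs d S C h (u * G - v * G') := by
  constructor <;> simp only [map_sub, deriv_mul, hu 0 (by decide), hu 2 (by decide),
    hu 3 (by decide), hv 0 (by decide), hv 2 (by decide), hv 3 (by decide), zero_mul, add_zero]
  · linear_combination u * hG.tt - v * hG'.tt
  · linear_combination u * hG.tθ - v * hG'.tθ
  · linear_combination u * hG.tφ - v * hG'.tφ
  · linear_combination u * hG.θθ - v * hG'.θθ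
  · linear_combination u * hG.θφ - v * hG'.θφ
  · linear_combination u * hG.φφ - v * hG'.φφ

namespace SphericalFrame

variable {d : Fin 4 → Derivation ℝ R R} {S C Ci ch sh h hi c s : R}
  (W : SphericalFrame d S C Ci ch sh h hi c s)
include W

theorem sphereEqs_sphereLinear {x y z : R} (hx : ∀ i, d i x = 0) (hy : ∀ i, d i y = 0)
    (hz : ∀ i, d i z = 0) : SphereEqs d h (sphereLinear d h c s x y z) := by
  constructor <;> simp only [sphereLinear, map_add, deriv_mul, hx, hy, hz, W.d0h, W.d1h, W.d3h,
    W.deriv_deriv_h 0 (by decide), W.deriv_deriv_h 1 (by decide), W.deriv_deriv_h 3 (by decide),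
    W.d2d2h, W.d0c, W.d1c, W.d2c, W.d3c, W.d0s, W.d1s, W.d2s, W.d3s, map_zero, map_neg, deriv_one]
  · ring
  · ring
  · ring
  · ring
  · linear_combination (h * (c * x + s * y)) * W.pyth

theorem linearEqs_hyperboloidLinear {w x y z : R} (hw : ∀ i, d i w = 0) (hx : ∀ i, d i x = 0)
    (hy : ∀ i, d i y = 0) (hz : ∀ i, d i z = 0) :
    LinearEqs d S C h (hyperboloidLinear d S C h c s w x y z) ∧
      d 1 (hyperboloidLinear d S C h c s w x y z) = 0 := by
  have hN := W.sphereEqs_sphereLinear hx hy hz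
  refine ⟨?_, by simp [hyperboloidLinear, hN.r, hw, W.d1S, W.d1B]⟩
  have h3 := hN.θφ
  have hCS := W.hCS
  constructor <;> simp only [hyperboloidLinear, map_add, deriv_mul, hw, W.d0S, W.d0C, W.d2S, W.d2B,
    W.d3S, W.d3B, hN.t, W.comm 0 2 (sphereLinear d h c s x y z),
    W.comm 0 3 (sphereLinear d h c s x y z), hN.θθ, hN.φφ, map_zero]
  · ring
  · ring
  · ring
  · linear_combination C * sphereLinear d h c s x y z * hCS
  · linear_combination C * h3
  · ring

theorem linearEqs_deriv {G : R} (hG : LinearEqs d S C h G) : LinearEqs d S C h (d 1 G) := by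
  constructor
  · rw [W.comm 0 1, W.comm 0 1, hG.tt]
  · have := congrArg (d 1) hG.tθ
    simp only [deriv_mul, W.d1B, W.d1S] at this
    rw [W.comm 2 1, W.comm 0 1]
    linear_combination this
  · have := congrArg (d 1) hG.tφ
    simp only [deriv_mul, W.d1B, W.d1S] at this
    rw [W.comm 3 1, W.comm 0 1]
    linear_combination this
  · have := congrArg (d 1) hG.θθ
    simp only [map_add, map_neg, deriv_mul, deriv_sq, W.d1B, W.d1S] at this
    rw [W.comm 2 1, W.comm 2 1, W.comm 0 1]
    linear_combination this
  · have := congrArg (d 1) hG.θφ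
    simp only [deriv_mul, W.d1h, W.deriv_deriv_h 1 (by decide)] at this
    rw [W.comm 3 1, W.comm 2 1]
    linear_combination this
  · have := congrArg (d 1) hG.φφ
    simp only [map_sub, deriv_mul, deriv_sq, W.d1h, W.deriv_deriv_h 1 (by decide)] at this
    rw [W.comm 3 1, W.comm 3 1, W.comm 2 1, W.comm 2 1]
    linear_combination this

theorem confEqs_modelField {k : Fin 15 → R} (hk : ∀ j i, d i (k j) = 0) :
    ∃ α, ConfEqs d 1 C h (modelField d S C Ci ch sh h hi c s k 0)
      (modelField d S C Ci ch sh h hi c s k 1) (modelField d S C Ci ch sh h hi c s k 2)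
      (modelField d S C Ci ch sh h hi c s k 3) α := by
  obtain ⟨hP, hP1⟩ := W.linearEqs_hyperboloidLinear (hk 0) (hk 1) (hk 2) (hk 3)
  obtain ⟨hQ, hQ1⟩ := W.linearEqs_hyperboloidLinear (hk 4) (hk 5) (hk 6) (hk 7)
  have hN := W.sphereEqs_sphereLinear (hk 8) (hk 9) (hk 10)
  have E1 := W.confEqs_of_linearEqs hP hP1 W.d0ch W.d1ch W.d2ch W.d3ch W.d0sh W.d1sh W.d2sh W.d3sh
  have E2 := W.confEqs_of_linearEqs hQ hQ1 W.d0sh W.d1sh W.d2sh W.d3sh W.d0ch W.d1ch W.d2ch W.d3ch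
  have E3 := W.confEqs_of_sphereEqs hN
  have E4 := W.confEqs_of_rotation (z := c * k 12 + s * k 13) (e := k 14) (k := k 11)
    (fun i hi => by
      fin_cases i
      · simp [hk, W.d0c, W.d0s]
      · simp [hk, W.d1c, W.d1s]
      · simp [hk, W.d2c, W.d2s]
      · simp at hi)
    (by simp only [map_add, deriv_mul, hk, W.d3c, W.d3s, map_neg, map_zero]; ring)
    (hk 14) (hk 11)
  have := ((E1.add E2).add E3).add E4
  rw [add_zero, add_zero] at this
  exact ⟨_, this⟩

/-- Known solutions are subtracted until only a translation and a rotation are left: first the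
fields of P and Q, which reduce f to a constant, then the boost of N, which removes q. -/
theorem exists_modelField {q f a b α : R} (E : ConfEqs d 1 C h q f a b α) :
    ∃ k : Fin 15 → R, (∀ j i, d i (k j) = 0) ∧
      ![q, f, a, b] = modelField d S C Ci ch sh h hi c s k := by
  obtain ⟨K, hK, hG, hG1⟩ := W.exists_linearEqs E
  obtain ⟨G, rfl⟩ : ∃ G, f = G - K := ⟨f + K, by ring⟩
  rw [sub_add_cancel] at hG hG1
  simp only [map_sub, hK, sub_zero] at hG1
  have hG' := W.linearEqs_deriv hG
  have hch : ∀ i, i ≠ 1 → d i ch = 0 := fun i hi => by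
    fin_cases i
    exacts [W.d0ch, (hi rfl).elim, W.d2ch, W.d3ch]
  have hsh : ∀ i, i ≠ 1 → d i sh = 0 := fun i hi => by
    fin_cases i
    exacts [W.d0sh, (hi rfl).elim, W.d2sh, W.d3sh]
  have hP := hG.mul_sub_mul hG' hch hsh
  have hP1 : d 1 (ch * G - sh * d 1 G) = 0 := by
    simp only [map_sub, deriv_mul, W.d1ch, W.d1sh, hG1]; ring
  have hQ := hG'.mul_sub_mul hG hch hsh
  have hQ1 : d 1 (ch * d 1 G - sh * G) = 0 := by
    simp only [map_sub, deriv_mul, W.d1ch, W.d1sh, hG1]; ring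
  -- As G_rr = G, these are the r-independent coefficients in G = ch P + sh Q.
  obtain ⟨P, hPe⟩ : ∃ P, P = ch * G - sh * d 1 G := ⟨_, rfl⟩
  obtain ⟨Q, hQe⟩ : ∃ Q, Q = ch * d 1 G - sh * G := ⟨_, rfl⟩
  rw [← hPe] at hP hP1
  rw [← hQe] at hQ hQ1
  have E1 := W.confEqs_of_linearEqs hP hP1 W.d0ch W.d1ch W.d2ch W.d3ch W.d0sh W.d1sh W.d2sh W.d3sh
  have E2 := W.confEqs_of_linearEqs hQ hQ1 W.d0sh W.d1sh W.d2sh W.d3sh W.d0ch W.d1ch W.d2ch W.d3ch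
  have hf : G = ch * P + sh * Q := by rw [hPe, hQe]; linear_combination -G * W.hch
  have E3 := (E.add E1.neg).add E2.neg
  obtain ⟨N, hN⟩ : ∃ N, N = q + -(sh * d 0 P) + -(ch * d 0 Q) := ⟨_, rfl⟩
  have hf' : G - K + -(ch * P) + -(sh * Q) = -K := by rw [hf]; ring
  rw [← hN, hf'] at E3
  obtain ⟨α', E4⟩ : ∃ α', ConfEqs d 1 C h N (-K) (a + - -(Ci ^ 2 * sh * d 2 P) +
      - -(Ci ^ 2 * ch * d 2 Q)) (b + - -(Ci ^ 2 * hi ^ 2 * sh * d 3 P) +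
      - -(Ci ^ 2 * hi ^ 2 * ch * d 3 Q)) α' := ⟨_, E3⟩
  -- The second component is now the constant -K and the rr equation reads α' = f_r; from here on
  -- the field is Killing.
  have hα' : α' = 0 := by
    have := E4.rr
    simp only [deriv_one, map_neg, hK] at this
    linear_combination -this
  rw [hα'] at E4
  have hNS : SphereEqs d h N := by
    obtain ⟨h1, h2, h3⟩ := W.angular_hessian E4
    refine ⟨E4.tt, ?_, ?_, h2, h3⟩
    · rw [E4.tr, map_neg, hK]; ring
    · rw [h1, W.d0C, W.d0S, map_zero]
      linear_combination -N * W.hCS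
  have E5 := E4.add (W.confEqs_of_sphereEqs hNS).neg
  rw [add_neg_cancel, neg_zero, add_zero, add_zero] at E5
  obtain ⟨ζ, hζ⟩ : ∃ ζ, ζ = a + - -(Ci ^ 2 * sh * d 2 P) + - -(Ci ^ 2 * ch * d 2 Q)
    + -(S * Ci * d 2 N) := ⟨_, rfl⟩
  rw [← hζ] at E5
  obtain ⟨-, ζ0, ζ1, ζ2, ζ3, he⟩ := W.sphere_killing E5 (by simp [hK]) (by simp [hK])
  obtain ⟨k0, N0, hk0, hN0, hP'⟩ := W.linearEqs_split hP hP1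
  obtain ⟨k4, N4, hk4, hN4, hQ'⟩ := W.linearEqs_split hQ hQ1
  obtain ⟨k1, k2, k3, hk1, hk2, hk3, hN0'⟩ := W.sphereEqs_split hN0
  obtain ⟨k5, k6, k7, hk5, hk6, hk7, hN4'⟩ := W.sphereEqs_split hN4
  obtain ⟨k8, k9, k10, hk8, hk9, hk10, hN'⟩ := W.sphereEqs_split hNS
  have hPl : P = hyperboloidLinear d S C h c s k0 k1 k2 k3 := by rw [hP', hN0']; rfl
  have hQl : Q = hyperboloidLinear d S C h c s k4 k5 k6 k7 := by rw [hQ', hN4']; rfl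
  have hNl : N = sphereLinear d h c s k8 k9 k10 := hN'
  obtain ⟨k12, hk12⟩ : ∃ x, x = c * ζ - s * d 3 ζ := ⟨_, rfl⟩
  obtain ⟨k13, hk13⟩ : ∃ x, x = s * ζ + c * d 3 ζ := ⟨_, rfl⟩
  have hζl : ζ = c * k12 + s * k13 := by
    rw [hk12, hk13]; linear_combination -ζ * W.hcs
  have hk12' : ∀ i, d i k12 = 0 := by
    intro i
    fin_cases i
    · simp [hk12, W.d0c, W.d0s, ζ0, W.comm 0 3]
    · simp [hk12, W.d1c, W.d1s, ζ1, W.comm 1 3]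
    · simp [hk12, W.d2c, W.d2s, ζ2, W.comm 2 3]
    · simp only [hk12, Fin.reduceFinMk, map_sub, deriv_mul, W.d3c, W.d3s, ζ3]; ring
  have hk13' : ∀ i, d i k13 = 0 := by
    intro i
    fin_cases i
    · simp [hk13, W.d0c, W.d0s, ζ0, W.comm 0 3]
    · simp [hk13, W.d1c, W.d1s, ζ1, W.comm 1 3]
    · simp [hk13, W.d2c, W.d2s, ζ2, W.comm 2 3]
    · simp only [hk13, Fin.reduceFinMk, map_add, deriv_mul, W.d3c, W.d3s, ζ3]; ring
  obtain ⟨e, hee⟩ : ∃ e, e = b + - -(Ci ^ 2 * hi ^ 2 * sh * d 3 P)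
    + - -(Ci ^ 2 * hi ^ 2 * ch * d 3 Q) + -(S * Ci * hi ^ 2 * d 3 N) - hi * d 2 h * d 3 ζ :=
    ⟨_, rfl⟩
  rw [← hee] at he
  refine ⟨![k0, k1, k2, k3, k4, k5, k6, k7, k8, k9, k10, -K, k12, k13, e], ?_, ?_⟩
  · intro j i
    have hK' : d i (-K) = 0 := by rw [map_neg, hK, neg_zero]
    fin_cases j
    exacts [hk0 i, hk1 i, hk2 i, hk3 i, hk4 i, hk5 i, hk6 i, hk7 i, hk8 i, hk9 i, hk10 i, hK',
      hk12' i, hk13' i, he i]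
  · have hq : q = sh * d 0 P + ch * d 0 Q + N := by rw [hN]; ring
    have hf : G - K = ch * P + sh * Q + -K := by rw [hf]; ring
    have ha : a = -(Ci ^ 2 * sh * d 2 P) + -(Ci ^ 2 * ch * d 2 Q) + S * Ci * d 2 N + ζ := by
      rw [hζ]; ring
    have hb : b = -(Ci ^ 2 * hi ^ 2 * sh * d 3 P) + -(Ci ^ 2 * hi ^ 2 * ch * d 3 Q)
        + S * Ci * hi ^ 2 * d 3 N + (hi * d 2 h * d 3 ζ + e) := by
      rw [hee]; ring
    rw [hq, hf, ha, hb, hPl, hQl, hNl, hζl]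
    rfl

theorem sphereLinear_eq_zero {x y z : R} (hx : ∀ i, d i x = 0) (hy : ∀ i, d i y = 0)
    (hz : ∀ i, d i z = 0) (h0 : sphereLinear d h c s x y z = 0) : x = 0 ∧ y = 0 ∧ z = 0 := by
  have h1 := congrArg (d 2) h0
  have h2 := congrArg (d 3) h1
  have h3 := congrArg (d 3) h0
  have h4 := W.deriv_deriv_h 3 (by decide)
  have h5 := W.pyth
  have h6 := W.hcs
  simp only [sphereLinear, map_add, deriv_mul, hx, hy, hz, W.d2d2h, W.d3h, h4, W.d2c, W.d2s, W.d3c,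
    W.d3s, map_zero, map_neg, deriv_one, mul_zero, zero_mul, add_zero, zero_add] at h1 h2 h3 h0
  have e1 : c * x + s * y = 0 := by
    linear_combination h * h0 + d 2 h * h1 - (c * x + s * y) * h5
  have e2 : -s * x + c * y = 0 := by
    linear_combination h * h3 + d 2 h * h2 - (-s * x + c * y) * h5
  refine ⟨?_, ?_, ?_⟩
  · linear_combination c * e1 - s * e2 - x * h6
  · linear_combination s * e1 + c * e2 - y * h6
  · linear_combination d 2 h * h0 - h * h1 - z * h5

theorem hyperboloidLinear_eq_zero {w x y z : R} (hw : ∀ i, d i w = 0) (hx : ∀ i, d i x = 0)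
    (hy : ∀ i, d i y = 0) (hz : ∀ i, d i z = 0)
    (h0 : hyperboloidLinear d S C h c s w x y z = 0) : w = 0 ∧ x = 0 ∧ y = 0 ∧ z = 0 := by
  have hN := W.sphereEqs_sphereLinear hx hy hz
  have h1 := congrArg (d 0) h0
  simp only [hyperboloidLinear, map_add, deriv_mul, hw, W.d0S, W.d0C, hN.t, map_zero] at h0 h1
  refine ⟨?_, W.sphereLinear_eq_zero hx hy hz ?_⟩
  · linear_combination C * h1 - S * h0 - w * W.hCS
  · linear_combination C * h0 - S * h1 - sphereLinear d h c s x y z * W.hCS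

/-- Two r-derivatives of the second component give sh P + ch Q = 0 and ch P + sh Q = 0, so P = Q =
0. Then the components yield N = 0, the translation, the two rotations and the coefficient of ∂_φ in
turn. -/
theorem eq_zero_of_modelField_eq_zero {k : Fin 15 → R} (hk : ∀ j i, d i (k j) = 0)
    (h0 : modelField d S C Ci ch sh h hi c s k = 0) : k = 0 := by
  have q0 := congrFun h0 0
  have f0 := congrFun h0 1
  have a0 := congrFun h0 2
  have b0 := congrFun h0 3
  simp only [modelField, Matrix.cons_val, Pi.zero_apply] at q0 f0 a0 b0
  obtain ⟨hP, hP1⟩ := W.linearEqs_hyperboloidLinear (hk 0) (hk 1) (hk 2) (hk 3)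
  obtain ⟨hQ, hQ1⟩ := W.linearEqs_hyperboloidLinear (hk 4) (hk 5) (hk 6) (hk 7)
  have f1 := congrArg (d 1) f0
  have f2 := congrArg (d 1) f1
  simp only [map_add, deriv_mul, hP1, hQ1, W.d1ch, W.d1sh, hk, map_zero, mul_zero, zero_add,
    add_zero] at f1 f2
  have P0 : hyperboloidLinear d S C h c s (k 0) (k 1) (k 2) (k 3) = 0 := by
    linear_combination ch * f2 - sh * f1
      - hyperboloidLinear d S C h c s (k 0) (k 1) (k 2) (k 3) * W.hch
  have Q0 : hyperboloidLinear d S C h c s (k 4) (k 5) (k 6) (k 7) = 0 := by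
    linear_combination ch * f1 - sh * f2
      - hyperboloidLinear d S C h c s (k 4) (k 5) (k 6) (k 7) * W.hch
  simp only [P0, Q0, map_zero, mul_zero, zero_add, neg_zero] at q0 f0 a0 b0
  simp only [q0, map_zero, mul_zero, zero_add] at a0 b0
  simp only [a0, map_zero, mul_zero, zero_add] at b0
  have a1 := congrArg (d 3) a0
  simp only [map_add, deriv_mul, hk, W.d3c, W.d3s, map_zero, mul_zero, zero_add] at a1
  obtain ⟨z0, z1, z2, z3⟩ := W.hyperboloidLinear_eq_zero (hk 0) (hk 1) (hk 2) (hk 3) P0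
  obtain ⟨z4, z5, z6, z7⟩ := W.hyperboloidLinear_eq_zero (hk 4) (hk 5) (hk 6) (hk 7) Q0
  obtain ⟨z8, z9, z10⟩ := W.sphereLinear_eq_zero (hk 8) (hk 9) (hk 10) q0
  have z12 : k 12 = 0 := by linear_combination c * a0 - s * a1 - k 12 * W.hcs
  have z13 : k 13 = 0 := by linear_combination s * a0 + c * a1 - k 13 * W.hcs
  funext j
  fin_cases j
  exacts [z0, z1, z2, z3, z4, z5, z6, z7, z8, z9, z10, f0, z12, z13, b0]

end SphericalFrame
end Model

/-! ### Lie derivative and Hessian of a diagonal metric; cancellation -/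

section DiagonalMetric

variable {n : ℕ} {U : TopologicalSpace.Opens (Fin n → ℝ)}
  {g : (Fin n → ℝ) → Matrix (Fin n) (Fin n) ℝ} {G : Fin n → smoothAlg U}

/-- The components of a smooth vector field as elements of the algebra of smooth functions. -/
def component (X : (Fin n → ℝ) → Fin n → ℝ) (hX : ContDiffOn ℝ ∞ X U) (c : Fin n) : smoothAlg U :=
  ofFun (fun x => X x c) (contDiffOn_pi.1 hX c)

theorem pd_diagonal (hg : ∀ x : U, g x = Matrix.diagonal fun i => (G i : U → ℝ) x)
    (c a b : Fin n) (x : U) :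
    pd c (fun y => g y a b) x = if a = b then (partialD c (G a) : U → ℝ) x else 0 := by
  split_ifs with h
  · subst h
    rw [partialD_apply (G a) (fun y => g y a a) (fun y => by simp [hg])]
  · rw [pd_congr (f' := fun _ => 0) x.2 (fun y hy => by simp [hg ⟨y, hy⟩, h])]
    simp [pd]

/-- The components of the Lie derivative of a diagonal metric. -/
theorem lieDerivMetric_diagonal (hg : ∀ x : U, g x = Matrix.diagonal fun i => (G i : U → ℝ) x)
    {X : (Fin n → ℝ) → Fin n → ℝ} (hX : ContDiffOn ℝ ∞ X U) (a b : Fin n) (x : U) :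
    lieDerivMetric g X a b x = (((if a = b then ∑ c, partialD c (G a) * component X hX c else 0) +
      G b * partialD a (component X hX b) + G a * partialD b (component X hX a) : smoothAlg U) :
        U → ℝ) x := by
  have h1 : ∀ i k, pd i (fun y => X y k) x = (partialD i (component X hX k) : U → ℝ) x :=
    fun i k => (partialD_apply _ _ (fun _ => rfl) i x).symm
  simp only [lieDerivMetric, pd_diagonal hg, h1, hg, Matrix.diagonal_apply, Finset.sum_add_distrib,
    ite_mul, zero_mul, Finset.sum_ite_eq, Finset.sum_ite_eq', Finset.mem_univ, if_true]
  split_ifs with h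
  · subst h
    simp [component]
  · simp

/-- The components of the Hessian with respect to a diagonal metric. -/
theorem hessian_diagonal (hg : ∀ x : U, g x = Matrix.diagonal fun i => (G i : U → ℝ) x)
    {Gi : Fin n → smoothAlg U} (hGi : ∀ i, G i * Gi i = 1)
    {f : (Fin n → ℝ) → ℝ} (hf : ContDiffOn ℝ ∞ f U) (a b : Fin n) (x : U) :
    hessian g f a b x = ((partialD a (partialD b (ofFun f hf)) - algebraMap ℝ _ 2⁻¹ *
      (Gi b * partialD a (G b) * partialD b (ofFun f hf) +
        Gi a * partialD b (G a) * partialD a (ofFun f hf) -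
        if a = b then ∑ c, Gi c * partialD c (G a) * partialD c (ofFun f hf) else 0) : smoothAlg U) :
        U → ℝ) x := by
  have hinv : (g x)⁻¹ = Matrix.diagonal fun i => (Gi i : U → ℝ) x := by
    refine Matrix.inv_eq_right_inv ?_
    rw [hg, Matrix.diagonal_mul_diagonal, ← Matrix.diagonal_one]
    congr 1
    funext i
    exact congrFun (congrArg Subtype.val (hGi i)) x
  have h1 : ∀ i, pd i f x = (partialD i (ofFun f hf) : U → ℝ) x :=
    fun i => (partialD_apply _ _ (fun _ => rfl) i x).symm
  have h2 : pd a (pd b f) x = (partialD a (partialD b (ofFun f hf)) : U → ℝ) x := by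
    rw [partialD_apply _ (pd b f) (fun y => by rw [partialD_ofFun, ofFun_apply])]
  simp only [hessian, christoffel, pd_diagonal hg, h1, h2, hinv, Matrix.diagonal_apply,
    ite_mul, zero_mul, Finset.sum_ite_eq, Finset.mem_univ, if_true]
  have h3 : ∀ c, (1 / 2 * ((Gi c : U → ℝ) x * ((if c = b then (partialD a (G c) : U → ℝ) x else 0)
      + (if c = a then (partialD b (G c) : U → ℝ) x else 0)
      - if a = b then (partialD c (G a) : U → ℝ) x else 0)) * (partialD c (ofFun f hf) : U → ℝ) x)
    = (if c = b then 2⁻¹ * (Gi c : U → ℝ) x * (partialD a (G c) : U → ℝ) x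
          * (partialD c (ofFun f hf) : U → ℝ) x else 0)
      + (if c = a then 2⁻¹ * (Gi c : U → ℝ) x * (partialD b (G c) : U → ℝ) x
          * (partialD c (ofFun f hf) : U → ℝ) x else 0)
      - if a = b then 2⁻¹ * (Gi c : U → ℝ) x * (partialD c (G a) : U → ℝ) x
          * (partialD c (ofFun f hf) : U → ℝ) x else 0 := by
    intro c
    split_ifs <;> ring
  simp only [h3, Finset.sum_add_distrib, Finset.sum_sub_distrib, Finset.sum_ite_eq',
    Finset.mem_univ, if_true]
  split_ifs with h
  · subst h
    simp [Finset.mul_sum, mul_assoc, mul_add, mul_sub]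
  · simp [mul_assoc, mul_add]

/-- Move the i-th coordinate of x to that of a point where `a` does not vanish: `m` is unchanged,
and there `a` can be divided out. The box shape `hbox` keeps the moved point in U. -/
theorem Cancels.of_apply_coord (hU : Convex ℝ (U : Set (Fin n → ℝ)))
    (hbox : ∀ x y : U, ∀ i, Function.update (x : Fin n → ℝ) i ((y : Fin n → ℝ) i) ∈ U)
    {i : Fin n} {a : smoothAlg U} {φ : ℝ → ℝ}
    (ha : ∀ x : U, (a : U → ℝ) x = φ ((x : Fin n → ℝ) i)) (h0 : a ≠ 0) :
    Cancels (partialD i) a := by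
  obtain ⟨y, hy⟩ : ∃ y, (a : U → ℝ) y ≠ 0 := by
    by_contra! h
    exact h0 (smoothAlg_ext h)
  intro m hm hz
  refine smoothAlg_ext fun x => ?_
  rw [← apply_update_of_partialD_eq_zero hU hm x _ (hbox x y i)]
  have h1 := congrFun (congrArg Subtype.val hz) ⟨_, hbox x y i⟩
  have h2 : (a : U → ℝ) ⟨_, hbox x y i⟩ = (a : U → ℝ) y := by simp [ha]
  have h3 : (a : U → ℝ) ⟨_, hbox x y i⟩ ^ 2 * (m : U → ℝ) ⟨_, hbox x y i⟩ = 0 := h1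
  rw [h2] at h3
  exact (mul_eq_zero.1 h3).resolve_left (pow_ne_zero 2 hy)

end DiagonalMetric

/-! ### From tensor components to the scalar equations; conformal rescaling -/

section Components

variable {R : Type*} [CommRing R] [Algebra ℝ R]

theorem two_mul_half (x : R) : 2 * (algebraMap ℝ R 2⁻¹ * x) = x := by
  rw [← mul_assoc, ← map_ofNat (algebraMap ℝ R) 2, ← map_mul, mul_inv_cancel₀ two_ne_zero, map_one,
    one_mul]

namespace WarpedFrame

variable {d : Fin 4 → Derivation ℝ R R} {A Ai B Bi h hi ε : R}
  (W : WarpedFrame d A Ai B Bi h hi ε)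
include W

theorem confEqs_iff (X : Fin 4 → R) (α : R) :
    (∀ a b, (if a = b then
        ∑ c, d c ((![-1, A ^ 2, B ^ 2, B ^ 2 * h ^ 2] : Fin 4 → R) a) * X c else 0) +
      (![-1, A ^ 2, B ^ 2, B ^ 2 * h ^ 2] : Fin 4 → R) b * d a (X b) +
      (![-1, A ^ 2, B ^ 2, B ^ 2 * h ^ 2] : Fin 4 → R) a * d b (X a) =
      2 * α * if a = b then (![-1, A ^ 2, B ^ 2, B ^ 2 * h ^ 2] : Fin 4 → R) a else 0) ↔
    ConfEqs d A B h (X 0) (X 1) (X 2) (X 3) α := by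
  have hA := W.A_inv
  have hB := W.B_inv
  have hh := W.h_inv
  constructor
  · intro H
    have h00 := H 0 0
    have h01 := H 0 1
    have h02 := H 0 2
    have h03 := H 0 3
    have h11 := H 1 1
    have h12 := H 1 2
    have h13 := H 1 3
    have h22 := H 2 2
    have h23 := H 2 3
    have h33 := H 3 3
    simp only [Fin.sum_univ_four, Matrix.cons_val, Fin.reduceEq, if_true, if_false, map_neg,
      deriv_one, deriv_mul, deriv_sq, W.d1A, W.d2A, W.d3A, W.d1B, W.d2B, W.d3B, W.d0h, W.d1h,
      W.d3h] at h00 h01 h02 h03 h11 h12 h13 h22 h23 h33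
    constructor
    · refine sub_eq_zero.1 (eq_zero_of_two_mul ?_)
      linear_combination -h00
    · linear_combination -h01
    · linear_combination -h02
    · linear_combination -h03
    · refine sub_eq_zero.1 (eq_zero_of_two_mul (eq_zero_of_mul_eq hA ?_))
      linear_combination h11
    · linear_combination h12
    · linear_combination h13
    · refine sub_eq_zero.1 (eq_zero_of_two_mul (eq_zero_of_mul_eq hB ?_))
      linear_combination h22
    · refine eq_zero_of_mul_eq hB (eq_zero_of_mul_eq hB ?_)
      linear_combination h23
    · refine sub_eq_zero.1 (eq_zero_of_two_mul (eq_zero_of_mul_eq hB (eq_zero_of_mul_eq hh ?_)))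
      linear_combination h33
  · intro E a b
    fin_cases a <;> fin_cases b <;>
    simp only [Fin.zero_eta, Fin.mk_one, Fin.reduceFinMk, Fin.sum_univ_four, Matrix.cons_val,
      Fin.reduceEq, if_true, if_false, map_neg,
      deriv_one, deriv_mul, deriv_sq, W.d1A, W.d2A, W.d3A, W.d1B, W.d2B, W.d3B, W.d0h, W.d1h,
      W.d3h]
    · linear_combination -2 * E.tt
    · linear_combination -E.tr
    · linear_combination -E.tθ
    · linear_combination -E.tφ
    · linear_combination -E.tr
    · linear_combination 2 * A * E.rr
    · linear_combination E.rθ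
    · linear_combination E.rφ
    · linear_combination -E.tθ
    · linear_combination E.rθ
    · linear_combination 2 * B * E.θθ
    · linear_combination B ^ 2 * E.θφ
    · linear_combination -E.tφ
    · linear_combination E.rφ
    · linear_combination B ^ 2 * E.θφ
    · linear_combination 2 * B * h * E.φφ

theorem hessEqs_of_components {α β : R}
    (H : ∀ a b, d a (d b α) - algebraMap ℝ R 2⁻¹ *
      ((![-1, Ai ^ 2, Bi ^ 2, Bi ^ 2 * hi ^ 2] : Fin 4 → R) b *
          d a ((![-1, A ^ 2, B ^ 2, B ^ 2 * h ^ 2] : Fin 4 → R) b) * d b α +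
        (![-1, Ai ^ 2, Bi ^ 2, Bi ^ 2 * hi ^ 2] : Fin 4 → R) a *
          d b ((![-1, A ^ 2, B ^ 2, B ^ 2 * h ^ 2] : Fin 4 → R) a) * d a α -
        if a = b then ∑ c, (![-1, Ai ^ 2, Bi ^ 2, Bi ^ 2 * hi ^ 2] : Fin 4 → R) c *
          d c ((![-1, A ^ 2, B ^ 2, B ^ 2 * h ^ 2] : Fin 4 → R) a) * d c α else 0) =
      β * if a = b then (![-1, A ^ 2, B ^ 2, B ^ 2 * h ^ 2] : Fin 4 → R) a else 0) :
    HessEqs d A B α β := by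
  have hA := W.A_inv
  have hB := W.B_inv
  have hh := W.h_inv
  -- Doubling removes the factor 1/2 of the Christoffel symbols, an element of ℝ that
  -- `linear_combination` would otherwise have to handle inside R.
  have h00 := congrArg (2 * ·) (H 0 0)
  have h01 := congrArg (2 * ·) (H 0 1)
  have h02 := congrArg (2 * ·) (H 0 2)
  have h03 := congrArg (2 * ·) (H 0 3)
  have h11 := congrArg (2 * ·) (H 1 1)
  have h12 := congrArg (2 * ·) (H 1 2)
  have h13 := congrArg (2 * ·) (H 1 3)
  have h22 := congrArg (2 * ·) (H 2 2)
  simp only [mul_sub, two_mul_half] at h00 h01 h02 h03 h11 h12 h13 h22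
  simp only [Fin.sum_univ_four, Matrix.cons_val, Fin.reduceEq, if_true, if_false, map_neg,
    deriv_one, deriv_mul, deriv_sq, W.d1A, W.d2A, W.d3A, W.d1B, W.d2B, W.d3B, W.d0h, W.d1h]
    at h00 h01 h02 h03 h11 h12 h13 h22
  constructor <;> refine sub_eq_zero.1 (eq_zero_of_two_mul ?_)
  · linear_combination h00
  · linear_combination A * h01 + 2 * d 0 A * d 1 α * (A * Ai + 1) * hA
  · linear_combination B * h02 + 2 * d 0 B * d 2 α * (B * Bi + 1) * hB
  · linear_combination B * h03 + 2 * d 0 B * d 3 α * (B * Bi + 1) * hB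
      + 2 * B ^ 2 * Bi ^ 2 * d 0 B * d 3 α * (h * hi + 1) * hh
  · linear_combination h12
  · linear_combination h13
  · linear_combination h11
  · linear_combination h22

/-- The metric `-dt² + A² dr² + B² (dθ² + h² dφ²)` with `γ B = A C` is conformal to
`-dτ² + dρ² + C² (dθ² + h² dφ²)`, where `dτ = γ dt / A` and `ρ = γ r`. -/
theorem confEqs_conformal_iff {g gi C : R} (hg : g * gi = 1) (hg0 : ∀ i, d i g = 0)
    (hgB : g * B = A * C) {q f a b α : R} :
    ConfEqs ![(A * gi) • d 0, gi • d 1, d 2, d 3] 1 C h (g * Ai * q) (g * f) a b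
      (α - Ai * d 0 A * q) ↔ ConfEqs d A B h q f a b α := by
  have hA := W.A_inv
  have hAi : ∀ i, d i Ai = -Ai ^ 2 * d i A := fun i => deriv_inv hA
  have hC : C = g * Ai * B := by linear_combination -Ai * hgB - C * hA
  have hC' : d 0 C = g * Ai * (d 0 B - Ai * d 0 A * B) := by
    rw [hC]; simp only [deriv_mul, hg0, hAi]; ring
  have hAg : A * Ai * (g * gi) = 1 := by rw [hA, hg, one_mul]
  -- Each defect of the rescaled system is a unit times the defect of the original one, whence the
  -- equivalence. The factor α drops by (A'/A) q, the derivative of log A along the field.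
  have tt : A * gi * d 0 (g * Ai * q) - (α - Ai * d 0 A * q) = d 0 q - α := by
    simp only [deriv_mul, hg0, hAi]
    linear_combination (d 0 q - Ai * d 0 A * q) * hAg
  have tr : gi * d 1 (g * Ai * q) - 1 ^ 2 * (A * gi * d 0 (g * f))
      = Ai * (d 1 q - A ^ 2 * d 0 f) := by
    simp only [deriv_mul, hg0, hAi, W.d1A]
    linear_combination (Ai * d 1 q - A * d 0 f) * hg + A * d 0 f * hA
  have tθ : d 2 (g * Ai * q) - C ^ 2 * (A * gi * d 0 a) = g * Ai * (d 2 q - B ^ 2 * d 0 a) := by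
    simp only [deriv_mul, hg0, hAi, W.d2A, hC]
    linear_combination -(g * Ai * B ^ 2 * d 0 a) * hAg
  have tφ : d 3 (g * Ai * q) - C ^ 2 * h ^ 2 * (A * gi * d 0 b)
      = g * Ai * (d 3 q - B ^ 2 * h ^ 2 * d 0 b) := by
    simp only [deriv_mul, hg0, hAi, W.d3A, hC]
    linear_combination -(g * Ai * B ^ 2 * h ^ 2 * d 0 b) * hAg
  have rr : A * gi * d 0 (1 : R) * (g * Ai * q) + 1 * (gi * d 1 (g * f))
      - (α - Ai * d 0 A * q) * 1 = Ai * (d 0 A * q + A * d 1 f - α * A) := by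
    simp only [deriv_mul, hg0, deriv_one]
    linear_combination d 1 f * hg - (d 1 f - α) * hA
  have rθ : 1 ^ 2 * d 2 (g * f) + C ^ 2 * (gi * d 1 a)
      = g * Ai ^ 2 * (A ^ 2 * d 2 f + B ^ 2 * d 1 a) := by
    simp only [deriv_mul, hg0, hC]
    linear_combination g * Ai ^ 2 * B ^ 2 * d 1 a * hg - g * d 2 f * (A * Ai + 1) * hA
  have rφ : 1 ^ 2 * d 3 (g * f) + C ^ 2 * h ^ 2 * (gi * d 1 b)
      = g * Ai ^ 2 * (A ^ 2 * d 3 f + B ^ 2 * h ^ 2 * d 1 b) := by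
    simp only [deriv_mul, hg0, hC]
    linear_combination g * Ai ^ 2 * B ^ 2 * h ^ 2 * d 1 b * hg - g * d 3 f * (A * Ai + 1) * hA
  have θθ : A * gi * d 0 C * (g * Ai * q) + C * d 2 a - (α - Ai * d 0 A * q) * C
      = g * Ai * (d 0 B * q + B * d 2 a - α * B) := by
    rw [hC', hC]
    linear_combination g * Ai * (d 0 B - Ai * d 0 A * B) * q * hAg
  have φφ : A * gi * d 0 C * (g * Ai * q) * h + C * (d 2 h * a + h * d 3 b)
      - (α - Ai * d 0 A * q) * C * h
      = g * Ai * (d 0 B * q * h + B * (d 2 h * a + h * d 3 b) - α * B * h) := by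
    rw [hC', hC]
    linear_combination g * Ai * (d 0 B - Ai * d 0 A * B) * q * h * hAg
  have hAi' : Ai * A = 1 := by rw [mul_comm, hA]
  have hgA : g * Ai * (A * gi) = 1 := by rw [← hAg]; ring
  have hgA2 : g * Ai ^ 2 * (A ^ 2 * gi) = 1 := by linear_combination hAg + g * gi * A * Ai * hA
  constructor
  · intro E
    constructor
    · exact sub_eq_zero.1 (tt ▸ sub_eq_zero.2 E.tt)
    · exact sub_eq_zero.1 (eq_zero_of_mul_eq hAi' (tr ▸ sub_eq_zero.2 E.tr))
    · exact sub_eq_zero.1 (eq_zero_of_mul_eq hgA (tθ ▸ sub_eq_zero.2 E.tθ))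
    · exact sub_eq_zero.1 (eq_zero_of_mul_eq hgA (tφ ▸ sub_eq_zero.2 E.tφ))
    · exact sub_eq_zero.1 (eq_zero_of_mul_eq hAi' (rr ▸ sub_eq_zero.2 E.rr))
    · exact eq_zero_of_mul_eq hgA2 (rθ ▸ E.rθ)
    · exact eq_zero_of_mul_eq hgA2 (rφ ▸ E.rφ)
    · exact sub_eq_zero.1 (eq_zero_of_mul_eq hgA (θθ ▸ sub_eq_zero.2 E.θθ))
    · exact E.θφ
    · exact sub_eq_zero.1 (eq_zero_of_mul_eq hgA (φφ ▸ sub_eq_zero.2 E.φφ))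
  · intro E
    constructor
    · exact sub_eq_zero.1 (tt.trans (sub_eq_zero.2 E.tt))
    · exact sub_eq_zero.1 (tr.trans (by rw [E.tr, sub_self, mul_zero]))
    · exact sub_eq_zero.1 (tθ.trans (by rw [E.tθ, sub_self, mul_zero]))
    · exact sub_eq_zero.1 (tφ.trans (by rw [E.tφ, sub_self, mul_zero]))
    · exact sub_eq_zero.1 (rr.trans (by rw [E.rr, sub_self, mul_zero]))
    · exact rθ.trans (by rw [E.rθ, mul_zero])
    · exact rφ.trans (by rw [E.rφ, mul_zero])
    · exact sub_eq_zero.1 (θθ.trans (by rw [E.θθ, sub_self, mul_zero]))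
    · exact E.θφ
    · exact sub_eq_zero.1 (φφ.trans (by rw [E.φφ, sub_self, mul_zero]))

end WarpedFrame

end Components

/-! ### The concrete metric functions on the chart -/

section Charts

variable {S : SpacetimeType} {I : TopologicalSpace.Opens ℝ}

theorem SpacetimeType.convex_thetaRange (S : SpacetimeType) : Convex ℝ S.thetaRange := by
  cases S
  · exact convex_Ioo _ _
  · exact convex_Ioi _

theorem convex_chart (hI : (I : Set ℝ).OrdConnected) :
    Convex ℝ (chart S I : Set (Fin 4 → ℝ)) := by
  have h := fun (j : Fin 4) (V : Set ℝ) (hV : Convex ℝ V) =>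
    hV.linear_preimage (LinearMap.proj (R := ℝ) (φ := fun _ : Fin 4 => ℝ) j)
  exact (h 0 _ hI.convex).inter ((h 2 _ S.convex_thetaRange).inter (h 3 _ (convex_Ioo _ _)))

theorem update_mem_chart (x y : chart S I) (i : Fin 4) :
    Function.update (x : Fin 4 → ℝ) i ((y : Fin 4 → ℝ) i) ∈ chart S I := by
  obtain ⟨x, hx0, hx2, hx3⟩ := x
  obtain ⟨y, hy0, hy2, hy3⟩ := y
  refine ⟨?_, ?_, ?_⟩ <;> fin_cases i <;> simp_all

theorem exists_mem_chart {t : ℝ} (ht : t ∈ I) : ∃ x : chart S I, (x : Fin 4 → ℝ) 0 = t := by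
  obtain ⟨θ, hθ⟩ : S.thetaRange.Nonempty := by
    cases S
    · exact ⟨1, by norm_num, by linarith [Real.pi_gt_three]⟩
    · exact ⟨1, by norm_num [SpacetimeType.thetaRange]⟩
  exact ⟨⟨![t, 0, θ, 1], ht, hθ, show (0 : ℝ) < 1 by norm_num,
    show (1 : ℝ) < 2 * Real.pi by linarith [Real.pi_gt_three]⟩, rfl⟩

theorem contDiffOn_coord {n : ℕ} {U : TopologicalSpace.Opens (Fin n → ℝ)} {φ : ℝ → ℝ} {V : Set ℝ}
    (hφ : ContDiffOn ℝ ∞ φ V) (j : Fin n) (hV : ∀ x ∈ U, x j ∈ V) :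
    ContDiffOn ℝ ∞ (fun x : Fin n → ℝ => φ (x j)) U :=
  hφ.comp (contDiff_apply ℝ ℝ j).contDiffOn hV

theorem partialD_of_apply_coord {n : ℕ} {U : TopologicalSpace.Opens (Fin n → ℝ)} {f : smoothAlg U}
    {φ φ' : ℝ → ℝ} {j : Fin n} (hf : ∀ x : U, (f : U → ℝ) x = φ ((x : Fin n → ℝ) j))
    (h : ∀ x ∈ U, HasDerivAt φ (φ' (x j)) (x j)) (i : Fin n) (x : U) :
    (partialD i f : U → ℝ) x = if i = j then φ' ((x : Fin n → ℝ) j) else 0 := by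
  rw [partialD_apply f (fun x => φ (x j)) hf, pd_comp_apply (h x x.2)]

theorem partialD_ne_of_apply_coord {n : ℕ} {U : TopologicalSpace.Opens (Fin n → ℝ)}
    {f : smoothAlg U} {φ φ' : ℝ → ℝ} {j : Fin n}
    (hf : ∀ x : U, (f : U → ℝ) x = φ ((x : Fin n → ℝ) j))
    (h : ∀ x ∈ U, HasDerivAt φ (φ' (x j)) (x j)) {i : Fin n} (hij : i ≠ j) : partialD i f = 0 :=
  smoothAlg_ext fun x => by rw [partialD_of_apply_coord hf h, if_neg hij]; rfl

/-- The derivative of `S.h`. -/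
def SpacetimeType.h' : SpacetimeType → ℝ → ℝ
  | .kantowskiSachs => Real.cos
  | .bianchiIII => Real.cosh

/-- The sign in `h'' = ε h`. -/
def SpacetimeType.sign : SpacetimeType → ℝ
  | .kantowskiSachs => -1
  | .bianchiIII => 1

theorem SpacetimeType.hasDerivAt_h (S : SpacetimeType) (x : ℝ) : HasDerivAt S.h (S.h' x) x := by
  cases S
  · exact Real.hasDerivAt_sin x
  · exact Real.hasDerivAt_sinh x

theorem SpacetimeType.hasDerivAt_h' (S : SpacetimeType) (x : ℝ) :
    HasDerivAt S.h' (S.sign * S.h x) x := by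
  cases S
  · simpa [h', h, sign] using Real.hasDerivAt_cos x
  · simpa [h', h, sign] using Real.hasDerivAt_cosh x

theorem SpacetimeType.h'_sq (S : SpacetimeType) (x : ℝ) :
    S.h' x ^ 2 - S.sign * S.h x ^ 2 = 1 := by
  cases S
  · simp [h', h, sign]
  · simp [h', h, sign, Real.cosh_sq]

theorem SpacetimeType.contDiff_h (S : SpacetimeType) : ContDiff ℝ ∞ S.h := by
  cases S
  · exact Real.contDiff_sin
  · exact Real.contDiff_sinh

theorem SpacetimeType.h_ne_zero (S : SpacetimeType) {x : ℝ} (hx : x ∈ S.thetaRange) :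
    S.h x ≠ 0 := by
  cases S
  · exact (Real.sin_pos_of_mem_Ioo hx).ne'
  · exact (Real.sinh_pos_iff.2 hx).ne'

/-- The functions on a chart that express the metric, as elements of the algebra of smooth
functions. -/
structure MetricFunctions (S : SpacetimeType) (I : TopologicalSpace.Opens ℝ) (A T : ℝ → ℝ)
    (γ : ℝ) (A₀ Ai B Bi h hi Sh Ch Chi g gi : smoothAlg (chart S I)) : Prop where
  frame : WarpedFrame partialD A₀ Ai B Bi h hi (algebraMap ℝ _ S.sign)
  A_apply : ∀ x : chart S I, (A₀ : chart S I → ℝ) x = A ((x : Fin 4 → ℝ) 0)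
  B_apply : ∀ x : chart S I, (B : chart S I → ℝ) x =
    A ((x : Fin 4 → ℝ) 0) / γ * Real.cosh (γ * T ((x : Fin 4 → ℝ) 0))
  h_apply : ∀ x : chart S I, (h : chart S I → ℝ) x = S.h ((x : Fin 4 → ℝ) 2)
  h'_apply : ∀ x : chart S I, (partialD 2 h : chart S I → ℝ) x = S.h' ((x : Fin 4 → ℝ) 2)
  Sh_apply : ∀ x : chart S I, (Sh : chart S I → ℝ) x = Real.sinh (γ * T ((x : Fin 4 → ℝ) 0))
  Ch_apply : ∀ x : chart S I, (Ch : chart S I → ℝ) x = Real.cosh (γ * T ((x : Fin 4 → ℝ) 0))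
  Ch_inv : Ch * Chi = 1
  g_eq : g = algebraMap ℝ _ γ
  g_inv : g * gi = 1
  dg : ∀ i, partialD i g = 0
  gB : g * B = A₀ * Ch
  dSh : A₀ * partialD 0 Sh = g * Ch
  dCh : A₀ * partialD 0 Ch = g * Sh
  diSh : ∀ i, i ≠ 0 → partialD i Sh = 0
  diCh : ∀ i, i ≠ 0 → partialD i Ch = 0
  Ch_sq : Ch ^ 2 - Sh ^ 2 = 1

theorem exists_metricFunctions {A T : ℝ → ℝ} {γ : ℝ} (hγ : γ ≠ 0)
    (hA : ContDiffOn ℝ ∞ A I) (hA0 : ∀ t ∈ I, A t ≠ 0)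
    (hT : ∀ t ∈ I, HasDerivAt T (1 / A t) t) :
    ∃ A₀ Ai B Bi h hi Sh Ch Chi g gi, MetricFunctions S I A T γ A₀ Ai B Bi h hi Sh Ch Chi g gi := by
  -- T is only assumed to be an antiderivative; it is smooth because 1/A is.
  have hTs : ContDiffOn ℝ ∞ T I := by
    rw [contDiffOn_infty_iff_deriv_of_isOpen I.isOpen]
    refine ⟨fun t ht => (hT t ht).differentiableAt.differentiableWithinAt, ?_⟩
    exact (contDiffOn_const.div hA hA0).congr fun t ht => (hT t ht).deriv
  have hS : ContDiffOn ℝ ∞ (fun t => Real.sinh (γ * T t)) I :=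
    Real.contDiff_sinh.comp_contDiffOn (contDiffOn_const.mul hTs)
  have hC : ContDiffOn ℝ ∞ (fun t => Real.cosh (γ * T t)) I :=
    Real.contDiff_cosh.comp_contDiffOn (contDiffOn_const.mul hTs)
  have hB : ContDiffOn ℝ ∞ (fun t => A t / γ * Real.cosh (γ * T t)) I := (hA.div_const γ).mul hC
  have hC0 : ∀ t ∈ I, Real.cosh (γ * T t) ≠ 0 := fun t _ => (Real.cosh_pos _).ne'
  have hB0 : ∀ t ∈ I, A t / γ * Real.cosh (γ * T t) ≠ 0 := fun t ht =>
    mul_ne_zero (div_ne_zero (hA0 t ht) hγ) (hC0 t ht)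
  have h0 : ∀ x ∈ chart S I, x 0 ∈ I := fun x hx => hx.1
  have h2 : ∀ x ∈ chart S I, x 2 ∈ S.thetaRange := fun x hx => hx.2.1
  have dA : ∀ {φ : ℝ → ℝ}, ContDiffOn ℝ ∞ φ I → ∀ x ∈ chart S I,
      HasDerivAt φ (deriv φ (x 0)) (x 0) := fun hφ x hx =>
    ((hφ.contDiffAt (I.isOpen.mem_nhds hx.1)).differentiableAt (by simp)).hasDerivAt
  have dS : ∀ x ∈ chart S I, HasDerivAt (fun t => Real.sinh (γ * T t))
      (Real.cosh (γ * T (x 0)) * (γ * (1 / A (x 0)))) (x 0) := fun x hx =>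
    ((hT _ hx.1).const_mul γ).sinh
  have dC : ∀ x ∈ chart S I, HasDerivAt (fun t => Real.cosh (γ * T t))
      (Real.sinh (γ * T (x 0)) * (γ * (1 / A (x 0)))) (x 0) := fun x hx =>
    ((hT _ hx.1).const_mul γ).cosh
  have dh : ∀ x ∈ chart S I, HasDerivAt S.h (S.h' (x 2)) (x 2) := fun x _ => S.hasDerivAt_h _
  have dh' : ∀ x ∈ chart S I, HasDerivAt S.h' (S.sign * S.h (x 2)) (x 2) :=
    fun x _ => S.hasDerivAt_h' _
  have e2 : ∀ x : chart S I, (partialD 2 (ofFun _ (contDiffOn_coord S.contDiff_h.contDiffOn 2 h2)) :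
      chart S I → ℝ) x = S.h' ((x : Fin 4 → ℝ) 2) := fun x =>
    partialD_of_apply_coord (φ' := S.h') (fun _ => rfl) dh 2 x
  refine ⟨ofFun _ (contDiffOn_coord hA 0 h0), ofFun _ (contDiffOn_coord (hA.inv hA0) 0 h0),
    ofFun _ (contDiffOn_coord hB 0 h0), ofFun _ (contDiffOn_coord (hB.inv hB0) 0 h0),
    ofFun _ (contDiffOn_coord S.contDiff_h.contDiffOn 2 h2),
    ofFun _ (contDiffOn_coord (S.contDiff_h.contDiffOn.inv fun _ hx => S.h_ne_zero hx) 2 h2),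
    ofFun _ (contDiffOn_coord hS 0 h0), ofFun _ (contDiffOn_coord hC 0 h0),
    ofFun _ (contDiffOn_coord (hC.inv hC0) 0 h0), algebraMap ℝ _ γ, algebraMap ℝ _ γ⁻¹,
    { frame :=
        { comm := partialD_comm
          A_inv := smoothAlg_ext fun x => mul_inv_cancel₀ (hA0 _ x.2.1)
          B_inv := smoothAlg_ext fun x => mul_inv_cancel₀ (hB0 _ x.2.1)
          h_inv := smoothAlg_ext fun x => mul_inv_cancel₀ (S.h_ne_zero x.2.2.1)
          d1A := partialD_ne_of_apply_coord (fun _ => rfl) (dA hA) (by decide)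
          d2A := partialD_ne_of_apply_coord (fun _ => rfl) (dA hA) (by decide)
          d3A := partialD_ne_of_apply_coord (fun _ => rfl) (dA hA) (by decide)
          d1B := partialD_ne_of_apply_coord (fun _ => rfl) (dA hB) (by decide)
          d2B := partialD_ne_of_apply_coord (fun _ => rfl) (dA hB) (by decide)
          d3B := partialD_ne_of_apply_coord (fun _ => rfl) (dA hB) (by decide)
          d0h := partialD_ne_of_apply_coord (fun _ => rfl) dh (by decide)
          d1h := partialD_ne_of_apply_coord (fun _ => rfl) dh (by decide)
          d3h := partialD_ne_of_apply_coord (fun _ => rfl) dh (by decide)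
          d2d2h := smoothAlg_ext fun x =>
            partialD_of_apply_coord (φ' := fun y => S.sign * S.h y) e2 dh' 2 x
          pyth := smoothAlg_ext fun x => by
            have := S.h'_sq ((x : Fin 4 → ℝ) 2)
            rw [← e2] at this
            exact this }
      A_apply := fun _ => rfl
      B_apply := fun _ => rfl
      h_apply := fun _ => rfl
      h'_apply := e2
      Sh_apply := fun _ => rfl
      Ch_apply := fun _ => rfl
      Ch_inv := smoothAlg_ext fun x => mul_inv_cancel₀ (hC0 _ x.2.1)
      g_eq := rfl
      g_inv := by rw [← map_mul, mul_inv_cancel₀ hγ, map_one]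
      dg := fun i => (partialD i).map_algebraMap γ
      gB := smoothAlg_ext fun x => by
        change γ * (A _ / γ * Real.cosh _) = A _ * Real.cosh _
        field_simp
      dSh := smoothAlg_ext fun x => by
        have := partialD_of_apply_coord (φ' := fun t => Real.cosh (γ * T t) * (γ * (1 / A t)))
          (f := ofFun _ (contDiffOn_coord (U := chart S I) hS 0 h0)) (fun _ => rfl) dS 0 x
        rw [if_pos rfl] at this
        refine (congrArg (A ((x : Fin 4 → ℝ) 0) * ·) this).trans ?_
        change A _ * (Real.cosh _ * _) = γ * Real.cosh _
        have := hA0 _ x.2.1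
        field_simp
      dCh := smoothAlg_ext fun x => by
        have := partialD_of_apply_coord (φ' := fun t => Real.sinh (γ * T t) * (γ * (1 / A t)))
          (f := ofFun _ (contDiffOn_coord (U := chart S I) hC 0 h0)) (fun _ => rfl) dC 0 x
        rw [if_pos rfl] at this
        refine (congrArg (A ((x : Fin 4 → ℝ) 0) * ·) this).trans ?_
        change A _ * (Real.sinh _ * _) = γ * Real.sinh _
        have := hA0 _ x.2.1
        field_simp
      diSh := fun i hi => partialD_ne_of_apply_coord
        (φ' := fun t => Real.cosh (γ * T t) * (γ * (1 / A t))) (fun _ => rfl) dS hi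
      diCh := fun i hi => partialD_ne_of_apply_coord
        (φ' := fun t => Real.sinh (γ * T t) * (γ * (1 / A t))) (fun _ => rfl) dC hi
      Ch_sq := smoothAlg_ext fun x => by
        change Real.cosh _ ^ 2 - Real.sinh _ ^ 2 = 1
        exact Real.cosh_sq_sub_sinh_sq _ }⟩

end Charts

/-! ### The non-exceptional conditions and the vanishing of α, β and q -/

section Main

variable {S : SpacetimeType} {I : TopologicalSpace.Opens ℝ} {A T : ℝ → ℝ} {γ : ℝ}
  {A₀ Ai B Bi h hi Sh Ch Chi g gi : smoothAlg (chart S I)}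

theorem contDiffOn_of_apply {n : ℕ} {U : TopologicalSpace.Opens (Fin n → ℝ)}
    {f : (Fin n → ℝ) → ℝ} {F : smoothAlg U} (h : ∀ x : U, f x = (F : U → ℝ) x) :
    ContDiffOn ℝ ∞ f U :=
  (contDiffOn_rep F).congr fun x hx => by rw [h ⟨x, hx⟩, ← rep_apply]

/-- Differentiability of φ is read off from the smooth function `f` along the coordinate line
through x, so nothing need be known about φ beforehand. -/
theorem hasDerivAt_of_apply_coord {n : ℕ} {U : TopologicalSpace.Opens (Fin n → ℝ)}
    {f : smoothAlg U} {φ : ℝ → ℝ} {j : Fin n}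
    (hf : ∀ x : U, (f : U → ℝ) x = φ ((x : Fin n → ℝ) j)) (x : U) :
    HasDerivAt φ ((partialD j f : U → ℝ) x) ((x : Fin n → ℝ) j) := by
  have hx : Function.update (x : Fin n → ℝ) j ((x : Fin n → ℝ) j) = x := Function.update_eq_self j _
  have h1 := hasDerivAt_comp_update (F := rep f) (x : Fin n → ℝ) j ((x : Fin n → ℝ) j)
    (by rw [hx]; exact differentiableAt_of_mem (contDiffOn_rep f) x.2)
  rw [hx, ← partialD_apply f (rep f) (fun y => (rep_apply f y).symm)] at h1
  refine h1.congr_of_eventuallyEq ?_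
  have hopen : IsOpen {s : ℝ | Function.update (x : Fin n → ℝ) j s ∈ U} :=
    U.isOpen.preimage (continuous_const.update j continuous_id)
  filter_upwards [hopen.mem_nhds (show _ ∈ U by rw [hx]; exact x.2)] with s hs
  rw [rep_apply f ⟨_, hs⟩, hf]
  simp

theorem partialD_zero_apply {x : smoothAlg (chart S I)} {φ : ℝ → ℝ}
    (hx : ∀ y : chart S I, (x : chart S I → ℝ) y = φ ((y : Fin 4 → ℝ) 0)) (y : chart S I) :
    (partialD 0 x : chart S I → ℝ) y = deriv φ ((y : Fin 4 → ℝ) 0) :=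
  (hasDerivAt_of_apply_coord hx y).deriv.symm

theorem cancels_deriv (hI : (I : Set ℝ).OrdConnected) {x : smoothAlg (chart S I)} {φ : ℝ → ℝ}
    (hx : ∀ y : chart S I, (x : chart S I → ℝ) y = φ ((y : Fin 4 → ℝ) 0))
    (hi : ∀ i, i ≠ 0 → partialD i x = 0) (hc : ¬ ∃ c, ∀ t ∈ I, φ t = c) :
    Cancels (partialD (U := chart S I) 0) (partialD 0 x) := by
  refine Cancels.of_apply_coord (convex_chart hI) update_mem_chart (partialD_zero_apply hx)
    fun h0 => hc ?_
  obtain ⟨c, hc⟩ := eq_const_of_partialD_eq_zero (convex_chart hI) (f := x) fun i => by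
    by_cases h : i = 0
    · rw [h, h0]
    · exact hi i h
  refine ⟨c, fun t ht => ?_⟩
  obtain ⟨y, rfl⟩ := exists_mem_chart (S := S) ht
  rw [← hx, hc]
  rfl

namespace MetricFunctions

variable (M : MetricFunctions S I A T γ A₀ Ai B Bi h hi Sh Ch Chi g gi)
include M

theorem metric_eq (x : chart S I) : metric S A T γ x = Matrix.diagonal fun i =>
    (((![-1, A₀ ^ 2, B ^ 2, B ^ 2 * h ^ 2] : Fin 4 → smoothAlg (chart S I)) i :
      smoothAlg (chart S I)) : chart S I → ℝ) x := by
  rw [metric]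
  congr 1
  funext i
  fin_cases i
  · rfl
  · change _ = ((A₀ : chart S I → ℝ) x) ^ 2
    rw [M.A_apply]; rfl
  · change _ = ((B : chart S I → ℝ) x) ^ 2
    rw [M.B_apply]
    simp only [Fin.reduceFinMk, Matrix.cons_val]
    ring
  · change _ = ((B : chart S I → ℝ) x) ^ 2 * ((h : chart S I → ℝ) x) ^ 2
    rw [M.B_apply, M.h_apply]
    simp only [Fin.reduceFinMk, Matrix.cons_val]
    ring

theorem isConformalKillingWith_iff {X : (Fin 4 → ℝ) → Fin 4 → ℝ} {α : (Fin 4 → ℝ) → ℝ}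
    {Y : Fin 4 → smoothAlg (chart S I)} {α₀ : smoothAlg (chart S I)}
    (hX : ∀ (x : chart S I) c, X x c = (Y c : chart S I → ℝ) x)
    (hα : ∀ x : chart S I, α x = (α₀ : chart S I → ℝ) x) :
    IsConformalKillingWith (chart S I) (metric S A T γ) X α ↔
      ConfEqs partialD A₀ B h (Y 0) (Y 1) (Y 2) (Y 3) α₀ := by
  have sX : ContDiffOn ℝ ∞ X (chart S I) :=
    contDiffOn_pi.2 fun c => contDiffOn_of_apply fun x => hX x c
  have hY : component X sX = Y := funext fun c => smoothAlg_ext fun x => hX x c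
  rw [← M.frame.confEqs_iff, IsConformalKillingWith]
  simp only [sX, contDiffOn_of_apply hα, true_and]
  have key : ∀ (x : chart S I) (a b : Fin 4), 2 * α x * metric S A T γ x a b =
      ((2 * α₀ * if a = b then (![-1, A₀ ^ 2, B ^ 2, B ^ 2 * h ^ 2] : Fin 4 → _) a else 0 :
        smoothAlg (chart S I)) : chart S I → ℝ) x := by
    intro x a b
    rw [M.metric_eq, hα, Matrix.diagonal_apply]
    split_ifs <;> rfl
  constructor
  · intro H a b
    refine smoothAlg_ext fun x => ?_
    rw [← key, ← H x x.2, lieDerivMetric_diagonal M.metric_eq sX, hY]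
  · intro H x hx a b
    rw [key ⟨x, hx⟩, ← H, ← hY]
    exact lieDerivMetric_diagonal M.metric_eq sX a b ⟨x, hx⟩

/-- No regularity of β is assumed, but the tt component of the Hessian equation gives β = -α_tt, so
β is smooth on the chart and belongs to the ring. -/
theorem hessEqs_of_isConcircularWith {X : (Fin 4 → ℝ) → Fin 4 → ℝ} {α β : (Fin 4 → ℝ) → ℝ}
    (H : IsConcircularWith (chart S I) (metric S A T γ) X α β) :
    ∃ β₀ : smoothAlg (chart S I), (∀ x : chart S I, β x = (β₀ : chart S I → ℝ) x) ∧
      HessEqs partialD A₀ B (ofFun α H.1.2.1) β₀ := by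
  have hG : ∀ i, (![-1, A₀ ^ 2, B ^ 2, B ^ 2 * h ^ 2] : Fin 4 → smoothAlg (chart S I)) i *
      (![-1, Ai ^ 2, Bi ^ 2, Bi ^ 2 * hi ^ 2] : Fin 4 → smoothAlg (chart S I)) i = 1 := by
    have hA := M.frame.A_inv
    have hB := M.frame.B_inv
    have hh := M.frame.h_inv
    intro i
    fin_cases i
    · change (-1 : smoothAlg (chart S I)) * -1 = 1
      ring
    · simp [← mul_pow, hA]
    · simp [← mul_pow, hB]
    · simp [← mul_pow, mul_mul_mul_comm, hB, hh]
  have h1 := fun (x : chart S I) a b =>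
    (hessian_diagonal M.metric_eq hG H.1.2.1 a b x).symm.trans (H.2 x x.2 a b)
  obtain ⟨β₀, hβ⟩ : ∃ β₀ : smoothAlg (chart S I), ∀ x : chart S I,
      β x = (β₀ : chart S I → ℝ) x := by
    refine ⟨-partialD 0 (partialD 0 (ofFun α H.1.2.1)), fun x => ?_⟩
    have := h1 x 0 0
    simp only [Matrix.cons_val, map_neg, deriv_one, neg_zero, mul_zero, zero_mul, if_true,
      Finset.sum_const_zero, add_zero, sub_zero] at this
    have hm : metric S A T γ x 0 0 = -1 := rfl
    rw [hm] at this
    change β x = -(partialD 0 (partialD 0 (ofFun α H.1.2.1)) : chart S I → ℝ) x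
    rw [this]
    ring
  refine ⟨β₀, hβ, M.frame.hessEqs_of_components fun a b => smoothAlg_ext fun x => ?_⟩
  have key : β x * metric S A T γ x a b =
      ((β₀ * if a = b then (![-1, A₀ ^ 2, B ^ 2, B ^ 2 * h ^ 2] : Fin 4 → _) a else 0 :
        smoothAlg (chart S I)) : chart S I → ℝ) x := by
    rw [M.metric_eq, hβ, Matrix.diagonal_apply]
    split_ifs <;> rfl
  exact (h1 x a b).trans key

theorem cancels_deriv_A (hI : (I : Set ℝ).OrdConnected) (h : ¬ ∃ c, ∀ t ∈ I, A t = c) :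
    Cancels (partialD (U := chart S I) 0) (partialD 0 A₀) := by
  refine cancels_deriv hI M.A_apply (fun i hi => ?_) h
  fin_cases i
  exacts [(hi rfl).elim, M.frame.d1A, M.frame.d2A, M.frame.d3A]

theorem cancels_deriv_B (hI : (I : Set ℝ).OrdConnected)
    (h : ¬ ∃ c, ∀ t ∈ I, A t / γ * Real.cosh (γ * T t) = c) :
    Cancels (partialD (U := chart S I) 0) (partialD 0 B) := by
  refine cancels_deriv hI M.B_apply (fun i hi => ?_) h
  fin_cases i
  exacts [(hi rfl).elim, M.frame.d1B, M.frame.d2B, M.frame.d3B]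

/-- From γB = A C one gets A B' - A' B = A S. Its derivative A' S + γ C is the expression in
condition (iii). -/
theorem wronskian_eq : A₀ * partialD 0 (partialD 0 B) - partialD 0 (partialD 0 A₀) * B
      = partialD 0 (A₀ * Sh) := by
  have hB' : g * partialD 0 B = partialD 0 A₀ * Ch + g * Sh := by
    have := congrArg (partialD 0) M.gB
    rw [deriv_mul, deriv_mul, M.dg, M.dCh] at this
    linear_combination this
  have hD' : A₀ * partialD 0 B - partialD 0 A₀ * B = A₀ * Sh := by
    refine sub_eq_zero.1 (eq_zero_of_mul_eq M.g_inv ?_)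
    linear_combination A₀ * hB' - partialD 0 A₀ * M.gB
  rw [← hD', map_sub, deriv_mul, deriv_mul]
  ring

theorem cancels_wronskian (hI : (I : Set ℝ).OrdConnected)
    (h : ¬ ∀ t ∈ I, deriv A t * Real.sinh (γ * T t) + γ * Real.cosh (γ * T t) = 0) :
    Cancels (partialD (U := chart S I) 0)
      (A₀ * partialD 0 (partialD 0 B) - partialD 0 (partialD 0 A₀) * B) := by
  rw [M.wronskian_eq]
  have hAS : ∀ y : chart S I, ((A₀ * Sh : smoothAlg (chart S I)) : chart S I → ℝ) y =
      A ((y : Fin 4 → ℝ) 0) * Real.sinh (γ * T ((y : Fin 4 → ℝ) 0)) := fun y => by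
    rw [← M.A_apply, ← M.Sh_apply]; rfl
  refine Cancels.of_apply_coord (convex_chart hI) update_mem_chart
    (partialD_zero_apply (φ := fun t => A t * Real.sinh (γ * T t)) hAS) fun h0 => h ?_
  intro t ht
  obtain ⟨y, rfl⟩ := exists_mem_chart (S := S) ht
  have h4 : A₀ * partialD 0 Sh + partialD 0 A₀ * Sh = 0 :=
    (deriv_mul (partialD 0) A₀ Sh).symm.trans h0
  rw [M.dSh, M.g_eq] at h4
  have h5 : γ * (Ch : chart S I → ℝ) y + (partialD 0 A₀ : chart S I → ℝ) y *
    (Sh : chart S I → ℝ) y = 0 := congrFun (congrArg Subtype.val h4) y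
  rw [M.Ch_apply, M.Sh_apply, partialD_zero_apply M.A_apply] at h5
  linarith

/-- If sinh Ψ vanished identically, so would A S' = γ C, but cosh is positive. -/
theorem cancels_Sh (hI : (I : Set ℝ).OrdConnected) (hI' : (I : Set ℝ).Nonempty) :
    Cancels (partialD (U := chart S I) 0) Sh := by
  refine Cancels.of_apply_coord (φ := fun t => Real.sinh (γ * T t)) (convex_chart hI)
    update_mem_chart M.Sh_apply fun h0 => ?_
  obtain ⟨t, ht⟩ := hI'
  obtain ⟨y, rfl⟩ := exists_mem_chart (S := S) ht
  have h4 := M.dSh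
  rw [h0, map_zero, mul_zero] at h4
  have h5 : Ch = 0 := eq_zero_of_mul_eq M.g_inv h4.symm
  have h6 := M.Ch_apply y
  rw [h5] at h6
  exact (Real.cosh_pos _).ne h6

/-- In the cases that are not exceptional, concircular fields are Killing and tangent to the
hypersurfaces of constant `t`. -/
theorem concircular_eq_zero (hI : (I : Set ℝ).OrdConnected) (hI' : (I : Set ℝ).Nonempty)
    (h1 : S = .kantowskiSachs → ¬ ∃ c, ∀ t ∈ I, A t = c)
    (h2 : ¬ ∃ c, ∀ t ∈ I, A t / γ * Real.cosh (γ * T t) = c)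
    (h3 : ¬ ∀ t ∈ I, deriv A t * Real.sinh (γ * T t) + γ * Real.cosh (γ * T t) = 0)
    {q f a b α β : smoothAlg (chart S I)} (E : ConfEqs partialD A₀ B h q f a b α)
    (H : HessEqs partialD A₀ B α β) :
    α = 0 ∧ β = 0 ∧ q = 0 ∧ partialD 2 f = 0 ∧ partialD 3 f = 0 := by
  obtain ⟨hα, hβ, q1, f2, f3⟩ :=
    M.frame.conformalFactor_const E H (M.cancels_wronskian hI h3) (M.cancels_deriv_B hI h2)
  suffices q = 0 ∧ α = 0 from ⟨this.2, hβ, this.1, f2, f3⟩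
  by_cases hA : ∃ c, ∀ t ∈ I, A t = c
  · have hS : algebraMap ℝ (smoothAlg (chart S I)) S.sign = 1 := by
      cases S
      · exact (h1 rfl hA).elim
      · exact map_one _
    refine M.frame.orbit_component_eq_zero_of_hyperbolic hS E hα ?_ M.g_inv (M.dg 0) M.gB M.dSh
      M.dCh M.Ch_sq M.Ch_inv
    obtain ⟨c, hc⟩ := hA
    have : A₀ = algebraMap ℝ _ c := smoothAlg_ext fun y => by
      rw [M.A_apply, hc _ y.2.1]; rfl
    rw [this]
    exact (partialD 0).map_algebraMap c
  · exact M.frame.orbit_component_eq_zero E hα q1 f2 (M.cancels_deriv_A hI hA)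
      (M.cancels_Sh hI hI') M.g_inv (M.dg 0) M.gB M.dSh M.dCh M.Ch_sq M.Ch_inv

end MetricFunctions

end Main

/-! ### The four basic Killing fields -/

section Fields

variable {S : SpacetimeType} {I : TopologicalSpace.Opens ℝ} {A T : ℝ → ℝ} {γ : ℝ}
  {A₀ Ai B Bi h hi Sh Ch Chi g gi : smoothAlg (chart S I)}

theorem SpacetimeType.deriv_h (S : SpacetimeType) : deriv S.h = S.h' :=
  funext fun x => (S.hasDerivAt_h x).deriv

/-- The cosine of the last coordinate. -/
def cosφ (S : SpacetimeType) (I : TopologicalSpace.Opens ℝ) : smoothAlg (chart S I) :=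
  ofFun (fun x => Real.cos (x 3))
    (contDiffOn_coord Real.contDiff_cos.contDiffOn 3 fun _ _ => mem_univ _)

/-- The sine of the last coordinate. -/
def sinφ (S : SpacetimeType) (I : TopologicalSpace.Opens ℝ) : smoothAlg (chart S I) :=
  ofFun (fun x => Real.sin (x 3))
    (contDiffOn_coord Real.contDiff_sin.contDiffOn 3 fun _ _ => mem_univ _)

theorem partialD_cosφ (i : Fin 4) : partialD i (cosφ S I) = if i = 3 then -sinφ S I else 0 := by
  refine smoothAlg_ext fun x => ?_
  rw [partialD_of_apply_coord (φ := Real.cos) (φ' := fun y => -Real.sin y) (j := 3) (fun _ => rfl)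
    (fun y _ => Real.hasDerivAt_cos _)]
  split_ifs <;> rfl

theorem partialD_sinφ (i : Fin 4) : partialD i (sinφ S I) = if i = 3 then cosφ S I else 0 := by
  refine smoothAlg_ext fun x => ?_
  rw [partialD_of_apply_coord (φ := Real.sin) (φ' := Real.cos) (j := 3) (fun _ => rfl)
    (fun y _ => Real.hasDerivAt_sin _)]
  split_ifs <;> rfl

theorem cosφ_sq_add_sinφ_sq : cosφ S I ^ 2 + sinφ S I ^ 2 = 1 :=
  smoothAlg_ext fun _ => Real.cos_sq_add_sin_sq _

/-- Solutions of the equation of harmonic oscillation in the last coordinate. -/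
theorem exists_eq_cosφ_add_sinφ (hI : (I : Set ℝ).OrdConnected) {a : smoothAlg (chart S I)}
    (a0 : partialD 0 a = 0) (a1 : partialD 1 a = 0) (a2 : partialD 2 a = 0)
    (a3 : partialD 3 (partialD 3 a) = -a) :
    ∃ y z : ℝ, a = cosφ S I * algebraMap ℝ _ y + sinφ S I * algebraMap ℝ _ z := by
  have hconv := convex_chart (S := S) hI
  have e0 : partialD 0 (partialD 3 a) = 0 := by rw [partialD_comm, a0, map_zero]
  have e1 : partialD 1 (partialD 3 a) = 0 := by rw [partialD_comm, a1, map_zero]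
  have e2 : partialD 2 (partialD 3 a) = 0 := by rw [partialD_comm, a2, map_zero]
  have hc : ∀ i : Fin 4, i ≠ 3 → partialD i (cosφ S I) = 0 := fun i hi => by
    rw [partialD_cosφ, if_neg hi]
  have hs : ∀ i : Fin 4, i ≠ 3 → partialD i (sinφ S I) = 0 := fun i hi => by
    rw [partialD_sinφ, if_neg hi]
  have hc3 : partialD 3 (cosφ S I) = -sinφ S I := by rw [partialD_cosφ, if_pos rfl]
  have hs3 : partialD 3 (sinφ S I) = cosφ S I := by rw [partialD_sinφ, if_pos rfl]
  have key : ∀ i : Fin 4, i ≠ 3 → partialD i a = 0 ∧ partialD i (partialD 3 a) = 0 := by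
    intro i hi
    fin_cases i
    exacts [⟨a0, e0⟩, ⟨a1, e1⟩, ⟨a2, e2⟩, (hi rfl).elim]
  -- Variation of constants: rotating (a, a_φ) by the angle φ gives two constants.
  obtain ⟨y, hy⟩ := eq_const_of_partialD_eq_zero hconv
    (f := cosφ S I * a - sinφ S I * partialD 3 a) fun i => by
      rw [map_sub, deriv_mul, deriv_mul]
      by_cases hi : i = 3
      · subst hi
        rw [hc3, hs3, a3]; ring
      · rw [hc i hi, hs i hi, (key i hi).1, (key i hi).2]; ring
  obtain ⟨z, hz⟩ := eq_const_of_partialD_eq_zero hconv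
    (f := sinφ S I * a + cosφ S I * partialD 3 a) fun i => by
      rw [map_add, deriv_mul, deriv_mul]
      by_cases hi : i = 3
      · subst hi
        rw [hc3, hs3, a3]; ring
      · rw [hc i hi, hs i hi, (key i hi).1, (key i hi).2]; ring
  refine ⟨y, z, ?_⟩
  rw [← hy, ← hz]
  linear_combination -a * cosφ_sq_add_sinφ_sq (S := S) (I := I)

theorem mem_span_basicField {X : chart S I → Fin 4 → ℝ} {k y z e : ℝ}
    (hX : ∀ x : chart S I, X x = ![0, k,
      y * Real.cos ((x : Fin 4 → ℝ) 3) + z * Real.sin ((x : Fin 4 → ℝ) 3),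
      S.h' ((x : Fin 4 → ℝ) 2) / S.h ((x : Fin 4 → ℝ) 2) *
        (-y * Real.sin ((x : Fin 4 → ℝ) 3) + z * Real.cos ((x : Fin 4 → ℝ) 3)) + e]) :
    X ∈ Submodule.span ℝ (Set.range fun i => restrict (chart S I) (basicField S i)) := by
  have key : X = k • restrict (chart S I) (basicField S 0) +
      y • restrict (chart S I) (basicField S 1) +
      z • restrict (chart S I) (basicField S 2) + e • restrict (chart S I) (basicField S 3) := by
    funext x c
    rw [hX]
    fin_cases c
    · change 0 = k * 0 + y * 0 + z * 0 + e * 0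
      ring
    · change k = k * 1 + y * 0 + z * 0 + e * 0
      ring
    · change y * Real.cos _ + z * Real.sin _ = k * 0 + y * Real.cos _ + z * Real.sin _ + e * 0
      ring
    · change _ / _ * (-y * Real.sin _ + z * Real.cos _) + e =
        k * 0 + y * -(deriv S.h _ / S.h _ * Real.sin _) + z * (deriv S.h _ / S.h _ * Real.cos _)
          + e * 1
      rw [S.deriv_h]
      ring
  rw [key]
  have hm := fun i => Submodule.subset_span (R := ℝ)
    (Set.mem_range_self (f := fun i => restrict (chart S I) (basicField S i)) i)
  exact add_mem (add_mem (add_mem (Submodule.smul_mem _ _ (hm 0)) (Submodule.smul_mem _ _ (hm 1)))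
    (Submodule.smul_mem _ _ (hm 2))) (Submodule.smul_mem _ _ (hm 3))

theorem linearIndependent_basicField (hI' : (I : Set ℝ).Nonempty) :
    LinearIndependent ℝ (fun i => restrict (chart S I) (basicField S i)) := by
  obtain ⟨t, ht⟩ := hI'
  obtain ⟨x, -⟩ := exists_mem_chart (S := S) ht
  have hmem : ∀ φ : ℝ, 0 < φ → φ < 2 * Real.pi → ![t, 0, (x : Fin 4 → ℝ) 2, φ] ∈ chart S I :=
    fun φ h0 h1 => ⟨ht, x.2.2.1, h0, h1⟩
  rw [Fintype.linearIndependent_iff]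
  intro c hc
  have hpi := Real.pi_pos
  have H := fun φ h0 h1 j => congrFun (congrFun hc ⟨_, hmem φ h0 h1⟩) j
  simp only [Fin.sum_univ_four] at H
  have H1 : c 0 * 1 + c 1 * 0 + c 2 * 0 + c 3 * 0 = 0 := H Real.pi hpi (by linarith) 1
  -- The θ-components at φ = π and φ = π/2 isolate the two horizontal rotations; both values lie
  -- inside (0, 2π).
  have H2 : c 0 * 0 + c 1 * Real.cos Real.pi + c 2 * Real.sin Real.pi + c 3 * 0 = 0 :=
    H Real.pi hpi (by linarith) 2
  have H3 : c 0 * 0 + c 1 * Real.cos (Real.pi / 2) + c 2 * Real.sin (Real.pi / 2) + c 3 * 0 = 0 :=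
    H (Real.pi / 2) (by linarith) (by linarith) 2
  have H4 : c 0 * 0 + c 1 * -(deriv S.h _ / S.h _ * Real.sin Real.pi) +
      c 2 * (deriv S.h _ / S.h _ * Real.cos Real.pi) + c 3 * 1 = 0 :=
    H Real.pi hpi (by linarith) 3
  rw [Real.cos_pi, Real.sin_pi] at H2
  rw [Real.cos_pi_div_two, Real.sin_pi_div_two] at H3
  have c0 : c 0 = 0 := by linarith
  have c1 : c 1 = 0 := by linarith
  have c2 : c 2 = 0 := by linarith
  have c3 : c 3 = 0 := by rw [c0, c1, c2] at H4; linarith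
  intro i
  fin_cases i
  exacts [c0, c1, c2, c3]

namespace MetricFunctions

variable (M : MetricFunctions S I A T γ A₀ Ai B Bi h hi Sh Ch Chi g gi)
include M

theorem hi_apply (x : chart S I) : (hi : chart S I → ℝ) x = (S.h ((x : Fin 4 → ℝ) 2))⁻¹ := by
  have := congrFun (congrArg Subtype.val M.frame.h_inv) x
  have h1 : (h : chart S I → ℝ) x * (hi : chart S I → ℝ) x = 1 := this
  rw [M.h_apply] at h1
  exact eq_inv_of_mul_eq_one_right h1

/-- Killing fields with coefficients `k, y, z, e` with respect to the four basic fields. -/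
theorem isConcircularWith_of_apply {X : (Fin 4 → ℝ) → Fin 4 → ℝ} {k y z e : ℝ}
    (hX : ∀ x : chart S I, X x = ![0, k,
      y * Real.cos ((x : Fin 4 → ℝ) 3) + z * Real.sin ((x : Fin 4 → ℝ) 3),
      S.h' ((x : Fin 4 → ℝ) 2) / S.h ((x : Fin 4 → ℝ) 2) *
        (-y * Real.sin ((x : Fin 4 → ℝ) 3) + z * Real.cos ((x : Fin 4 → ℝ) 3)) + e]) :
    IsConcircularWith (chart S I) (metric S A T γ) X 0 0 := by
  obtain ⟨c, hc⟩ : ∃ c : ℝ → smoothAlg (chart S I), c = algebraMap ℝ _ := ⟨_, rfl⟩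
  have dc : ∀ i r, partialD i (c r) = 0 := fun i r => by
    rw [hc]; exact (partialD i).map_algebraMap r
  have E := M.frame.confEqs_of_rotation (k := c k) (e := c e)
    (z := cosφ S I * c y + sinφ S I * c z)
    (fun i hi => by simp [dc, partialD_cosφ, partialD_sinφ, hi])
    (by simp only [map_add, deriv_mul, dc, partialD_cosφ, partialD_sinφ, map_neg, map_zero, if_true]
        ring)
    (fun i => dc i e) (fun i => dc i k)
  refine ⟨(M.isConformalKillingWith_iff (Y := ![0, c k, cosφ S I * c y + sinφ S I * c z,
    hi * partialD 2 h * partialD 3 (cosφ S I * c y + sinφ S I * c z) + c e]) (α₀ := 0) ?_ ?_).2 E,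
    isConcircularWith_zero.2⟩
  · have h3 : partialD 3 (cosφ S I * c y + sinφ S I * c z) = cosφ S I * c z - sinφ S I * c y := by
      simp only [map_add, deriv_mul, dc, partialD_cosφ, partialD_sinφ, if_true]
      ring
    rw [h3]
    intro x j
    rw [hX]
    fin_cases j
    · rfl
    · rw [hc]; rfl
    · rw [hc]
      change y * Real.cos _ + z * Real.sin _ = Real.cos _ * y + Real.sin _ * z
      ring
    · rw [hc]
      change _ / _ * (-y * Real.sin _ + z * Real.cos _) + e = (hi : chart S I → ℝ) x *
        (partialD 2 h : chart S I → ℝ) x * (Real.cos _ * z - Real.sin _ * y) + e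
      rw [M.hi_apply, M.h'_apply]
      ring
  · intro x; rfl

theorem isConcircularWith_basicField (i : Fin 4) :
    IsConcircularWith (chart S I) (metric S A T γ) (basicField S i) 0 0 := by
  fin_cases i
  · refine M.isConcircularWith_of_apply (k := 1) (y := 0) (z := 0) (e := 0) fun x => ?_
    simp [basicField]
  · refine M.isConcircularWith_of_apply (k := 0) (y := 1) (z := 0) (e := 0) fun x => ?_
    simp [basicField, S.deriv_h]
  · refine M.isConcircularWith_of_apply (k := 0) (y := 0) (z := 1) (e := 0) fun x => ?_
    simp [basicField, S.deriv_h]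
  · refine M.isConcircularWith_of_apply (k := 0) (y := 0) (z := 0) (e := 1) fun x => ?_
    simp [basicField]

/-- By `sphere_killing` the r-component is a constant k, the θ-component is y cos φ + z sin φ, and
the φ-component is then fixed up to a constant e; these are the four coefficients. -/
theorem mem_span_of_confEqs (hI : (I : Set ℝ).OrdConnected) {Y : Fin 4 → smoothAlg (chart S I)}
    (hY : Y 0 = 0) (E : ConfEqs partialD A₀ B h (Y 0) (Y 1) (Y 2) (Y 3) 0)
    (h2 : partialD 2 (Y 1) = 0) (h3 : partialD 3 (Y 1) = 0) :
    (fun (x : chart S I) c => (Y c : chart S I → ℝ) x) ∈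
      Submodule.span ℝ (Set.range fun i => restrict (chart S I) (basicField S i)) := by
  rw [hY] at E
  obtain ⟨f0, a0, a1, a2, a3, he⟩ := M.frame.sphere_killing E h2 h3
  have hconv := convex_chart (S := S) hI
  obtain ⟨k, hk⟩ := eq_const_of_partialD_eq_zero hconv f0
  obtain ⟨e, he⟩ := eq_const_of_partialD_eq_zero hconv he
  obtain ⟨y, z, hyz⟩ := exists_eq_cosφ_add_sinφ hI a0 a1 a2 a3
  obtain ⟨c, hc⟩ : ∃ c : ℝ → smoothAlg (chart S I), c = algebraMap ℝ _ := ⟨_, rfl⟩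
  have dc : ∀ r, partialD 3 (c r) = 0 := fun r => by rw [hc]; exact (partialD 3).map_algebraMap r
  rw [← hc] at hk he hyz
  have e3 : partialD 3 (Y 2) = cosφ S I * c z - sinφ S I * c y := by
    rw [hyz]
    simp only [map_add, deriv_mul, dc, partialD_cosφ, partialD_sinφ, if_true]
    ring
  have e4 : Y 3 = hi * partialD 2 h * (cosφ S I * c z - sinφ S I * c y) + c e := by
    rw [← he, ← e3]; ring
  refine mem_span_basicField (k := k) (y := y) (z := z) (e := e) fun x => ?_
  funext j
  fin_cases j
  · change (Y 0 : chart S I → ℝ) x = 0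
    rw [hY]; rfl
  · change (Y 1 : chart S I → ℝ) x = k
    rw [hk, hc]; rfl
  · change (Y 2 : chart S I → ℝ) x = y * Real.cos _ + z * Real.sin _
    rw [hyz, hc]
    change Real.cos _ * y + Real.sin _ * z = _
    ring
  · change (Y 3 : chart S I → ℝ) x = _ / _ * (-y * Real.sin _ + z * Real.cos _) + e
    rw [e4, hc]
    change (hi : chart S I → ℝ) x *
      (partialD 2 h : chart S I → ℝ) x * (Real.cos _ * z - Real.sin _ * y) + e = _
    rw [M.hi_apply, M.h'_apply]
    ring

end MetricFunctions

end Fields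

/-! ### Linearity and injectivity in the fifteen coefficients -/

section ModelMap

variable {R : Type*} [CommRing R] [Algebra ℝ R]

theorem sphereLinear_add (d : Fin 4 → Derivation ℝ R R) (h c s x y z x' y' z' : R) :
    sphereLinear d h c s (x + x') (y + y') (z + z') =
      sphereLinear d h c s x y z + sphereLinear d h c s x' y' z' := by
  simp only [sphereLinear]; ring

theorem sphereLinear_smul (d : Fin 4 → Derivation ℝ R R) (h c s x y z : R) (r : ℝ) :
    sphereLinear d h c s (r • x) (r • y) (r • z) = r • sphereLinear d h c s x y z := by
  simp only [sphereLinear, Algebra.smul_def]; ring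

theorem hyperboloidLinear_add (d : Fin 4 → Derivation ℝ R R) (S C h c s w x y z w' x' y' z' : R) :
    hyperboloidLinear d S C h c s (w + w') (x + x') (y + y') (z + z') =
      hyperboloidLinear d S C h c s w x y z + hyperboloidLinear d S C h c s w' x' y' z' := by
  simp only [hyperboloidLinear, sphereLinear_add]; ring

theorem hyperboloidLinear_smul (d : Fin 4 → Derivation ℝ R R) (S C h c s w x y z : R) (r : ℝ) :
    hyperboloidLinear d S C h c s (r • w) (r • x) (r • y) (r • z) =
      r • hyperboloidLinear d S C h c s w x y z := by
  simp only [hyperboloidLinear, sphereLinear_smul]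
  simp only [Algebra.smul_def]; ring

theorem modelField_add (d : Fin 4 → Derivation ℝ R R) (S C Ci ch sh h hi c s : R)
    (k k' : Fin 15 → R) : modelField d S C Ci ch sh h hi c s (k + k') =
      modelField d S C Ci ch sh h hi c s k + modelField d S C Ci ch sh h hi c s k' := by
  funext i
  fin_cases i <;> simp only [modelField, Pi.add_apply, hyperboloidLinear_add, sphereLinear_add,
    map_add, deriv_mul, Fin.zero_eta, Fin.mk_one, Fin.reduceFinMk, Matrix.cons_val] <;> ring

theorem modelField_smul (d : Fin 4 → Derivation ℝ R R) (S C Ci ch sh h hi c s : R)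
    (r : ℝ) (k : Fin 15 → R) : modelField d S C Ci ch sh h hi c s (r • k) =
      r • modelField d S C Ci ch sh h hi c s k := by
  have e : c * r • k 12 + s * r • k 13 = r • (c * k 12 + s * k 13) := by
    simp only [Algebra.smul_def]; ring
  funext i
  fin_cases i <;> simp only [modelField, Pi.smul_apply, hyperboloidLinear_smul, sphereLinear_smul,
    e, Derivation.map_smul, Fin.zero_eta, Fin.mk_one, Fin.reduceFinMk, Matrix.cons_val] <;>
    simp only [Algebra.smul_def] <;> ring

/-- The linear map from the coefficients to the components of `modelField`. -/
def modelMap (d : Fin 4 → Derivation ℝ R R) (S C Ci ch sh h hi c s : R) :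
    (Fin 15 → ℝ) →ₗ[ℝ] Fin 4 → R where
  toFun k := modelField d S C Ci ch sh h hi c s fun j => algebraMap ℝ R (k j)
  map_add' k k' := by
    rw [← modelField_add]
    congr 1
    funext j
    exact map_add _ _ _
  map_smul' r k := by
    rw [RingHom.id_apply, ← modelField_smul]
    congr 1
    funext j
    simp [Algebra.smul_def]

/-- Multiplication of the components by given functions. -/
def scaleMap (u : Fin 4 → R) : (Fin 4 → R) →ₗ[ℝ] Fin 4 → R :=
  LinearMap.mulLeft ℝ u

theorem SphericalFrame.modelMap_injective {d : Fin 4 → Derivation ℝ R R}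
    {S C Ci ch sh h hi c s : R} (W : SphericalFrame d S C Ci ch sh h hi c s)
    (hR : Function.Injective (algebraMap ℝ R)) :
    Function.Injective (modelMap d S C Ci ch sh h hi c s) := by
  refine (injective_iff_map_eq_zero _).2 fun k hk => ?_
  have := W.eq_zero_of_modelField_eq_zero (k := fun j => algebraMap ℝ R (k j))
    (fun j i => (d i).map_algebraMap _) hk
  funext j
  exact hR ((congrFun this j).trans (map_zero _).symm)

end ModelMap

/-! ### Dimension fifteen and the span of the concircular fields -/

section Fields

variable {S : SpacetimeType} {I : TopologicalSpace.Opens ℝ} {A T : ℝ → ℝ} {γ : ℝ}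
  {A₀ Ai B Bi h hi Sh Ch Chi g gi : smoothAlg (chart S I)}

/-- The vector field with given smooth components. -/
def toField {n : ℕ} (U : TopologicalSpace.Opens (Fin n → ℝ)) :
    (Fin n → smoothAlg U) →ₗ[ℝ] U → Fin n → ℝ where
  toFun Y x c := (Y c : U → ℝ) x
  map_add' _ _ := rfl
  map_smul' _ _ := rfl

theorem toField_injective {n : ℕ} (U : TopologicalSpace.Opens (Fin n → ℝ)) :
    Function.Injective (toField U) := fun _ _ h =>
  funext fun c => smoothAlg_ext fun x => congrFun (congrFun h x) c

theorem exists_extension {n : ℕ} {U : TopologicalSpace.Opens (Fin n → ℝ)}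
    (Y : Fin n → smoothAlg U) : ∃ X : (Fin n → ℝ) → Fin n → ℝ, restrict U X = toField U Y ∧
      ∀ (x : U) c, X x c = (Y c : U → ℝ) x :=
  ⟨fun x c => rep (Y c) x, funext fun x => funext fun c => rep_apply (Y c) x,
    fun x c => rep_apply (Y c) x⟩

theorem chart_nonempty (hI' : (I : Set ℝ).Nonempty) : Nonempty (chart S I) := by
  obtain ⟨t, ht⟩ := hI'
  exact ⟨(exists_mem_chart (S := S) ht).choose⟩

theorem algebraMap_smoothAlg_injective {n : ℕ} {U : TopologicalSpace.Opens (Fin n → ℝ)}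
    [Nonempty U] : Function.Injective (algebraMap ℝ (smoothAlg U)) := fun _ _ h =>
  congrFun (congrArg Subtype.val h) (Classical.arbitrary U)

/-- The hyperbolic cosine of `γ r`. -/
def coshr (S : SpacetimeType) (I : TopologicalSpace.Opens ℝ) (γ : ℝ) : smoothAlg (chart S I) :=
  ofFun (fun x => Real.cosh (γ * x 1))
    (contDiffOn_coord (φ := fun r => Real.cosh (γ * r))
      (Real.contDiff_cosh.comp (contDiff_const.mul contDiff_id)).contDiffOn 1 fun _ _ => mem_univ _)

/-- The hyperbolic sine of `γ r`. -/
def sinhr (S : SpacetimeType) (I : TopologicalSpace.Opens ℝ) (γ : ℝ) : smoothAlg (chart S I) :=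
  ofFun (fun x => Real.sinh (γ * x 1))
    (contDiffOn_coord (φ := fun r => Real.sinh (γ * r))
      (Real.contDiff_sinh.comp (contDiff_const.mul contDiff_id)).contDiffOn 1 fun _ _ => mem_univ _)

theorem partialD_coshr (i : Fin 4) :
    partialD i (coshr S I γ) = if i = 1 then algebraMap ℝ _ γ * sinhr S I γ else 0 := by
  refine smoothAlg_ext fun x => ?_
  rw [partialD_of_apply_coord (φ := fun r => Real.cosh (γ * r))
    (φ' := fun r => Real.sinh (γ * r) * (γ * 1)) (j := 1) (fun _ => rfl)
    (fun y _ => ((hasDerivAt_id _).const_mul γ).cosh)]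
  split_ifs
  · change _ = γ * Real.sinh _
    ring
  · rfl

theorem partialD_sinhr (i : Fin 4) :
    partialD i (sinhr S I γ) = if i = 1 then algebraMap ℝ _ γ * coshr S I γ else 0 := by
  refine smoothAlg_ext fun x => ?_
  rw [partialD_of_apply_coord (φ := fun r => Real.sinh (γ * r))
    (φ' := fun r => Real.cosh (γ * r) * (γ * 1)) (j := 1) (fun _ => rfl)
    (fun y _ => ((hasDerivAt_id _).const_mul γ).sinh)]
  split_ifs
  · change _ = γ * Real.cosh _
    ring
  · rfl

theorem coshr_sq_sub_sinhr_sq : coshr S I γ ^ 2 - sinhr S I γ ^ 2 = 1 :=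
  smoothAlg_ext fun _ => Real.cosh_sq_sub_sinh_sq _

/-- The derivations along `dτ = γ dt / A`, `dρ = γ dr`, `dθ`, `dφ`. -/
def rescaledD (A₀ gi : smoothAlg (chart S I)) :
    Fin 4 → Derivation ℝ (smoothAlg (chart S I)) (smoothAlg (chart S I)) :=
  ![(A₀ * gi) • partialD 0, gi • partialD 1, partialD 2, partialD 3]

theorem rescaledD_zero (x : smoothAlg (chart S I)) :
    rescaledD A₀ gi 0 x = A₀ * gi * partialD 0 x := rfl
theorem rescaledD_one (x : smoothAlg (chart S I)) :
    rescaledD A₀ gi 1 x = gi * partialD 1 x := rfl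
theorem rescaledD_two (x : smoothAlg (chart S I)) : rescaledD A₀ gi 2 x = partialD 2 x := rfl
theorem rescaledD_three (x : smoothAlg (chart S I)) : rescaledD A₀ gi 3 x = partialD 3 x := rfl

namespace MetricFunctions

section

variable (M : MetricFunctions S I A T γ A₀ Ai B Bi h hi Sh Ch Chi g gi)
include M

theorem partialD_gi (i : Fin 4) : partialD i gi = 0 := by
  rw [deriv_inv M.g_inv, M.dg, mul_zero]

theorem rescaledD_comm (i j : Fin 4) (x : smoothAlg (chart S I)) :
    rescaledD A₀ gi i (rescaledD A₀ gi j x) = rescaledD A₀ gi j (rescaledD A₀ gi i x) := by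
  have h1 := M.frame.d1A
  have h2 := M.frame.d2A
  have h3 := M.frame.d3A
  have hg := M.partialD_gi
  have c01 := partialD_comm 0 1 x
  have c02 := partialD_comm 0 2 x
  have c03 := partialD_comm 0 3 x
  have c12 := partialD_comm 1 2 x
  have c13 := partialD_comm 1 3 x
  have c23 := partialD_comm 2 3 x
  fin_cases i <;> fin_cases j <;> simp only [Fin.zero_eta, Fin.mk_one, Fin.reduceFinMk,
    rescaledD_zero, rescaledD_one, rescaledD_two, rescaledD_three, deriv_mul, hg, h1, h2, h3,
    c01, c02, c03, c12, c13, c23] <;> ring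

theorem eq_const_of_rescaledD_eq_zero (hI : (I : Set ℝ).OrdConnected) {f : smoothAlg (chart S I)}
    (hf : ∀ i, rescaledD A₀ gi i f = 0) : ∃ c, f = algebraMap ℝ _ c := by
  have hg : gi * g = 1 := by rw [mul_comm, M.g_inv]
  refine eq_const_of_partialD_eq_zero (convex_chart hI) fun i => ?_
  have := hf i
  fin_cases i
  · refine eq_zero_of_mul_eq (a := A₀ * gi) (ai := Ai * g) ?_ this
    linear_combination M.frame.A_inv + A₀ * Ai * hg
  · exact eq_zero_of_mul_eq hg this
  · exact this
  · exact this

end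

theorem sphericalFrame {A₀ Ai B Bi h hi Sh Ch Chi g gi : smoothAlg (chart .kantowskiSachs I)}
    (M : MetricFunctions .kantowskiSachs I A T γ A₀ Ai B Bi h hi Sh Ch Chi g gi) :
    SphericalFrame (rescaledD A₀ gi) Sh Ch Chi (coshr _ I γ) (sinhr _ I γ) h hi
      (cosφ _ I) (sinφ _ I) := by
  have hsign : algebraMap ℝ (smoothAlg (chart .kantowskiSachs I))
      SpacetimeType.kantowskiSachs.sign = -1 := by
    rw [SpacetimeType.sign, map_neg, map_one]
  have hg := M.g_eq
  have hgi := M.g_inv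
  exact
    { comm := M.rescaledD_comm
      A_inv := one_mul 1
      B_inv := M.Ch_inv
      h_inv := M.frame.h_inv
      d1A := deriv_one _
      d2A := deriv_one _
      d3A := deriv_one _
      d1B := by rw [rescaledD_one, M.diCh 1 (by decide), mul_zero]
      d2B := by rw [rescaledD_two, M.diCh 2 (by decide)]
      d3B := by rw [rescaledD_three, M.diCh 3 (by decide)]
      d0h := by rw [rescaledD_zero, M.frame.d0h, mul_zero]
      d1h := by rw [rescaledD_one, M.frame.d1h, mul_zero]
      d3h := M.frame.d3h
      d2d2h := M.frame.d2d2h.trans (by rw [hsign])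
      pyth := (show partialD 2 h ^ 2 - -1 * h ^ 2 = 1 by rw [← hsign]; exact M.frame.pyth)
      d0C := by rw [rescaledD_zero]; linear_combination gi * M.dCh + Sh * hgi
      d0S := by rw [rescaledD_zero]; linear_combination gi * M.dSh + Ch * hgi
      d1S := by rw [rescaledD_one, M.diSh 1 (by decide), mul_zero]
      d2S := by rw [rescaledD_two, M.diSh 2 (by decide)]
      d3S := by rw [rescaledD_three, M.diSh 3 (by decide)]
      hCS := M.Ch_sq
      d0ch := by rw [rescaledD_zero, partialD_coshr, if_neg (by decide), mul_zero]
      d1ch := by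
        rw [rescaledD_one, partialD_coshr, if_pos rfl, ← hg]
        linear_combination sinhr _ I γ * hgi
      d2ch := by rw [rescaledD_two, partialD_coshr, if_neg (by decide)]
      d3ch := by rw [rescaledD_three, partialD_coshr, if_neg (by decide)]
      d0sh := by rw [rescaledD_zero, partialD_sinhr, if_neg (by decide), mul_zero]
      d1sh := by
        rw [rescaledD_one, partialD_sinhr, if_pos rfl, ← hg]
        linear_combination coshr _ I γ * hgi
      d2sh := by rw [rescaledD_two, partialD_sinhr, if_neg (by decide)]
      d3sh := by rw [rescaledD_three, partialD_sinhr, if_neg (by decide)]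
      hch := coshr_sq_sub_sinhr_sq
      d0c := by rw [rescaledD_zero, partialD_cosφ, if_neg (by decide), mul_zero]
      d1c := by rw [rescaledD_one, partialD_cosφ, if_neg (by decide), mul_zero]
      d2c := by rw [rescaledD_two, partialD_cosφ, if_neg (by decide)]
      d3c := by rw [rescaledD_three, partialD_cosφ, if_pos rfl]
      d0s := by rw [rescaledD_zero, partialD_sinφ, if_neg (by decide), mul_zero]
      d1s := by rw [rescaledD_one, partialD_sinφ, if_neg (by decide), mul_zero]
      d2s := by rw [rescaledD_two, partialD_sinφ, if_neg (by decide)]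
      d3s := by rw [rescaledD_three, partialD_sinφ, if_pos rfl]
      hcs := cosφ_sq_add_sinφ_sq }

section

variable {A₀ Ai B Bi h hi Sh Ch Chi g gi : smoothAlg (chart .kantowskiSachs I)}
  (M : MetricFunctions .kantowskiSachs I A T γ A₀ Ai B Bi h hi Sh Ch Chi g gi)
include M

/-- Scaling by (A/γ, 1/γ, 1, 1) turns components along ∂_τ, ∂_ρ into components along ∂_t, ∂_r; by
`confEqs_conformal_iff` a conformal change of metric keeps the field conformal Killing. -/
theorem toField_mem_conformalKillingFields (k : Fin 15 → ℝ) :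
    toField _ (scaleMap ![gi * A₀, gi, 1, 1] (modelMap (rescaledD A₀ gi) Sh Ch Chi (coshr _ I γ)
      (sinhr _ I γ) h hi (cosφ _ I) (sinφ _ I) k)) ∈
      conformalKillingFields (chart .kantowskiSachs I) (metric .kantowskiSachs A T γ) := by
  obtain ⟨m, hm⟩ : ∃ m, m = modelMap (rescaledD A₀ gi) Sh Ch Chi (coshr _ I γ)
      (sinhr _ I γ) h hi (cosφ _ I) (sinφ _ I) k := ⟨_, rfl⟩
  obtain ⟨α, E⟩ := M.sphericalFrame.confEqs_modelField
    (k := fun j => algebraMap ℝ _ (k j)) fun j i => (rescaledD A₀ gi i).map_algebraMap _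
  have hm' : modelField (rescaledD A₀ gi) Sh Ch Chi (coshr _ I γ) (sinhr _ I γ) h hi (cosφ _ I)
      (sinφ _ I) (fun j => algebraMap ℝ _ (k j)) = m := hm.symm
  rw [hm'] at E
  rw [← hm]
  have hgi := M.g_inv
  have hA := M.frame.A_inv
  obtain ⟨q, hq⟩ : ∃ q, q = gi * A₀ * m 0 := ⟨_, rfl⟩
  obtain ⟨f, hf⟩ : ∃ f, f = gi * m 1 := ⟨_, rfl⟩
  have e0 : m 0 = g * Ai * q := by
    rw [hq]; linear_combination -m 0 * hA - m 0 * A₀ * Ai * hgi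
  have e1 : m 1 = g * f := by rw [hf]; linear_combination -m 1 * hgi
  have eα : α = (α + Ai * partialD 0 A₀ * q) - Ai * partialD 0 A₀ * q := by ring
  rw [e0, e1, eα] at E
  have E' := (M.frame.confEqs_conformal_iff hgi M.dg M.gB).1 E
  obtain ⟨X, hX, hX'⟩ := exists_extension (scaleMap ![gi * A₀, gi, 1, 1] m)
  rw [← hX]
  refine Submodule.mem_map_of_mem ⟨rep (α + Ai * partialD 0 A₀ * q),
    (M.isConformalKillingWith_iff hX' (rep_apply _)).2 ?_⟩
  have s0 : scaleMap ![gi * A₀, gi, 1, 1] m 0 = q := hq.symm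
  have s1 : scaleMap ![gi * A₀, gi, 1, 1] m 1 = f := hf.symm
  have s2 : scaleMap ![gi * A₀, gi, 1, 1] m 2 = m 2 := one_mul _
  have s3 : scaleMap ![gi * A₀, gi, 1, 1] m 3 = m 3 := one_mul _
  rw [s0, s1, s2, s3]
  exact E'

theorem exists_toField_eq (hI : (I : Set ℝ).OrdConnected) {X : (Fin 4 → ℝ) → Fin 4 → ℝ}
    {α : (Fin 4 → ℝ) → ℝ}
    (H : IsConformalKillingWith (chart .kantowskiSachs I) (metric .kantowskiSachs A T γ) X α) :
    ∃ k, toField _ (scaleMap ![gi * A₀, gi, 1, 1] (modelMap (rescaledD A₀ gi) Sh Ch Chi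
      (coshr _ I γ) (sinhr _ I γ) h hi (cosφ _ I) (sinφ _ I) k)) = restrict _ X := by
  obtain ⟨Y, hY⟩ : ∃ Y, Y = component X H.1 := ⟨_, rfl⟩
  have hX : ∀ (x : chart .kantowskiSachs I) c, X x c = (Y c : chart .kantowskiSachs I → ℝ) x :=
    fun x c => by rw [hY]; rfl
  have E := (M.isConformalKillingWith_iff (α₀ := ofFun α H.2.1) hX fun x => rfl).1 H
  have hgi := M.g_inv
  have hA := M.frame.A_inv
  obtain ⟨k, hk, e⟩ := M.sphericalFrame.exists_modelField
    ((M.frame.confEqs_conformal_iff hgi M.dg M.gB).2 E)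
  choose c hc using fun j => M.eq_const_of_rescaledD_eq_zero hI (hk j)
  obtain rfl : k = fun j => algebraMap ℝ _ (c j) := funext hc
  refine ⟨c, ?_⟩
  rw [show modelMap (rescaledD A₀ gi) Sh Ch Chi (coshr _ I γ) (sinhr _ I γ) h hi (cosφ _ I)
    (sinφ _ I) c = _ from e.symm]
  have key : scaleMap ![gi * A₀, gi, 1, 1] ![g * Ai * Y 0, g * Y 1, Y 2, Y 3] = Y := by
    funext i
    fin_cases i
    · change gi * A₀ * (g * Ai * Y 0) = Y 0
      linear_combination Y 0 * hA + Y 0 * A₀ * Ai * hgi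
    · change gi * (g * Y 1) = Y 1
      linear_combination Y 1 * hgi
    · exact one_mul _
    · exact one_mul _
  rw [key]
  exact funext fun x => funext fun i => (hX x i).symm

theorem finrank_conformalKillingFields (hI : (I : Set ℝ).OrdConnected)
    (hI' : (I : Set ℝ).Nonempty) :
    Module.finrank ℝ (conformalKillingFields (chart .kantowskiSachs I)
      (metric .kantowskiSachs A T γ)) = 15 := by
  obtain ⟨Φ, hΦ⟩ : ∃ Φ, Φ = toField _ ∘ₗ scaleMap ![gi * A₀, gi, 1, 1] ∘ₗ
    modelMap (rescaledD A₀ gi) Sh Ch Chi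
      (coshr _ I γ) (sinhr _ I γ) h hi (cosφ _ I) (sinφ _ I) := ⟨_, rfl⟩
  have hrange : conformalKillingFields (chart .kantowskiSachs I) (metric .kantowskiSachs A T γ)
      = LinearMap.range Φ := by
    refine le_antisymm ?_ ?_
    · rintro _ ⟨X, ⟨α, H⟩, rfl⟩
      obtain ⟨k, hk⟩ := M.exists_toField_eq hI H
      exact ⟨k, by rw [hΦ]; exact hk⟩
    · rintro _ ⟨k, rfl⟩
      rw [hΦ]
      exact M.toField_mem_conformalKillingFields k
  have hinj : Function.Injective Φ := by
    -- On an empty chart all constants would coincide; nonemptiness makes the coefficients visible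
    -- in the ring.
    have := chart_nonempty (S := .kantowskiSachs) hI'
    rw [hΦ, LinearMap.coe_comp, LinearMap.coe_comp]
    refine (toField_injective _).comp (Function.Injective.comp ?_
      (M.sphericalFrame.modelMap_injective algebraMap_smoothAlg_injective))
    have hA := M.frame.A_inv
    have hgi := M.g_inv
    refine Function.LeftInverse.injective (g := scaleMap ![g * Ai, g, 1, 1]) fun m => ?_
    funext i
    fin_cases i
    · change g * Ai * (gi * A₀ * m 0) = m 0
      linear_combination m 0 * hA + m 0 * A₀ * Ai * hgi
    · change g * (gi * m 1) = m 1
      linear_combination m 1 * hgi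
    · change 1 * (1 * m 2) = m 2
      ring
    · change 1 * (1 * m 3) = m 3
      ring
  rw [hrange, LinearMap.finrank_range_of_inj hinj, Module.finrank_fin_fun]

end

section

variable (M : MetricFunctions S I A T γ A₀ Ai B Bi h hi Sh Ch Chi g gi)
include M

theorem concircular_eq_zero_and_mem_span (hI : (I : Set ℝ).OrdConnected)
    (hI' : (I : Set ℝ).Nonempty)
    (h1 : S = .kantowskiSachs → ¬ ∃ c, ∀ t ∈ I, A t = c)
    (h2 : ¬ ∃ c, ∀ t ∈ I, A t / γ * Real.cosh (γ * T t) = c)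
    (h3 : ¬ ∀ t ∈ I, deriv A t * Real.sinh (γ * T t) + γ * Real.cosh (γ * T t) = 0)
    {X : (Fin 4 → ℝ) → Fin 4 → ℝ} {α β : (Fin 4 → ℝ) → ℝ}
    (H : IsConcircularWith (chart S I) (metric S A T γ) X α β) :
    (∀ x ∈ chart S I, α x = 0 ∧ β x = 0) ∧ restrict (chart S I) X ∈
      Submodule.span ℝ (Set.range fun i => restrict (chart S I) (basicField S i)) := by
  obtain ⟨Y, hY⟩ : ∃ Y, Y = component X H.1.1 := ⟨_, rfl⟩
  have hX : ∀ (x : chart S I) c, X x c = (Y c : chart S I → ℝ) x :=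
    fun x c => by rw [hY]; rfl
  have E := (M.isConformalKillingWith_iff (α₀ := ofFun α H.1.2.1) hX fun x => rfl).1 H.1
  obtain ⟨β₀, hβ, hH⟩ := M.hessEqs_of_isConcircularWith H
  obtain ⟨hα, hβ0, q0, f2, f3⟩ := M.concircular_eq_zero hI hI' h1 h2 h3 E hH
  refine ⟨fun x hx => ⟨congrFun (congrArg Subtype.val hα) ⟨x, hx⟩, ?_⟩, ?_⟩
  · rw [hβ ⟨x, hx⟩, hβ0]; rfl
  · rw [hα] at E
    have := M.mem_span_of_confEqs hI q0 E f2 f3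
    have hr : restrict (chart S I) X = fun (x : chart S I) c => (Y c : chart S I → ℝ) x :=
      funext fun x => funext fun c => hX x c
    rw [hr]
    exact this

theorem concircularFields_eq_span (hI : (I : Set ℝ).OrdConnected) (hI' : (I : Set ℝ).Nonempty)
    (h1 : S = .kantowskiSachs → ¬ ∃ c, ∀ t ∈ I, A t = c)
    (h2 : ¬ ∃ c, ∀ t ∈ I, A t / γ * Real.cosh (γ * T t) = c)
    (h3 : ¬ ∀ t ∈ I, deriv A t * Real.sinh (γ * T t) + γ * Real.cosh (γ * T t) = 0) :
    concircularFields (chart S I) (metric S A T γ) =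
      Submodule.span ℝ (Set.range fun i => restrict (chart S I) (basicField S i)) := by
  refine le_antisymm ?_ (Submodule.span_le.2 ?_)
  · rintro _ ⟨X, ⟨α, β, H⟩, rfl⟩
    exact (M.concircular_eq_zero_and_mem_span hI hI' h1 h2 h3 H).2
  · rintro _ ⟨i, rfl⟩
    exact Submodule.mem_map_of_mem ⟨0, 0, M.isConcircularWith_basicField i⟩

end

end MetricFunctions

end Fields

end Concircular

end

theorem mainTheorem3 (S : Concircular.SpacetimeType)
    (I : TopologicalSpace.Opens ℝ) (hI : (I : Set ℝ).OrdConnected) (hI' : (I : Set ℝ).Nonempty)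
    (A T : ℝ → ℝ) (γ : ℝ) (hγ : γ ≠ 0)
    (hA : ContDiffOn ℝ ∞ A I) (hA0 : ∀ t ∈ I, A t ≠ 0)
    (hT : ∀ t ∈ I, HasDerivAt T (1 / A t) t) :
    -- the four fields are linearly independent and always concircular with vanishing factors
    LinearIndependent ℝ (fun i =>
      Concircular.restrict (Concircular.chart S I) (Concircular.basicField S i)) ∧
    (∀ i, Concircular.IsConcircularWith (Concircular.chart S I) (Concircular.metric S A T γ)
      (Concircular.basicField S i) 0 0) ∧
    -- in the Kantowski-Sachs case there are fifteen conformal Killing vector fields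
    (S = .kantowskiSachs →
      Module.finrank ℝ (Concircular.conformalKillingFields (Concircular.chart S I)
        (Concircular.metric S A T γ)) = 15) ∧
    -- outside the exceptional cases there are no further concircular vector fields
    ((S = .kantowskiSachs → ¬ ∃ c, ∀ t ∈ I, A t = c) →
      (¬ ∃ c, ∀ t ∈ I, A t / γ * Real.cosh (γ * T t) = c) →
      (¬ ∀ t ∈ I, deriv A t * Real.sinh (γ * T t) + γ * Real.cosh (γ * T t) = 0) →
      Module.finrank ℝ (Concircular.concircularFields (Concircular.chart S I)
        (Concircular.metric S A T γ)) = 4 ∧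
      Concircular.concircularFields (Concircular.chart S I) (Concircular.metric S A T γ) =
        Submodule.span ℝ (Set.range fun i =>
          Concircular.restrict (Concircular.chart S I) (Concircular.basicField S i)) ∧
      ∀ X α β, Concircular.IsConcircularWith (Concircular.chart S I)
          (Concircular.metric S A T γ) X α β →
        ∀ x ∈ Concircular.chart S I, α x = 0 ∧ β x = 0) := by
  obtain ⟨A₀, Ai, B, Bi, h, hi, Sh, Ch, Chi, g, gi, M⟩ :=
    Concircular.exists_metricFunctions (S := S) hγ hA hA0 hT
  have hL := Concircular.linearIndependent_basicField (S := S) hI'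
  refine ⟨hL, M.isConcircularWith_basicField, ?_, fun h1 h2 h3 => ?_⟩
  · rintro rfl
    exact M.finrank_conformalKillingFields hI hI'
  · have hspan := M.concircularFields_eq_span hI hI' h1 h2 h3
    refine ⟨?_, hspan, fun X α β H x hx =>
      (M.concircular_eq_zero_and_mem_span hI hI' h1 h2 h3 H).1 x hx⟩
    rw [hspan, finrank_span_eq_card hL, Fintype.card_fin]
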